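/- **Setting.** Let $L,R,r>0$ with $Lr\le \tfrac12$. A probability distribution $\mathcal D$ on $\mathbb R$ is *$(L,R,r)$-admissible* if it has a unique median $m(\mathcal D)$, $m(\mathcal D)\in[-R,R]$, and on $[m(\mathcal D)-r,m(\mathcal D)+r]$ it has a Lebesgue density $f$ with $f\ge L$ there. For $X\in\mathbb R^n$, $n\ge 1$, let $m(X)=X_{(\lfloor n/2\rfloor)}$ be the left empirical median, where $X_{(1)}\le\dots\le X_{(n)}$ are the sorted entries (for $n=1$, $m(X)=X_1$), and let $d_H$ be the Hamming distance on $\mathbb R^n$. For $C>0$ and $\epsilon\in(0,1)$ define: * the typical set $\mathcal H=\mathcal H_C\subseteq\mathbb R^n$ of all $X$ with $m(X)\in[-R-\frac r2,R+\frac r2]$ such that, for every integer $1\le\kappa\le \frac{Lnr}{2C}$, at least $\kappa+1$ indices $i$ satisfy $X_i-m(X)\in[0,\frac{\kappa C}{Ln}]$ and at least $\kappa+1$ indices $i$ satisfy $m(X)-X_i\in[0,\frac{\kappa C}{Ln}]$; * the flattened Laplace mechanism, whose output on $X$ has density on $\mathcal I=[-R-4Cr,R+4Cr]$ (and $0$ outside)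 given by $$f_{\hat{\mathcal A}(X)}(\omega)=\frac{\exp\left(-\frac\epsilon4\min\{\frac{Ln}{3C}|m(X)-\omega|,\,Lrn\}\right)}{\int_{\mathcal I}\exp\left(-\frac\epsilon4\min\{\frac{Ln}{3C}|m(X)-\omega'|,\,Lrn\}\right)d\omega'};$$ * the algorithm $\mathcal A=\mathcal A_{C,\epsilon,L,R,r}$ given by the Extension Lemma construction applied to $\hat{\mathcal A}$ on $\mathcal H$: for $X\in\mathbb R^n$, the output $\mathcal A(X)$ has density $$f_{\mathcal A(X)}(\omega)=\frac1{Z_X}\inf_{X'\in\mathcal H}\left[e^{\frac\epsilon2 d_H(X,X')}f_{\hat{\mathcal A}(X')}(\omega)\right],\qquad \omega\in\mathbb R,$$ with $Z_X$ the normalizing constant. **Theorem.** There is an absolute constant $C_0>0$ such that the following hold. Below, $\epsilon\in(0,1)$, $L,R,r>0$ with $Lr\le\frac12$, an $(L,R,r)$-admissible $\mathcal D$, and $\alpha\in(0,r)$ are arbitrary; probabilities are over i.i.d. samples $X_1,\dots,X_n\sim\mathcal D$ and the randomness of $\mathcal A$. 1. For every $C\ge C_0$ and $n\ge1$, $\mathcal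 A$ is a well-defined randomized algorithm on $\mathbb R^n$ (a Markov kernel), and it is $\epsilon$-differentially private: $\mathbb P(\mathcal A(X)\in S)\le e^{\epsilon d_H(X,Y)}\,\mathbb P(\mathcal A(Y)\in S)$ for all $X,Y\in\mathbb R^n$ and Borel $S\subseteq\mathbb R$. 2. (Constant $C$.) For every $C\ge C_0$ there is $K=K(C)>0$ such that for all $\beta\in(0,1)$ and all $$n\ \ge\ K\left(\frac{\log(1/\beta)}{L^2\alpha^2}+\frac{\log(1/\beta)}{\epsilon L\alpha}+\frac{\log(R/\alpha+1)}{\epsilon Lr}\right)$$ one has $\mathbb P\left[|\mathcal A(X_1,\dots,X_n)-m(\mathcal D)|\ge\alpha\right]\le\beta$. 3. ($C$ possibly scaling with $n$.) For every $b\in(0,1)$ there is $K=K(b)>0$ such that for every sequence $(C_n)$ with $C_n\ge C_0$ for all $n$, all $\beta\in(0,b]$ and all $$n\ \ge\ K\left(\frac{\log(1/\beta)}{L^2\alpha^2}+C_n\frac{\log(1/\beta)}{\epsilon L\alpha}+\frac{\log(R/\alpha+1)}{\epsilon Lr}\right)$$ the algorithm $\mathcal A$ with $C=C_n$ satisfies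 $\mathbb P\left[|\mathcal A(X_1,\dots,X_n)-m(\mathcal D)|\ge\alpha\right]\le\beta$. -/

import Mathlib

open MeasureTheory Set

namespace PrivateMedian

/-- `m` is a median of the distribution `D`. -/
def IsMedian (D : Measure ℝ) (m : ℝ) : Prop :=
  1 / 2 ≤ D (Iic m) ∧ 1 / 2 ≤ D (Ici m)

/-- `D` is admissible with parameters `L, R, r`, and `m` is its median: `m` is the unique median
of `D`, it lies in `[-R, R]`, and on `[m - r, m + r]` the distribution has a Lebesgue density
which is at least `L` there. -/
structure IsAdmissible (L R r : ℝ) (D : Measure ℝ) (m : ℝ) : Prop where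
  isMedian : IsMedian D m
  unique : ∀ m', IsMedian D m' → m' = m
  mem_Icc : m ∈ Icc (-R) R
  density : ∃ f : ℝ → ENNReal, Measurable f ∧
    D.restrict (Icc (m - r) (m + r)) = (volume.restrict (Icc (m - r) (m + r))).withDensity f ∧
    ∀ u ∈ Icc (m - r) (m + r), ENNReal.ofReal L ≤ f u

/-- The left empirical median of `x = (x_1, ..., x_n)`: the order statistic `x_(ℓ)` of rank
`ℓ = ⌊n/2⌋`. `Tuple.sort x` is the permutation that sorts `x` in nondecreasing order, and
positions are counted from `0`, so rank `ℓ` is position `ℓ - 1`. For `n = 1`, where `⌊n/2⌋ = 0`,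
this is the only entry of `x`. -/
noncomputable def leftMedian {n : ℕ} (x : Fin n → ℝ) : ℝ :=
  if h : 0 < n then x (Tuple.sort x ⟨n / 2 - 1, by omega⟩) else 0

/-- The typical set `H_C`. -/
def typicalSet (C L R r : ℝ) (n : ℕ) : Set (Fin n → ℝ) :=
  {X | (∀ κ : ℕ, 1 ≤ κ → (κ : ℝ) ≤ L * n * r / (2 * C) →
          κ + 1 ≤ (Finset.univ.filter fun i : Fin n =>
            0 ≤ X i - leftMedian X ∧ X i - leftMedian X ≤ κ * C / (L * n)).card ∧
          κ + 1 ≤ (Finset.univ.filter fun i : Fin n =>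
            0 ≤ leftMedian X - X i ∧ leftMedian X - X i ≤ κ * C / (L * n)).card) ∧
        leftMedian X ∈ Icc (-R - r / 2) (R + r / 2)}

/-- The interval of possible outputs, `[-R - 4Cr, R + 4Cr]`. -/
def outputInterval (C R r : ℝ) : Set ℝ := Icc (-R - 4 * C * r) (R + 4 * C * r)

/-- The unnormalized density of the flattened Laplace mechanism on input `X`. -/
noncomputable def flattenedLaplaceWeight (C ε L r : ℝ) {n : ℕ} (X : Fin n → ℝ) (ω : ℝ) : ℝ :=
  Real.exp (-(ε / 4) * min (L * n / (3 * C) * |leftMedian X - ω|) (L * r * n))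

/-- The density of the flattened Laplace mechanism on input `X`. -/
noncomputable def flattenedLaplaceDensity (C ε L R r : ℝ) {n : ℕ} (X : Fin n → ℝ) : ℝ → ℝ :=
  (outputInterval C R r).indicator fun ω =>
    flattenedLaplaceWeight C ε L r X ω /
      ∫ ω' in outputInterval C R r, flattenedLaplaceWeight C ε L r X ω'

/-- For output densities `f X'`, given for inputs `X' ∈ H`, the unnormalized output density
`inf_{X' ∈ H} exp (η d_H(X, X')) f_{X'}(ω)` of the Extension Lemma on an arbitrary input `X`. -/
noncomputable def extensionWeight {n : ℕ} (H : Set (Fin n → ℝ)) (f : (Fin n → ℝ) → ℝ → ℝ)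
    (η : ℝ) (X : Fin n → ℝ) (ω : ℝ) : ℝ :=
  ⨅ X' : H, Real.exp (η * (hammingDist X (X' : Fin n → ℝ) : ℝ)) * f X' ω

/-- The output distribution of the extended mechanism of the Extension Lemma. -/
noncomputable def extension {n : ℕ} (H : Set (Fin n → ℝ)) (f : (Fin n → ℝ) → ℝ → ℝ)
    (η : ℝ) (X : Fin n → ℝ) : Measure ℝ :=
  volume.withDensity fun ω =>
    ENNReal.ofReal (extensionWeight H f η X ω / ∫ ω', extensionWeight H f η X ω')

/-- The algorithm `A`, as the map from inputs to output distributions: the extension, with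
parameter `ε / 2`, of the flattened Laplace mechanism from the typical set to `ℝⁿ`. -/
noncomputable def algorithm (C ε L R r : ℝ) {n : ℕ} : (Fin n → ℝ) → Measure ℝ :=
  extension (typicalSet C L R r n) (flattenedLaplaceDensity C ε L R r) (ε / 2)

/-- `A` is a randomized algorithm with real output: a Markov kernel from `ℝⁿ` to `ℝ`. -/
def IsRandomizedAlgorithm {n : ℕ} (A : (Fin n → ℝ) → Measure ℝ) : Prop :=
  Measurable A ∧ ∀ X, IsProbabilityMeasure (A X)

/-- `ε`-differential privacy. -/
def IsDifferentiallyPrivate {n : ℕ} (ε : ℝ) (A : (Fin n → ℝ) → Measure ℝ) : Prop :=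
  ∀ (X₁ X₂ : Fin n → ℝ) (S : Set ℝ), MeasurableSet S →
    A X₁ S ≤ ENNReal.ofReal (Real.exp (ε * (hammingDist X₁ X₂ : ℝ))) * A X₂ S

/-- The probability that `|A(X_1, ..., X_n) - m| ≥ α`, over `n` i.i.d. samples `X_i` from `D` and
the randomness of `A`. -/
noncomputable def failureProbability {n : ℕ} (A : (Fin n → ℝ) → Measure ℝ) (D : Measure ℝ)
    (m α : ℝ) : ENNReal :=
  ∫⁻ X, A X {ω | α ≤ |ω - m|} ∂(Measure.pi fun _ : Fin n => D)

end PrivateMedian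

/-! Privacy and well-definedness need no statistics. Between inputs at Hamming distance d, the
unnormalized weight changes by a factor of at most e^{εd/2}, and so does its integral, hence the
density changes by at most e^{εd} (`isDifferentiallyPrivate_extension`). The infimum defining the
weight is uncountable; it is Borel because the typical set is closed, so that sublevel sets are
projections of σ-compact sets (`measurable_iInf_hammingDist_mul`).

Accuracy rests on comparing the algorithm with the flattened Laplace mechanism on inputs that are
`WellSpread` with defect k. There the extension weight lies between e^{-ε(k+1)/2} and e^{εk/2} times
the Laplace density. The lower bound holds because d changes of a well-spread input move its median
by a controlled amount; the upper bound because moving at most k entries onto the median yields a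
typical input with the same median. Altogether the comparison costs a factor e^{ε(2k+1)/2}.

Given the value t of the empirical median, the entries on its two sides are independent samples of D
conditioned to (-∞, t) and (t, ∞). Chernoff bounds then show that spread with defect k fails with
conditional probability at most e^{-k}/8 + 2e^{-Lnr/30}
(`IsMedianWindow.measure_not_wellSpread_le`). For β ≤ b < 1, take k = ⌈log(1/β)⌉: the failure of
spread costs about β, and the factor e^{k} is absorbed by the Laplace tails, with a constant
independent of C (`failureProbability_le_of_le`).

When β is close to 1, log(1/β) is close to 0, n need not be large enough for any concentration, and
what must be shown is a success probability of at least 1 - β, for which log(1/β) suffices. This is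
`exists_le_one_sub`. If the noise scale s = 12C/(εLn) is at most r/8, the median falls in a window
of mass 2v with probability at least √n v/16, given this the input is well spread with k = 0 with
probability at least 3/4, and then the noise succeeds with probability of order min(1, α/s); the
product is at least of order min(1, n(Lα)², nεLα)/C. The conditional form of the Chernoff bounds is
essential, since the window event may itself be rare. If s > r/8, every output law dominates a
constant multiple of the uniform law on an interval of length O(r), with constants depending on C.
-/

namespace PrivateMedian

/-! ### Order statistics and the empirical median. -/

section OrderStatistics

variable {n : ℕ}

/-- The number of entries of `X` that satisfy `p`. -/
noncomputable def count (X : Fin n → ℝ) (p : ℝ → Prop) : ℕ :=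
  open Classical in (Finset.univ.filter fun i => p (X i)).card

lemma count_mono (X : Fin n → ℝ) {p p' : ℝ → Prop} (h : ∀ x, p x → p' x) :
    count X p ≤ count X p' := by
  classical
  unfold count
  exact Finset.card_le_card (Finset.monotone_filter_right _ fun i _ => h (X i))

lemma count_add_count_not (X : Fin n → ℝ) (p : ℝ → Prop) :
    count X p + count X (fun x => ¬ p x) = n := by
  classical
  unfold count
  rw [Finset.card_filter_add_card_filter_not]
  simp

lemma count_or_le (X : Fin n → ℝ) (p p' : ℝ → Prop) :
    count X (fun x => p x ∨ p' x) ≤ count X p + count X p' := by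
  classical
  unfold count
  refine (Finset.card_le_card fun i hi => ?_).trans (Finset.card_union_le _ _)
  simpa using hi

lemma count_comp_perm (X : Fin n → ℝ) (σ : Equiv.Perm (Fin n)) (p : ℝ → Prop) :
    count (X ∘ σ) p = count X p := by
  classical
  unfold count
  refine Finset.card_bij (fun i _ => σ i) ?_ (fun _ _ _ _ h => σ.injective h) ?_
  · intro i hi
    simpa using hi
  · intro i hi
    exact ⟨σ.symm i, by simpa using hi, by simp⟩

/-- Changing `d` entries changes a count by at most `d`. -/
lemma count_le_count_add_hammingDist (X Y : Fin n → ℝ) (p : ℝ → Prop) :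
    count X p ≤ count Y p + hammingDist X Y := by
  classical
  unfold count hammingDist
  refine (Finset.card_le_card ?_).trans (Finset.card_union_le _ _)
  intro i hi
  simp only [Finset.mem_filter, Finset.mem_univ, true_and, Finset.mem_union] at hi ⊢
  by_cases h : X i = Y i
  · exact Or.inl (h ▸ hi)
  · exact Or.inr h

/-- The rank is written `n / 2 - 1 + 1` rather than `n / 2`: truncated subtraction makes it 1 for n
= 1 and changes nothing for n ≥ 2. All later facts about the median go through counts. -/
lemma leftMedian_le_iff (hn : 0 < n) (X : Fin n → ℝ) (t : ℝ) :
    leftMedian X ≤ t ↔ n / 2 - 1 + 1 ≤ count X (· ≤ t) := by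
  classical
  have h := Tuple.lt_card_le_iff_apply_le_of_monotone
    (j := ⟨n / 2 - 1, by omega⟩) (a := t) (Tuple.monotone_sort X)
  rw [← count_comp_perm X (Tuple.sort X)]
  unfold leftMedian count
  rw [dif_pos hn, Nat.add_one_le_iff]
  simp only [Function.comp] at h ⊢
  exact h.symm

lemma lt_leftMedian_iff (hn : 0 < n) (X : Fin n → ℝ) (t : ℝ) :
    t < leftMedian X ↔ n - (n / 2 - 1) ≤ count X (t < ·) := by
  rw [← not_le, leftMedian_le_iff hn]
  have h := count_add_count_not X (· ≤ t)
  simp only [not_le] at h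
  omega

lemma leftMedian_lt_iff (hn : 0 < n) (X : Fin n → ℝ) (t : ℝ) :
    leftMedian X < t ↔ n / 2 - 1 + 1 ≤ count X (· < t) := by
  classical
  constructor
  · intro h
    exact ((leftMedian_le_iff hn X _).1 le_rfl).trans (count_mono X fun x hx => hx.trans_lt h)
  · intro h
    by_contra hc
    rw [not_lt] at hc
    have hne : (Finset.univ.filter fun i => X i < t).Nonempty := by
      rw [← Finset.card_pos]
      exact lt_of_lt_of_le (Nat.succ_pos _) h
    obtain ⟨j, hj, hmax⟩ := Finset.exists_max_image _ X hne
    simp only [Finset.mem_filter, Finset.mem_univ, true_and] at hj hmax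
    have : leftMedian X ≤ X j := by
      rw [leftMedian_le_iff hn]
      refine h.trans ?_
      unfold count
      refine Finset.card_le_card fun i hi => ?_
      simp only [Finset.mem_filter, Finset.mem_univ, true_and] at hi ⊢
      exact hmax i hi
    linarith

lemma le_leftMedian_iff (hn : 0 < n) (X : Fin n → ℝ) (t : ℝ) :
    t ≤ leftMedian X ↔ n - (n / 2 - 1) ≤ count X (t ≤ ·) := by
  rw [← not_lt, leftMedian_lt_iff hn]
  have h := count_add_count_not X (· < t)
  simp only [not_lt] at h
  omega

lemma leftMedian_eq_of_count (hn : 0 < n) (X : Fin n → ℝ) (t : ℝ)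
    (h1 : count X (· < t) ≤ n / 2 - 1) (h2 : n / 2 - 1 + 1 ≤ count X (· ≤ t)) :
    leftMedian X = t := by
  apply le_antisymm
  · rwa [leftMedian_le_iff hn]
  · rw [← not_lt, leftMedian_lt_iff hn]
    omega

lemma count_lt_leftMedian (hn : 0 < n) (X : Fin n → ℝ) :
    count X (· < leftMedian X) ≤ n / 2 - 1 := by
  have := (leftMedian_lt_iff hn X (leftMedian X)).not.1 (lt_irrefl _)
  omega

lemma count_gt_leftMedian (hn : 0 < n) (X : Fin n → ℝ) :
    count X (leftMedian X < ·) + (n / 2 - 1 + 1) ≤ n := by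
  have := (lt_leftMedian_iff hn X (leftMedian X)).not.1 (lt_irrefl _)
  omega

lemma exists_eq_leftMedian (hn : 0 < n) (X : Fin n → ℝ) : ∃ i, X i = leftMedian X := by
  unfold leftMedian
  rw [dif_pos hn]
  exact ⟨_, rfl⟩

lemma leftMedian_const (hn : 0 < n) (c : ℝ) : leftMedian (fun _ : Fin n => c) = c := by
  obtain ⟨i, hi⟩ := exists_eq_leftMedian hn (fun _ : Fin n => c)
  exact hi.symm

lemma leftMedian_le_add_dist (hn : 0 < n) (X Y : Fin n → ℝ) :
    leftMedian X ≤ leftMedian Y + dist X Y := by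
  classical
  rw [leftMedian_le_iff hn]
  refine ((leftMedian_le_iff hn Y _).1 le_rfl).trans ?_
  unfold count
  refine Finset.card_le_card fun i hi => ?_
  simp only [Finset.mem_filter, Finset.mem_univ, true_and] at hi ⊢
  have h1 := dist_le_pi_dist X Y i
  rw [Real.dist_eq] at h1
  have := le_abs_self (X i - Y i)
  linarith

lemma continuous_leftMedian : Continuous (leftMedian : (Fin n → ℝ) → ℝ) := by
  rcases Nat.eq_zero_or_pos n with rfl | hn
  · have : (leftMedian : (Fin 0 → ℝ) → ℝ) = fun _ => 0 := by
      funext X; simp [leftMedian]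
    rw [this]; exact continuous_const
  · have : LipschitzWith 1 (leftMedian : (Fin n → ℝ) → ℝ) := by
      apply LipschitzWith.of_dist_le_mul
      intro X Y
      rw [Real.dist_eq, abs_le]
      have h1 := leftMedian_le_add_dist hn X Y
      have h2 := leftMedian_le_add_dist hn Y X
      rw [dist_comm Y X] at h2
      constructor <;> simp <;> linarith
    exact this.continuous

/-- The number of indices `i` with `X i` in a closed set that depends on `X` is an upper
semicontinuous function of `X`. -/
lemma isClosed_setOf_le_card {ι E : Type*} [Fintype ι] [TopologicalSpace E]
    (p : ι → E → Prop) [∀ i x, Decidable (p i x)] (hp : ∀ i, IsClosed {x | p i x}) (c : ℕ) :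
    IsClosed {x | c ≤ (Finset.univ.filter fun i => p i x).card} := by
  classical
  have : {x | c ≤ (Finset.univ.filter fun i => p i x).card} =
      ⋃ T ∈ (Finset.univ.powersetCard c : Finset (Finset ι)), ⋂ i ∈ T, {x | p i x} := by
    ext x
    simp only [mem_ofPred_eq, Finset.mem_powersetCard, mem_iUnion, mem_iInter]
    constructor
    · intro h
      obtain ⟨T, hT, hc⟩ := Finset.exists_subset_card_eq h
      exact ⟨T, ⟨Finset.subset_univ _, hc⟩, fun i hi => (Finset.mem_filter.1 (hT hi)).2⟩
    · rintro ⟨T, ⟨-, hc⟩, hT⟩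
      rw [← hc]
      exact Finset.card_le_card fun i hi => Finset.mem_filter.2 ⟨Finset.mem_univ _, hT i hi⟩
  rw [this]
  exact Set.Finite.isClosed_biUnion (Finset.finite_toSet _) fun T _ =>
    isClosed_biInter fun i _ => hp i

/-- The median is continuous, so every requirement asks that at least κ + 1 of finitely many closed
conditions hold. Closedness is what makes the infimum over this set Borel measurable. -/
lemma isClosed_typicalSet (C L R r : ℝ) (n : ℕ) : IsClosed (typicalSet C L R r n) := by
  have hm := continuous_leftMedian (n := n)
  have hX : ∀ i : Fin n, Continuous fun X : Fin n → ℝ => X i := fun i => continuous_apply i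
  have : typicalSet C L R r n =
      (⋂ κ : ℕ, ⋂ _ : 1 ≤ κ, ⋂ _ : (κ : ℝ) ≤ L * n * r / (2 * C),
        ({X : Fin n → ℝ | κ + 1 ≤ (Finset.univ.filter fun i : Fin n =>
            0 ≤ X i - leftMedian X ∧ X i - leftMedian X ≤ κ * C / (L * n)).card} ∩
         {X : Fin n → ℝ | κ + 1 ≤ (Finset.univ.filter fun i : Fin n =>
            0 ≤ leftMedian X - X i ∧ leftMedian X - X i ≤ κ * C / (L * n)).card})) ∩
      leftMedian ⁻¹' Icc (-R - r / 2) (R + r / 2) := by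
    ext X
    simp [typicalSet]
  rw [this]
  refine IsClosed.inter ?_ (isClosed_Icc.preimage hm)
  refine isClosed_iInter fun κ => isClosed_iInter fun _ => isClosed_iInter fun _ => ?_
  refine IsClosed.inter (isClosed_setOf_le_card _ (fun i => ?_) _)
    (isClosed_setOf_le_card _ (fun i => ?_) _)
  · exact (isClosed_le continuous_const ((hX i).sub hm)).inter
      (isClosed_le ((hX i).sub hm) continuous_const)
  · exact (isClosed_le continuous_const (hm.sub (hX i))).inter
      (isClosed_le (hm.sub (hX i)) continuous_const)

end OrderStatistics

end PrivateMedian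

namespace PrivateMedian

/-! ### Borel measurability of the extended mechanism. -/

section Measurability

variable {n : ℕ}

/-- The infimum over a closed set of inputs of a continuous function, weighted by the Hamming
distance, is a jointly measurable function. -/
lemma measurable_iInf_hammingDist_mul {H : Set (Fin n → ℝ)} (hH : IsClosed H) (hne : H.Nonempty)
    {ψ : (Fin n → ℝ) → ℝ → ℝ} (hψ : Continuous (Function.uncurry ψ)) (hpos : ∀ X ω, 0 ≤ ψ X ω)
    {η : ℝ} (hη : 0 ≤ η) :
    Measurable fun p : (Fin n → ℝ) × ℝ =>
      ⨅ X' : H, Real.exp (η * (hammingDist p.1 (X' : Fin n → ℝ) : ℝ)) * ψ X' p.2 := by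
  classical
  have : Nonempty H := hne.to_subtype
  refine measurable_of_Iio fun c => ?_
  -- `T` contains all coordinates where the two inputs differ, so its cardinality bounds the Hamming
  -- distance by a closed condition. The margin 1 / (j + 1) replaces the strict inequality by closed
  -- ones.
  let S : Finset (Fin n) → ℕ → Set ((Fin n → ℝ) × (Fin n → ℝ) × ℝ) := fun T j =>
    {z | z.2.1 ∈ H ∧ (∀ i, i ∉ T → z.1 i = z.2.1 i) ∧
      Real.exp (η * (T.card : ℝ)) * ψ z.2.1 z.2.2 ≤ c - 1 / ((j : ℝ) + 1)}
  have hS : ∀ T j, IsClosed (S T j) := by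
    intro T j
    refine IsClosed.inter (hH.preimage (continuous_fst.comp continuous_snd))
      (IsClosed.inter ?_ ?_)
    · have : {z : (Fin n → ℝ) × (Fin n → ℝ) × ℝ | ∀ i, i ∉ T → z.1 i = z.2.1 i} =
          ⋂ i, ⋂ (_ : i ∉ T), {z | z.1 i = z.2.1 i} := by
        ext z; simp
      change IsClosed {z : (Fin n → ℝ) × (Fin n → ℝ) × ℝ | ∀ i, i ∉ T → z.1 i = z.2.1 i}
      rw [this]
      exact isClosed_iInter fun i => isClosed_iInter fun _ => isClosed_eq
        ((continuous_apply i).comp continuous_fst)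
        ((continuous_apply i).comp (continuous_fst.comp continuous_snd))
    · exact isClosed_le (continuous_const.mul (hψ.comp continuous_snd)) continuous_const
  have heq : (fun p : (Fin n → ℝ) × ℝ =>
      ⨅ X' : H, Real.exp (η * (hammingDist p.1 (X' : Fin n → ℝ) : ℝ)) * ψ X' p.2) ⁻¹' Iio c =
      ⋃ T : Finset (Fin n), ⋃ j : ℕ, (fun z => (z.1, z.2.2)) '' S T j := by
    ext ⟨X, ω⟩
    simp only [mem_preimage, mem_Iio, mem_iUnion, mem_image, Prod.mk.injEq]
    constructor
    · intro h
      obtain ⟨⟨X', hX'⟩, h⟩ := exists_lt_of_ciInf_lt h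
      obtain ⟨j, hj⟩ := exists_nat_one_div_lt (sub_pos.2 h)
      refine ⟨Finset.univ.filter fun i => X i ≠ X' i, j, (X, X', ω), ⟨hX', ?_, ?_⟩, rfl, rfl⟩
      · intro i hi
        simpa using hi
      · have : hammingDist X X' = (Finset.univ.filter fun i => X i ≠ X' i).card := rfl
        rw [this] at h hj
        simp only at hj ⊢
        linarith
    · rintro ⟨T, j, ⟨X₁, X', ω₁⟩, ⟨h1, h2, h3⟩, h4, h5⟩
      simp only at h1 h2 h3 h4 h5
      subst h4 h5
      refine (ciInf_le ⟨0, ?_⟩ (⟨X', h1⟩ : H)).trans_lt ?_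
      · rintro _ ⟨X'', rfl⟩
        exact mul_nonneg (Real.exp_pos _).le (hpos _ _)
      · have hd : hammingDist X₁ X' ≤ T.card := by
          refine Finset.card_le_card fun i hi => ?_
          by_contra hc
          exact (Finset.mem_filter.1 hi).2 (h2 i hc)
        have hj : 0 < 1 / ((j : ℝ) + 1) := by positivity
        have : Real.exp (η * (hammingDist X₁ X' : ℝ)) * ψ X' ω₁ ≤
            Real.exp (η * (T.card : ℝ)) * ψ X' ω₁ := by
          refine mul_le_mul_of_nonneg_right (Real.exp_le_exp.2 ?_) (hpos _ _)
          exact mul_le_mul_of_nonneg_left (by exact_mod_cast hd) hη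
        simp only
        linarith
  rw [heq]
  refine MeasurableSet.iUnion fun T => MeasurableSet.iUnion fun j => ?_
  -- A projection of a Borel set is in general only analytic. A closed set in Euclidean space is
  -- σ-compact, and this survives continuous images.
  have hσ : IsSigmaCompact ((fun z : (Fin n → ℝ) × (Fin n → ℝ) × ℝ => (z.1, z.2.2)) '' S T j) :=
    (IsSigmaCompact.of_isClosed_subset isSigmaCompact_univ (hS T j) (subset_univ _)).image
      (by fun_prop)
  obtain ⟨K, hK, hKe⟩ := hσ
  rw [← hKe]
  exact MeasurableSet.iUnion fun i => (hK i).measurableSet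

/-- Normalizing jointly measurable weights with positive finite integrals gives a randomized
algorithm. -/
lemma isRandomizedAlgorithm_of_weight {g : (Fin n → ℝ) → ℝ → ℝ}
    (hg : Measurable (Function.uncurry g)) (h0 : ∀ X ω, 0 ≤ g X ω)
    (hint : ∀ X, Integrable (g X)) (hpos : ∀ X, 0 < ∫ ω, g X ω) :
    IsRandomizedAlgorithm fun X => (volume : Measure ℝ).withDensity fun ω =>
      ENNReal.ofReal (g X ω / ∫ ω', g X ω') := by
  have hZ : Measurable fun X => ∫ ω, g X ω :=
    (StronglyMeasurable.integral_prod_right (f := g) hg.stronglyMeasurable).measurable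
  have hm : Measurable fun p : (Fin n → ℝ) × ℝ => ENNReal.ofReal (g p.1 p.2 / ∫ ω', g p.1 ω') :=
    ENNReal.measurable_ofReal.comp (hg.div (hZ.comp measurable_fst))
  constructor
  · refine Measure.measurable_of_measurable_coe _ fun S hS => ?_
    simp_rw [withDensity_apply _ hS]
    exact hm.lintegral_prod_right'
  · intro X
    constructor
    rw [withDensity_apply _ MeasurableSet.univ, Measure.restrict_univ,
      ← ofReal_integral_eq_lintegral_ofReal ((hint X).div_const _)
        (Filter.Eventually.of_forall fun ω => div_nonneg (h0 X ω) (hpos X).le),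
      integral_div, div_self (hpos X).ne', ENNReal.ofReal_one]

end Measurability

/-! ### The Extension Lemma. -/

section Extension

variable {n : ℕ} {H : Set (Fin n → ℝ)} {f : (Fin n → ℝ) → ℝ → ℝ} {η : ℝ}

lemma bddBelow_extensionWeight (hf : ∀ X ω, 0 ≤ f X ω) (X : Fin n → ℝ) (ω : ℝ) :
    BddBelow (range fun X' : H =>
      Real.exp (η * (hammingDist X (X' : Fin n → ℝ) : ℝ)) * f X' ω) := by
  refine ⟨0, ?_⟩
  rintro _ ⟨X', rfl⟩
  exact mul_nonneg (Real.exp_pos _).le (hf _ _)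

lemma extensionWeight_nonneg (hf : ∀ X ω, 0 ≤ f X ω) (X : Fin n → ℝ) (ω : ℝ) :
    0 ≤ extensionWeight H f η X ω :=
  Real.iInf_nonneg fun _ => mul_nonneg (Real.exp_pos _).le (hf _ _)

lemma extensionWeight_le (hf : ∀ X ω, 0 ≤ f X ω) (X : Fin n → ℝ) {X' : Fin n → ℝ} (hX' : X' ∈ H)
    (ω : ℝ) :
    extensionWeight H f η X ω ≤ Real.exp (η * (hammingDist X X' : ℝ)) * f X' ω :=
  ciInf_le (bddBelow_extensionWeight hf X ω) (⟨X', hX'⟩ : H)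

lemma le_extensionWeight (hne : H.Nonempty) (X : Fin n → ℝ) (ω c : ℝ)
    (h : ∀ X' ∈ H, c ≤ Real.exp (η * (hammingDist X X' : ℝ)) * f X' ω) :
    c ≤ extensionWeight H f η X ω := by
  have : Nonempty H := hne.to_subtype
  exact le_ciInf fun X' => h X' X'.2

/-- The triangle inequality for the Hamming distance, applied to each term of the infimum; nothing
about `f` beyond nonnegativity enters. -/
lemma extensionWeight_le_exp_mul (hne : H.Nonempty) (hf : ∀ X ω, 0 ≤ f X ω) (hη : 0 ≤ η)
    (X Y : Fin n → ℝ) (ω : ℝ) :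
    extensionWeight H f η X ω ≤
      Real.exp (η * (hammingDist X Y : ℝ)) * extensionWeight H f η Y ω := by
  rw [← div_le_iff₀' (Real.exp_pos _)]
  refine le_extensionWeight hne Y ω _ fun X' hX' => ?_
  rw [div_le_iff₀' (Real.exp_pos _)]
  refine (extensionWeight_le hf X hX' ω).trans ?_
  rw [← mul_assoc, ← Real.exp_add, ← mul_add]
  refine mul_le_mul_of_nonneg_right (Real.exp_le_exp.2 (mul_le_mul_of_nonneg_left ?_ hη)) (hf _ _)
  exact_mod_cast hammingDist_triangle X Y X'

/-- The extended mechanism is differentially private. -/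
lemma isDifferentiallyPrivate_extension (hne : H.Nonempty) (hf : ∀ X ω, 0 ≤ f X ω) {ε : ℝ}
    (hε : 0 ≤ ε) (hint : ∀ X, Integrable (extensionWeight H f (ε / 2) X))
    (hpos : ∀ X, 0 < ∫ ω, extensionWeight H f (ε / 2) X ω) :
    IsDifferentiallyPrivate ε (extension H f (ε / 2)) := by
  intro X Y S hS
  have hε2 : 0 ≤ ε / 2 := by positivity
  set e := Real.exp (ε / 2 * (hammingDist X Y : ℝ)) with he
  have he0 : 0 < e := Real.exp_pos _
  have hee : Real.exp (ε * (hammingDist X Y : ℝ)) = e * e := by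
    rw [he, ← Real.exp_add]; ring_nf
  have h1 := extensionWeight_le_exp_mul (f := f) hne hf hε2 X Y
  -- The normalizers contribute a second factor e^{εd/2}, which is why the weights are built with
  -- parameter ε / 2.
  have h2 : ∫ ω, extensionWeight H f (ε / 2) Y ω ≤
      e * ∫ ω, extensionWeight H f (ε / 2) X ω := by
    rw [← integral_const_mul]
    refine integral_mono (hint Y) ((hint X).const_mul _) fun ω => ?_
    have := extensionWeight_le_exp_mul (f := f) hne hf hε2 Y X ω
    rwa [hammingDist_comm, ← he] at this
  unfold extension
  rw [withDensity_apply _ hS, withDensity_apply _ hS, hee,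
    ← lintegral_const_mul' _ _ ENNReal.ofReal_ne_top]
  refine lintegral_mono fun ω => ?_
  rw [← ENNReal.ofReal_mul (by positivity)]
  refine ENNReal.ofReal_le_ofReal ?_
  have hX := hpos X
  have hY := hpos Y
  set ZX := ∫ ω, extensionWeight H f (ε / 2) X ω
  set ZY := ∫ ω, extensionWeight H f (ε / 2) Y ω
  have hg := extensionWeight_nonneg (H := H) (η := ε / 2) hf Y ω
  rw [div_le_iff₀ hX]
  calc _ ≤ e * extensionWeight H f (ε / 2) Y ω := h1 ω
    _ = e * (extensionWeight H f (ε / 2) Y ω / ZY) * ZY := by field_simp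
    _ ≤ e * (extensionWeight H f (ε / 2) Y ω / ZY) * (e * ZX) := by gcongr
    _ = _ := by ring

lemma extension_apply (hf : ∀ X ω, 0 ≤ f X ω) {X : Fin n → ℝ}
    (hint : Integrable (extensionWeight H f η X)) {S : Set ℝ} (hS : MeasurableSet S) :
    extension H f η X S = ENNReal.ofReal
      ((∫ ω in S, extensionWeight H f η X ω) / ∫ ω, extensionWeight H f η X ω) := by
  unfold extension
  rw [withDensity_apply _ hS, ← integral_div, ofReal_integral_eq_lintegral_ofReal]
  · exact (hint.div_const _).integrableOn
  · exact Filter.Eventually.of_forall fun ω => div_nonneg (extensionWeight_nonneg hf X ω)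
      (integral_nonneg fun ω => extensionWeight_nonneg hf X ω)

/-- If the weight at `X` is within constant factors of an integrable function `φ`, then the output
distribution is within constant factors of the distribution with density proportional to `φ`. -/
lemma extension_apply_le (hf : ∀ X ω, 0 ≤ f X ω) {X : Fin n → ℝ} {φ : ℝ → ℝ} (hφ : Integrable φ)
    (hφpos : 0 < ∫ ω, φ ω)
    (hint : Integrable (extensionWeight H f η X)) {a b : ℝ} (ha : 0 < a)
    (h1 : ∀ ω, a * φ ω ≤ extensionWeight H f η X ω)
    (h2 : ∀ ω, extensionWeight H f η X ω ≤ b * φ ω) {S : Set ℝ} (hS : MeasurableSet S) :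
    extension H f η X S ≤ ENNReal.ofReal (b / a * ((∫ ω in S, φ ω) / ∫ ω, φ ω)) := by
  rw [extension_apply hf hint hS]
  refine ENNReal.ofReal_le_ofReal ?_
  have e1 : a * ∫ ω, φ ω ≤ ∫ ω, extensionWeight H f η X ω := by
    rw [← integral_const_mul]
    exact integral_mono (hφ.const_mul _) hint h1
  have e2 : ∫ ω in S, extensionWeight H f η X ω ≤ b * ∫ ω in S, φ ω := by
    rw [← integral_const_mul]
    exact integral_mono hint.integrableOn (hφ.const_mul _).integrableOn h2
  rw [div_mul_div_comm]
  have e3 : 0 ≤ ∫ ω in S, extensionWeight H f η X ω :=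
    integral_nonneg fun ω => extensionWeight_nonneg hf X ω
  exact div_le_div₀ (e3.trans e2) e2 (by positivity) e1

lemma le_extension_apply (hf : ∀ X ω, 0 ≤ f X ω) {X : Fin n → ℝ} {φ : ℝ → ℝ} (hφ : Integrable φ)
    (h0 : ∀ ω, 0 ≤ φ ω) (hφpos : 0 < ∫ ω, φ ω)
    (hint : Integrable (extensionWeight H f η X)) {a b : ℝ} (ha : 0 < a)
    (h1 : ∀ ω, a * φ ω ≤ extensionWeight H f η X ω)
    (h2 : ∀ ω, extensionWeight H f η X ω ≤ b * φ ω) {S : Set ℝ} (hS : MeasurableSet S) :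
    ENNReal.ofReal (a / b * ((∫ ω in S, φ ω) / ∫ ω, φ ω)) ≤ extension H f η X S := by
  rw [extension_apply hf hint hS]
  refine ENNReal.ofReal_le_ofReal ?_
  have e1 : ∫ ω, extensionWeight H f η X ω ≤ b * ∫ ω, φ ω := by
    rw [← integral_const_mul]
    exact integral_mono hint (hφ.const_mul _) h2
  have e2 : a * ∫ ω in S, φ ω ≤ ∫ ω in S, extensionWeight H f η X ω := by
    rw [← integral_const_mul]
    exact integral_mono (hφ.const_mul _).integrableOn hint.integrableOn h1
  have e4 : a * ∫ ω, φ ω ≤ ∫ ω, extensionWeight H f η X ω := by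
    rw [← integral_const_mul]
    exact integral_mono (hφ.const_mul _) hint h1
  rw [div_mul_div_comm]
  have e3 : 0 ≤ ∫ ω in S, φ ω := integral_nonneg h0
  exact div_le_div₀ ((by positivity : 0 ≤ a * ∫ ω in S, φ ω).trans e2) e2
    (lt_of_lt_of_le (by positivity) e4) e1

end Extension

end PrivateMedian

/-! ### The flattened Laplace profile, and the algorithm as a private Markov kernel. -/

namespace PrivateMedian

/-- The unnormalized density of the flattened Laplace mechanism, as a function of the median. -/
noncomputable def laplaceProfile (C ε L r : ℝ) (n : ℕ) (t ω : ℝ) : ℝ :=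
  Real.exp (-(ε / 4) * min (L * n / (3 * C) * |t - ω|) (L * r * n))

/-- The profile restricted to the output interval. -/
noncomputable def truncatedProfile (C ε L R r : ℝ) (n : ℕ) (t : ℝ) : ℝ → ℝ :=
  (outputInterval C R r).indicator (laplaceProfile C ε L r n t)

section Profile

variable {C ε L R r : ℝ} {n : ℕ}

lemma continuous_laplaceProfile :
    Continuous (Function.uncurry (laplaceProfile C ε L r n)) := by
  unfold laplaceProfile Function.uncurry
  fun_prop

lemma laplaceProfile_pos (t ω : ℝ) : 0 < laplaceProfile C ε L r n t ω := Real.exp_pos _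

lemma exp_neg_le_laplaceProfile (hε : 0 < ε) (t ω : ℝ) :
    Real.exp (-(ε / 4) * (L * r * n)) ≤ laplaceProfile C ε L r n t ω := by
  refine Real.exp_le_exp.2 ?_
  have := min_le_right (L * n / (3 * C) * |t - ω|) (L * r * n)
  nlinarith

lemma laplaceProfile_le_one (hC : 0 < C) (hε : 0 < ε) (hL : 0 < L) (hr : 0 < r) (t ω : ℝ) :
    laplaceProfile C ε L r n t ω ≤ 1 := by
  refine Real.exp_le_one_iff.2 ?_
  have : 0 ≤ min (L * n / (3 * C) * |t - ω|) (L * r * n) := le_min (by positivity) (by positivity)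
  nlinarith

lemma measurableSet_outputInterval : MeasurableSet (outputInterval C R r) := measurableSet_Icc

lemma volume_outputInterval (hC : 0 < C) (hR : 0 < R) (hr : 0 < r) :
    (volume : Measure ℝ).real (outputInterval C R r) = 2 * R + 8 * C * r := by
  have : 0 < C * r := by positivity
  unfold outputInterval
  rw [Real.volume_real_Icc_of_le (by nlinarith)]
  ring

lemma truncatedProfile_nonneg (t ω : ℝ) : 0 ≤ truncatedProfile C ε L R r n t ω :=
  indicator_nonneg (fun _ _ => (laplaceProfile_pos _ _).le) _

lemma integrable_truncatedProfile (t : ℝ) : Integrable (truncatedProfile C ε L R r n t) := by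
  unfold truncatedProfile
  rw [integrable_indicator_iff measurableSet_outputInterval]
  refine ContinuousOn.integrableOn_compact isCompact_Icc (Continuous.continuousOn ?_)
  exact continuous_laplaceProfile.comp (Continuous.prodMk_right t)

lemma integral_truncatedProfile (t : ℝ) :
    ∫ ω, truncatedProfile C ε L R r n t ω =
      ∫ ω in outputInterval C R r, laplaceProfile C ε L r n t ω :=
  integral_indicator measurableSet_outputInterval

/-- The normalizing constant of the flattened Laplace mechanism does not depend on the median. -/
lemma integral_truncatedProfile_eq (hC : 1 ≤ C) (hL : 0 < L) (hr : 0 < r)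
    {t : ℝ} (ht : t ∈ Icc (-R - r / 2) (R + r / 2)) :
    ∫ ω, truncatedProfile C ε L R r n t ω =
      (∫ x : ℝ, (laplaceProfile C ε L r n 0 x - Real.exp (-(ε / 4) * (L * r * n)))) +
        (volume : Measure ℝ).real (outputInterval C R r) *
          Real.exp (-(ε / 4) * (L * r * n)) := by
  set e := Real.exp (-(ε / 4) * (L * r * n)) with he
  have hshift : ∀ ω, laplaceProfile C ε L r n t ω = laplaceProfile C ε L r n 0 (t - ω) := by
    intro ω
    rw [laplaceProfile, laplaceProfile, zero_sub, abs_neg]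
  have hcont : Continuous (laplaceProfile C ε L r n t) :=
    continuous_laplaceProfile.comp (Continuous.prodMk_right t)
  have hI : IntegrableOn (laplaceProfile C ε L r n t) (outputInterval C R r) :=
    hcont.continuousOn.integrableOn_compact isCompact_Icc
  have h1 : ∫ ω in outputInterval C R r, (laplaceProfile C ε L r n t ω - e) =
      ∫ ω, (laplaceProfile C ε L r n t ω - e) := by
    refine setIntegral_eq_integral_of_forall_compl_eq_zero fun ω hω => ?_
    -- The minimum saturates at distance 3Cr from `t`, and the output interval contains [t - 3Cr, t
    -- + 3Cr] because r/2 + 3Cr ≤ 4Cr. So the non-flat part of the profile is never truncated and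
    -- its integral is translation invariant.
    have hfar : 3 * C * r ≤ |t - ω| := by
      by_contra hc
      rw [not_le, abs_lt] at hc
      apply hω
      have : r ≤ C * r := by nlinarith
      constructor <;> nlinarith [ht.1, ht.2, hc.1, hc.2]
    have : L * r * n ≤ L * n / (3 * C) * |t - ω| := by
      rw [div_mul_eq_mul_div, le_div_iff₀ (by positivity)]
      have : 0 ≤ L * n := by positivity
      nlinarith
    unfold laplaceProfile
    rw [min_eq_right this, ← he, sub_self]
  have h2 : ∫ ω, (laplaceProfile C ε L r n t ω - e) = ∫ x, (laplaceProfile C ε L r n 0 x - e) := by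
    simp_rw [hshift]
    exact integral_sub_left_eq_self (fun x => laplaceProfile C ε L r n 0 x - e) volume t
  rw [integral_truncatedProfile, ← h2, ← h1, integral_sub hI]
  · rw [setIntegral_const, smul_eq_mul]
    ring
  · exact continuousOn_const.integrableOn_compact isCompact_Icc

/-- The common normalizing constant. -/
noncomputable def laplaceNormalizer (C ε L R r : ℝ) (n : ℕ) : ℝ :=
  ∫ ω, truncatedProfile C ε L R r n 0 ω

lemma integral_truncatedProfile_eq_normalizer (hC : 1 ≤ C) (hL : 0 < L) (hR : 0 < R) (hr : 0 < r)
    {t : ℝ} (ht : t ∈ Icc (-R - r / 2) (R + r / 2)) :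
    ∫ ω, truncatedProfile C ε L R r n t ω = laplaceNormalizer C ε L R r n := by
  unfold laplaceNormalizer
  rw [integral_truncatedProfile_eq hC hL hr ht, integral_truncatedProfile_eq hC hL hr]
  constructor <;> linarith

lemma laplaceNormalizer_pos (hC : 0 < C) (hε : 0 < ε) (hR : 0 < R) (hr : 0 < r) :
    0 < laplaceNormalizer C ε L R r n := by
  unfold laplaceNormalizer
  have hV := volume_outputInterval hC hR hr
  have : ∫ ω, (outputInterval C R r).indicator (fun _ => Real.exp (-(ε / 4) * (L * r * n))) ω ≤
      ∫ ω, truncatedProfile C ε L R r n 0 ω := by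
    refine integral_mono ?_ (integrable_truncatedProfile 0) fun ω => ?_
    · exact (integrable_indicator_iff measurableSet_outputInterval).2
        (continuousOn_const.integrableOn_compact isCompact_Icc)
    · exact indicator_le_indicator (exp_neg_le_laplaceProfile hε 0 ω)
  rw [integral_indicator measurableSet_outputInterval, setIntegral_const, smul_eq_mul, hV] at this
  refine lt_of_lt_of_le ?_ this
  positivity

end Profile

section Mechanism

variable {C ε L R r : ℝ} {n : ℕ}

lemma flattenedLaplaceDensity_nonneg (X : Fin n → ℝ) (ω : ℝ) :
    0 ≤ flattenedLaplaceDensity C ε L R r X ω :=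
  indicator_nonneg (fun _ _ => div_nonneg (Real.exp_pos _).le
    (integral_nonneg fun _ => (Real.exp_pos _).le)) _

/-- With one normalizer for all admissible medians, densities of different inputs compare through
their profiles alone. -/
lemma flattenedLaplaceDensity_eq (hC : 1 ≤ C) (hL : 0 < L) (hR : 0 < R) (hr : 0 < r)
    {X : Fin n → ℝ} (hX : leftMedian X ∈ Icc (-R - r / 2) (R + r / 2)) (ω : ℝ) :
    flattenedLaplaceDensity C ε L R r X ω =
      truncatedProfile C ε L R r n (leftMedian X) ω / laplaceNormalizer C ε L R r n := by
  rw [← integral_truncatedProfile_eq_normalizer hC hL hR hr hX, integral_truncatedProfile]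
  unfold flattenedLaplaceDensity truncatedProfile
  by_cases hω : ω ∈ outputInterval C R r
  · rw [indicator_of_mem hω, indicator_of_mem hω]
    rfl
  · rw [indicator_of_notMem hω, indicator_of_notMem hω, zero_div]

/-- A constant input has all n entries at its median, and Lr ≤ 1/2 keeps the relevant κ below n. -/
lemma nonempty_typicalSet (hC : 1 ≤ C) (hL : 0 < L) (hR : 0 < R) (hr : 0 < r)
    (hLr : L * r ≤ 1 / 2) (hn : 0 < n) : (typicalSet C L R r n).Nonempty := by
  refine ⟨fun _ => 0, ?_⟩
  have hm : leftMedian (fun _ : Fin n => (0 : ℝ)) = 0 := leftMedian_const hn 0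
  refine ⟨fun κ h1 h2 => ?_, ?_⟩
  · rw [hm]
    have hκ : κ + 1 ≤ n := by
      have hn' : (1 : ℝ) ≤ n := by exact_mod_cast hn
      have h3 : (κ : ℝ) * (2 * C) ≤ L * n * r := by rwa [le_div_iff₀ (by positivity)] at h2
      have h4 : L * n * r ≤ n / 2 := by nlinarith
      have h5 : (1 : ℝ) ≤ κ := by exact_mod_cast h1
      have : (κ : ℝ) + 1 ≤ n := by nlinarith
      exact_mod_cast this
    have h0 : (0 : ℝ) ≤ κ * C / (L * n) := by positivity
    simp [h0, hκ]
  · rw [hm]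
    constructor <;> linarith

/-- Pulling the indicator and the normalizer out of the infimum leaves a jointly continuous function
of the typical input and the output, to which the measurability lemma applies. -/
lemma extensionWeight_eq (hC : 1 ≤ C) (hL : 0 < L) (hR : 0 < R) (hr : 0 < r) (η : ℝ)
    (X : Fin n → ℝ) (ω : ℝ) :
    extensionWeight (typicalSet C L R r n) (flattenedLaplaceDensity C ε L R r) η X ω =
      (outputInterval C R r).indicator (fun ω => (⨅ X' : typicalSet C L R r n,
        Real.exp (η * (hammingDist X (X' : Fin n → ℝ) : ℝ)) *
          laplaceProfile C ε L r n (leftMedian (X' : Fin n → ℝ)) ω) *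
            (laplaceNormalizer C ε L R r n)⁻¹) ω := by
  have h : ∀ X' : typicalSet C L R r n, flattenedLaplaceDensity C ε L R r (X' : Fin n → ℝ) ω =
      truncatedProfile C ε L R r n (leftMedian (X' : Fin n → ℝ)) ω /
        laplaceNormalizer C ε L R r n := fun X' =>
    flattenedLaplaceDensity_eq hC hL hR hr X'.2.2 ω
  unfold extensionWeight
  simp_rw [h]
  unfold truncatedProfile
  by_cases hω : ω ∈ outputInterval C R r
  · simp only [indicator_of_mem hω]
    rw [Real.iInf_mul_of_nonneg]
    · simp only [div_eq_mul_inv, mul_assoc]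
    · exact inv_nonneg.2 (integral_nonneg fun _ => truncatedProfile_nonneg _ _)
  · simp only [indicator_of_notMem hω]
    simp

lemma measurable_extensionWeight (hC : 1 ≤ C) (hL : 0 < L) (hR : 0 < R) (hr : 0 < r)
    (hLr : L * r ≤ 1 / 2) (hn : 0 < n) {η : ℝ} (hη : 0 ≤ η) :
    Measurable (Function.uncurry (extensionWeight (typicalSet C L R r n)
      (flattenedLaplaceDensity C ε L R r) η)) := by
  have h := (measurable_iInf_hammingDist_mul (isClosed_typicalSet C L R r n)
    (nonempty_typicalSet hC hL hR hr hLr hn)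
    (ψ := fun X ω => laplaceProfile C ε L r n (leftMedian X) ω)
    (continuous_laplaceProfile.comp
      ((continuous_leftMedian.comp continuous_fst).prodMk continuous_snd))
    (fun X ω => (laplaceProfile_pos _ _).le) hη).mul_const (laplaceNormalizer C ε L R r n)⁻¹
  have h' := h.indicator (measurable_snd (measurableSet_outputInterval (C := C) (R := R) (r := r)))
  convert h' using 1
  funext ⟨X, ω⟩
  exact extensionWeight_eq hC hL hR hr η X ω

/-- The weight of the extended mechanism is comparable to the uniform weight. -/
lemma extensionWeight_bounds (hC : 1 ≤ C) (hε : 0 < ε) (hL : 0 < L) (hR : 0 < R) (hr : 0 < r)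
    (hLr : L * r ≤ 1 / 2) (hn : 0 < n) (X : Fin n → ℝ) :
    ∃ a : ℝ, 0 < a ∧ ∀ ω,
      a * Real.exp (-(ε / 4) * (L * r * n)) * (outputInterval C R r).indicator 1 ω ≤
        extensionWeight (typicalSet C L R r n) (flattenedLaplaceDensity C ε L R r) (ε / 2) X ω ∧
      extensionWeight (typicalSet C L R r n) (flattenedLaplaceDensity C ε L R r) (ε / 2) X ω ≤
        a * (outputInterval C R r).indicator 1 ω := by
  have hne := nonempty_typicalSet hC hL hR hr hLr hn
  have : Nonempty (typicalSet C L R r n) := hne.to_subtype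
  have hJ := laplaceNormalizer_pos (L := L) (n := n) (C := C) (by linarith) hε hR hr
  set J := laplaceNormalizer C ε L R r n
  -- The exponential of the distance to the typical set may be huge, but it is the same factor in
  -- both bounds and cancels on normalization.
  set δ : ℝ := ⨅ X' : typicalSet C L R r n,
    Real.exp (ε / 2 * (hammingDist X (X' : Fin n → ℝ) : ℝ)) with hδ
  have hbdd : BddBelow (range fun X' : typicalSet C L R r n =>
      Real.exp (ε / 2 * (hammingDist X (X' : Fin n → ℝ) : ℝ))) := by
    refine ⟨1, ?_⟩
    rintro _ ⟨X', rfl⟩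
    exact Real.one_le_exp (by positivity)
  have hδ1 : 1 ≤ δ := le_ciInf fun X' => Real.one_le_exp (by positivity)
  refine ⟨δ * J⁻¹, by positivity, fun ω => ?_⟩
  rw [extensionWeight_eq hC hL hR hr]
  by_cases hω : ω ∈ outputInterval C R r
  · simp only [indicator_of_mem hω, Pi.one_apply, mul_one]
    have hbdd' : BddBelow (range fun X' : typicalSet C L R r n =>
      Real.exp (ε / 2 * (hammingDist X (X' : Fin n → ℝ) : ℝ)) *
          laplaceProfile C ε L r n (leftMedian (X' : Fin n → ℝ)) ω) := by
      refine ⟨0, ?_⟩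
      rintro _ ⟨X', rfl⟩
      exact mul_nonneg (Real.exp_pos _).le (laplaceProfile_pos _ _).le
    constructor
    · rw [mul_right_comm]
      refine mul_le_mul_of_nonneg_right (le_ciInf fun X' => ?_) (by positivity)
      exact mul_le_mul (ciInf_le hbdd X') (exp_neg_le_laplaceProfile hε _ _) (Real.exp_pos _).le
        (Real.exp_pos _).le
    · refine mul_le_mul_of_nonneg_right (ciInf_mono hbdd' fun X' => ?_) (by positivity)
      exact mul_le_of_le_one_right (Real.exp_pos _).le
        (laplaceProfile_le_one (by linarith) hε hL hr _ _)
  · simp [indicator_of_notMem hω]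

lemma integrable_indicator_one_outputInterval :
    Integrable ((outputInterval C R r).indicator (1 : ℝ → ℝ)) :=
  (integrable_indicator_iff measurableSet_outputInterval).2
    (continuousOn_const.integrableOn_compact isCompact_Icc)

lemma integral_indicator_one_outputInterval (hC : 0 < C) (hR : 0 < R) (hr : 0 < r) :
    ∫ ω, (outputInterval C R r).indicator (1 : ℝ → ℝ) ω = 2 * R + 8 * C * r := by
  rw [integral_indicator_one measurableSet_outputInterval, volume_outputInterval hC hR hr]

lemma integrable_extensionWeight (hC : 1 ≤ C) (hε : 0 < ε) (hL : 0 < L) (hR : 0 < R) (hr : 0 < r)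
    (hLr : L * r ≤ 1 / 2) (hn : 0 < n) (X : Fin n → ℝ) :
    Integrable (extensionWeight (typicalSet C L R r n)
      (flattenedLaplaceDensity C ε L R r) (ε / 2) X) := by
  obtain ⟨a, ha, h⟩ := extensionWeight_bounds hC hε hL hR hr hLr hn X
  refine ((integrable_indicator_one_outputInterval (C := C) (R := R) (r := r)).const_mul a).mono' ?_ ?_
  · exact ((measurable_extensionWeight hC hL hR hr hLr hn (by positivity)).comp
      measurable_prodMk_left).aestronglyMeasurable
  · refine Filter.Eventually.of_forall fun ω => ?_
    rw [Real.norm_of_nonneg (extensionWeight_nonneg flattenedLaplaceDensity_nonneg X ω)]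
    exact (h ω).2

lemma integral_extensionWeight_pos (hC : 1 ≤ C) (hε : 0 < ε) (hL : 0 < L) (hR : 0 < R)
    (hr : 0 < r) (hLr : L * r ≤ 1 / 2) (hn : 0 < n) (X : Fin n → ℝ) :
    0 < ∫ ω, extensionWeight (typicalSet C L R r n)
      (flattenedLaplaceDensity C ε L R r) (ε / 2) X ω := by
  obtain ⟨a, ha, h⟩ := extensionWeight_bounds hC hε hL hR hr hLr hn X
  have h1 := integral_mono (integrable_indicator_one_outputInterval.const_mul _)
    (integrable_extensionWeight hC hε hL hR hr hLr hn X) fun ω => (h ω).1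
  rw [integral_const_mul, integral_indicator_one_outputInterval (by linarith) hR hr] at h1
  refine lt_of_lt_of_le ?_ h1
  positivity

theorem isRandomizedAlgorithm_algorithm (hC : 1 ≤ C) (hε : 0 < ε) (hL : 0 < L) (hR : 0 < R)
    (hr : 0 < r) (hLr : L * r ≤ 1 / 2) (hn : 0 < n) :
    IsRandomizedAlgorithm (algorithm C ε L R r : (Fin n → ℝ) → Measure ℝ) :=
  isRandomizedAlgorithm_of_weight
    (measurable_extensionWeight hC hL hR hr hLr hn (by positivity))
    (extensionWeight_nonneg flattenedLaplaceDensity_nonneg)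
    (integrable_extensionWeight hC hε hL hR hr hLr hn)
    (integral_extensionWeight_pos hC hε hL hR hr hLr hn)

theorem isDifferentiallyPrivate_algorithm (hC : 1 ≤ C) (hε : 0 < ε) (hL : 0 < L) (hR : 0 < R)
    (hr : 0 < r) (hLr : L * r ≤ 1 / 2) (hn : 0 < n) :
    IsDifferentiallyPrivate ε (algorithm C ε L R r : (Fin n → ℝ) → Measure ℝ) :=
  isDifferentiallyPrivate_extension (nonempty_typicalSet hC hL hR hr hLr hn)
    flattenedLaplaceDensity_nonneg hε.le
    (integrable_extensionWeight hC hε hL hR hr hLr hn)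
    (integral_extensionWeight_pos hC hε hL hR hr hLr hn)

end Mechanism

end PrivateMedian

/-! ### Well-spread inputs: comparison with the flattened Laplace mechanism. -/

namespace PrivateMedian

/-- `X` has many entries near its median, on both sides: at least as many as in the definition of
the typical set for all `κ > k`, and at least `Lnr / 2` within distance `7r / 8`. -/
structure WellSpread (C L r : ℝ) (k : ℕ) {n : ℕ} (X : Fin n → ℝ) : Prop where
  right : ∀ κ : ℕ, k < κ → (κ : ℝ) ≤ L * n * r / (2 * C) →
    n / 2 - 1 + 1 + κ ≤ count X (· ≤ leftMedian X + κ * C / (L * n))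
  left : ∀ κ : ℕ, k < κ → (κ : ℝ) ≤ L * n * r / (2 * C) →
    n - (n / 2 - 1) + κ ≤ count X (leftMedian X - κ * C / (L * n) ≤ ·)
  right_far : ((n / 2 - 1 + 1 : ℕ) : ℝ) + L * n * r / 2 ≤ count X (· ≤ leftMedian X + 7 * r / 8)
  left_far : ((n - (n / 2 - 1) : ℕ) : ℝ) + L * n * r / 2 ≤ count X (leftMedian X - 7 * r / 8 ≤ ·)

section

variable {C ε L R r : ℝ} {n k : ℕ}

/-- Changing d entries lowers a count by at most d, so a surplus of d over the required rank at m ±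
s traps the new median. -/
lemma abs_leftMedian_sub_le (hn : 0 < n) {X X' : Fin n → ℝ} {s : ℝ}
    (h1 : n / 2 - 1 + 1 + hammingDist X X' ≤ count X (· ≤ leftMedian X + s))
    (h2 : n - (n / 2 - 1) + hammingDist X X' ≤ count X (leftMedian X - s ≤ ·)) :
    |leftMedian X' - leftMedian X| ≤ s := by
  have h3 : leftMedian X' ≤ leftMedian X + s := by
    rw [leftMedian_le_iff hn]
    have := count_le_count_add_hammingDist X X' (· ≤ leftMedian X + s)
    omega
  have h4 : leftMedian X - s ≤ leftMedian X' := by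
    rw [le_leftMedian_iff hn]
    have := count_le_count_add_hammingDist X X' (leftMedian X - s ≤ ·)
    omega
  rw [abs_le]
  constructor <;> linarith

/-- Moving away from `X` is charged ε/2 per changed entry, which pays for the displacement of the
median. This needs spread of `X` only; the other input is arbitrary. -/
lemma WellSpread.exp_mul_laplaceProfile_le (hC : 1 ≤ C) (hε : 0 < ε) (hL : 0 < L) (hr : 0 < r)
    (hn : 0 < n) {X : Fin n → ℝ} (hX : WellSpread C L r k X) (X' : Fin n → ℝ) (ω : ℝ) :
    Real.exp (-(ε / 2 * (k + 1))) * laplaceProfile C ε L r n (leftMedian X) ω ≤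
      Real.exp (ε / 2 * (hammingDist X X' : ℝ)) *
        laplaceProfile C ε L r n (leftMedian X') ω := by
  unfold laplaceProfile
  rw [← Real.exp_add, ← Real.exp_add]
  refine Real.exp_le_exp.2 ?_
  set d := hammingDist X X' with hd
  have hn' : (0 : ℝ) < n := by exact_mod_cast hn
  set m := leftMedian X
  set m' := leftMedian X'
  have hc : 0 < L * n / (3 * C) := by positivity
  suffices h : min (L * n / (3 * C) * |m' - ω|) (L * r * n) ≤
      min (L * n / (3 * C) * |m - ω|) (L * r * n) + 2 * d + 2 * (k + 1) by nlinarith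
  have hA : 0 ≤ min (L * n / (3 * C) * |m - ω|) (L * r * n) := by positivity
  -- Beyond Lrn/2 changes, the cap of the flattened profile alone gives the bound.
  rcases le_or_gt (L * r * n) (2 * d) with h2d | h2d
  · have := min_le_right (L * n / (3 * C) * |m' - ω|) (L * r * n)
    linarith [(Nat.cast_nonneg k : (0 : ℝ) ≤ k)]
  · have key : L * n / (3 * C) * |m' - m| ≤ d + (k + 1) := by
      have hmax : ((max d (k + 1) : ℕ) : ℝ) ≤ d + (k + 1) := by
        have : max d (k + 1) ≤ d + (k + 1) := by omega
        exact_mod_cast this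
      have hdκ : d ≤ max d (k + 1) := le_max_left _ _
      have hkκ : k < max d (k + 1) := lt_of_lt_of_le (Nat.lt_succ_self k) (le_max_right _ _)
      -- Spread is only assumed at scales above `k`, so a small distance is rounded up to `k + 1`.
      set κ := max d (k + 1)
      rcases le_or_gt (κ : ℝ) (L * n * r / (2 * C)) with hκ | hκ
      · have h1 := hX.right κ hkκ hκ
        have h2 := hX.left κ hkκ hκ
        have h3 : |m' - m| ≤ κ * C / (L * n) :=
          abs_leftMedian_sub_le hn (by omega) (by omega)
        have h4 : L * n / (3 * C) * (κ * C / (L * n)) = κ / 3 := by field_simp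
        have h5 := mul_le_mul_of_nonneg_left h3 hc.le
        have h6 : (0 : ℝ) ≤ κ := Nat.cast_nonneg _
        linarith
      -- The scale exceeds the range of the fine counts, but d < Lnr/2, so the far counts confine
      -- the median to distance 7r/8. In units of the noise this is 7/12 of Lnr/(2C), which is less
      -- than κ.
      · have h1 := hX.right_far
        have h2 := hX.left_far
        have h2d' : (d : ℝ) ≤ L * n * r / 2 := by nlinarith
        have h3 : |m' - m| ≤ 7 * r / 8 := by
          refine abs_leftMedian_sub_le hn ?_ ?_
          · have := h1.trans' (add_le_add_right h2d' _)
            exact_mod_cast this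
          · have := h2.trans' (add_le_add_right h2d' _)
            exact_mod_cast this
        have h5 := mul_le_mul_of_nonneg_left h3 hc.le
        have h4 : L * n / (3 * C) * (7 * r / 8) = 7 / 12 * (L * n * r / (2 * C)) := by
          field_simp; norm_num
        have : 0 < L * n * r / (2 * C) := by positivity
        linarith
    have htri : |m' - ω| ≤ |m' - m| + |m - ω| := abs_sub_le _ _ _
    have h7 := mul_le_mul_of_nonneg_left htri hc.le
    have hd0 : (0 : ℝ) ≤ d := Nat.cast_nonneg _
    have hk0 : (0 : ℝ) ≤ k := Nat.cast_nonneg _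
    rcases le_total (L * n / (3 * C) * |m - ω|) (L * r * n) with h8 | h8
    · rw [min_eq_left h8]
      refine (min_le_left _ _).trans ?_
      nlinarith
    · rw [min_eq_right h8]
      refine (min_le_right _ _).trans ?_
      linarith

/-- Planting up to `k` entries at the median supplies the counts for κ ≤ k; for larger κ the spread
of `X` supplies them, and planting cannot decrease them. -/
lemma WellSpread.exists_mem_typicalSet (hC : 1 ≤ C) (hL : 0 < L)
    (hLr : L * r ≤ 1 / 2) (hn : 0 < n) {X : Fin n → ℝ} (hX : WellSpread C L r k X)
    (hm : leftMedian X ∈ Icc (-R - r / 2) (R + r / 2)) :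
    ∃ X' ∈ typicalSet C L R r n, hammingDist X X' ≤ k ∧ leftMedian X' = leftMedian X := by
  classical
  set t := leftMedian X with ht
  obtain ⟨i₀, hi₀⟩ := exists_eq_leftMedian hn X
  -- One index attaining the median is kept aside: together with it, the planted entries number `min
  -- k (n - 1) + 1`, the `κ + 1` that typicality asks for.
  have hcard : min k (n - 1) ≤ (Finset.univ.erase i₀).card := by
    rw [Finset.card_erase_of_mem (Finset.mem_univ _), Finset.card_univ, Fintype.card_fin]
    exact min_le_right _ _
  obtain ⟨T, hTsub, hT⟩ := Finset.exists_subset_card_eq hcard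
  have hi₀T : i₀ ∉ T := fun h => by simpa using hTsub h
  set X' : Fin n → ℝ := fun j => if j ∈ T then t else X j with hX'
  have hX'1 : ∀ j, j ∈ T → X' j = t := fun j hj => if_pos hj
  have hX'2 : ∀ j, j ∉ T → X' j = X j := fun j hj => if_neg hj
  have hmed : leftMedian X' = t := by
    refine leftMedian_eq_of_count hn _ _ ?_ ?_
    · refine le_trans ?_ (count_lt_leftMedian hn X)
      unfold count
      refine Finset.card_le_card fun j hj => ?_
      simp only [Finset.mem_filter, Finset.mem_univ, true_and] at hj ⊢
      by_cases hjT : j ∈ T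
      · rw [hX'1 j hjT] at hj; exact absurd hj (lt_irrefl _)
      · rwa [hX'2 j hjT] at hj
    · refine le_trans ((leftMedian_le_iff hn X t).1 le_rfl) ?_
      unfold count
      refine Finset.card_le_card fun j hj => ?_
      simp only [Finset.mem_filter, Finset.mem_univ, true_and] at hj ⊢
      by_cases hjT : j ∈ T
      · rw [hX'1 j hjT]
      · rwa [hX'2 j hjT]
  have hsmall : ∀ (p : ℝ → Prop) [DecidablePred p] (κ : ℕ), p t → κ ≤ min k (n - 1) →
      κ + 1 ≤ (Finset.univ.filter fun j => p (X' j)).card := by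
    intro p _ κ hp hκ
    have : (insert i₀ T).card = min k (n - 1) + 1 := by
      rw [Finset.card_insert_of_notMem hi₀T, hT]
    rw [← Nat.add_le_add_iff_right (n := 1), ← this] at hκ
    refine hκ.trans (Finset.card_le_card fun j hj => ?_)
    rw [Finset.mem_filter]
    refine ⟨Finset.mem_univ _, ?_⟩
    rcases Finset.mem_insert.1 hj with rfl | hj
    · rwa [hX'2 _ hi₀T, hi₀]
    · rwa [hX'1 _ hj]
  have hlarge : ∀ (p : ℝ → Prop) [DecidablePred p], p t →
      count X p ≤ (Finset.univ.filter fun j => p (X' j)).card := by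
    intro p _ hp
    refine Finset.card_le_card fun j hj => ?_
    simp only [Finset.mem_filter, Finset.mem_univ, true_and] at hj ⊢
    by_cases hjT : j ∈ T
    · rwa [hX'1 j hjT]
    · rwa [hX'2 j hjT]
  refine ⟨X', ⟨fun κ h1 h2 => ?_, by rwa [hmed]⟩, ?_, hmed⟩
  · have hκn : κ ≤ n - 1 := by
      have hn' : (1 : ℝ) ≤ n := by exact_mod_cast hn
      have h3 : (κ : ℝ) * (2 * C) ≤ L * n * r := by rwa [le_div_iff₀ (by positivity)] at h2
      have h4 : L * n * r ≤ n / 2 := by nlinarith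
      have h5 : (1 : ℝ) ≤ κ := by exact_mod_cast h1
      have : (κ : ℝ) + 1 ≤ n := by nlinarith
      have : κ + 1 ≤ n := by exact_mod_cast this
      omega
    have hw : 0 ≤ (κ : ℝ) * C / (L * n) := by positivity
    rw [hmed]
    rcases le_or_gt κ k with hκ | hκ
    · exact ⟨hsmall (fun x => 0 ≤ x - t ∧ x - t ≤ κ * C / (L * n)) κ (by simp [hw])
          (le_min hκ hκn),
        hsmall (fun x => 0 ≤ t - x ∧ t - x ≤ κ * C / (L * n)) κ (by simp [hw]) (le_min hκ hκn)⟩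
    · constructor
      · refine le_trans ?_ (hlarge (fun x => 0 ≤ x - t ∧ x - t ≤ κ * C / (L * n)) (by simp [hw]))
        have e1 := hX.right κ hκ h2
        rw [← ht] at e1
        have e2 := count_lt_leftMedian hn X
        rw [← ht] at e2
        -- Fewer than the rank of the median lie strictly below it, so the surplus in the one-sided
        -- count consists of entries in [t, t + κC/(Ln)], the median included.
        have e3 : count X (· ≤ t + κ * C / (L * n)) ≤
            count X (fun x => x < t ∨ (0 ≤ x - t ∧ x - t ≤ κ * C / (L * n))) := by
          refine count_mono X fun x hx => ?_
          rcases lt_or_ge x t with h | h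
          · exact Or.inl h
          · exact Or.inr ⟨by linarith, by linarith⟩
        have e4 := count_or_le X (· < t) (fun x => 0 ≤ x - t ∧ x - t ≤ κ * C / (L * n))
        omega
      · refine le_trans ?_ (hlarge (fun x => 0 ≤ t - x ∧ t - x ≤ κ * C / (L * n)) (by simp [hw]))
        have e1 := hX.left κ hκ h2
        rw [← ht] at e1
        have e2 := count_gt_leftMedian hn X
        rw [← ht] at e2
        have e3 : count X (t - κ * C / (L * n) ≤ ·) ≤
            count X (fun x => t < x ∨ (0 ≤ t - x ∧ t - x ≤ κ * C / (L * n))) := by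
          refine count_mono X fun x hx => ?_
          rcases lt_or_ge t x with h | h
          · exact Or.inl h
          · exact Or.inr ⟨by linarith, by linarith⟩
        have e4 := count_or_le X (t < ·) (fun x => 0 ≤ t - x ∧ t - x ≤ κ * C / (L * n))
        omega
  · refine le_trans (Finset.card_le_card fun j hj => ?_) (hT.le.trans (min_le_left _ _))
    by_contra hjT
    exact (Finset.mem_filter.1 hj).2 (hX'2 j hjT).symm

/-- On a well-spread input, the weight of the extended mechanism is comparable to that of the
flattened Laplace mechanism. -/
lemma WellSpread.extensionWeight_bounds (hC : 1 ≤ C) (hε : 0 < ε) (hL : 0 < L) (hR : 0 < R)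
    (hr : 0 < r) (hLr : L * r ≤ 1 / 2) (hn : 0 < n) {X : Fin n → ℝ} (hX : WellSpread C L r k X)
    (hm : leftMedian X ∈ Icc (-R - r / 2) (R + r / 2)) (ω : ℝ) :
    Real.exp (-(ε / 2 * (k + 1))) / laplaceNormalizer C ε L R r n *
        truncatedProfile C ε L R r n (leftMedian X) ω ≤
      extensionWeight (typicalSet C L R r n) (flattenedLaplaceDensity C ε L R r) (ε / 2) X ω ∧
    extensionWeight (typicalSet C L R r n) (flattenedLaplaceDensity C ε L R r) (ε / 2) X ω ≤
      Real.exp (ε / 2 * k) / laplaceNormalizer C ε L R r n *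
        truncatedProfile C ε L R r n (leftMedian X) ω := by
  have hJ := laplaceNormalizer_pos (L := L) (n := n) (C := C) (by linarith) hε hR hr
  constructor
  · refine le_extensionWeight (nonempty_typicalSet hC hL hR hr hLr hn) _ _ _ fun X' hX' => ?_
    rw [flattenedLaplaceDensity_eq hC hL hR hr hX'.2]
    unfold truncatedProfile
    by_cases hω : ω ∈ outputInterval C R r
    · rw [indicator_of_mem hω, indicator_of_mem hω, div_mul_eq_mul_div, ← mul_div_assoc]
      exact div_le_div_of_nonneg_right (hX.exp_mul_laplaceProfile_le hC hε hL hr hn X' ω) hJ.le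
    · rw [indicator_of_notMem hω, indicator_of_notMem hω]
      simp
  · obtain ⟨X', h1, h2, h3⟩ := hX.exists_mem_typicalSet hC hL hLr hn hm
    refine (extensionWeight_le flattenedLaplaceDensity_nonneg X h1 ω).trans ?_
    rw [flattenedLaplaceDensity_eq hC hL hR hr h1.2, h3, ← mul_div_assoc,
      div_mul_eq_mul_div (Real.exp (ε / 2 * k))]
    refine div_le_div_of_nonneg_right (mul_le_mul_of_nonneg_right (Real.exp_le_exp.2 ?_)
      (truncatedProfile_nonneg _ _)) hJ.le
    have : (hammingDist X X' : ℝ) ≤ k := by exact_mod_cast h2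
    gcongr

lemma WellSpread.algorithm_apply_le (hC : 1 ≤ C) (hε : 0 < ε) (hL : 0 < L) (hR : 0 < R)
    (hr : 0 < r) (hLr : L * r ≤ 1 / 2) (hn : 0 < n) {X : Fin n → ℝ} (hX : WellSpread C L r k X)
    (hm : leftMedian X ∈ Icc (-R - r / 2) (R + r / 2)) {S : Set ℝ} (hS : MeasurableSet S) :
    algorithm C ε L R r X S ≤ ENNReal.ofReal (Real.exp (ε / 2 * (2 * k + 1)) *
      ((∫ ω in S, truncatedProfile C ε L R r n (leftMedian X) ω) /
        laplaceNormalizer C ε L R r n)) := by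
  have hJ := laplaceNormalizer_pos (L := L) (n := n) (C := C) (by linarith) hε hR hr
  have hJ' := integral_truncatedProfile_eq_normalizer (ε := ε) (n := n) hC hL hR hr hm
  have hb := hX.extensionWeight_bounds hC hε hL hR hr hLr hn hm
  refine (extension_apply_le flattenedLaplaceDensity_nonneg
    (integrable_truncatedProfile (C := C) (ε := ε) (L := L) (R := R) (r := r) (n := n)
      (leftMedian X)) (by rw [hJ']; exact hJ)
    (integrable_extensionWeight hC hε hL hR hr hLr hn X) (by positivity) (fun ω => (hb ω).1)
    (fun ω => (hb ω).2) hS).trans_eq ?_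
  rw [hJ', div_div_div_cancel_right₀ hJ.ne', ← Real.exp_sub]
  ring_nf

lemma WellSpread.le_algorithm_apply (hC : 1 ≤ C) (hε : 0 < ε) (hL : 0 < L) (hR : 0 < R)
    (hr : 0 < r) (hLr : L * r ≤ 1 / 2) (hn : 0 < n) {X : Fin n → ℝ} (hX : WellSpread C L r k X)
    (hm : leftMedian X ∈ Icc (-R - r / 2) (R + r / 2)) {S : Set ℝ} (hS : MeasurableSet S) :
    ENNReal.ofReal (Real.exp (-(ε / 2 * (2 * k + 1))) *
      ((∫ ω in S, truncatedProfile C ε L R r n (leftMedian X) ω) /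
        laplaceNormalizer C ε L R r n)) ≤ algorithm C ε L R r X S := by
  have hJ := laplaceNormalizer_pos (L := L) (n := n) (C := C) (by linarith) hε hR hr
  have hJ' := integral_truncatedProfile_eq_normalizer (ε := ε) (n := n) hC hL hR hr hm
  have hb := hX.extensionWeight_bounds hC hε hL hR hr hLr hn hm
  refine le_trans (le_of_eq ?_) (le_extension_apply flattenedLaplaceDensity_nonneg
    (integrable_truncatedProfile (C := C) (ε := ε) (L := L) (R := R) (r := r) (n := n)
      (leftMedian X)) (truncatedProfile_nonneg _) (by rw [hJ']; exact hJ)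
    (integrable_extensionWeight hC hε hL hR hr hLr hn X) (by positivity) (fun ω => (hb ω).1)
    (fun ω => (hb ω).2) hS)
  rw [hJ', div_div_div_cancel_right₀ hJ.ne', ← Real.exp_sub]
  ring_nf

/-- On every input, the output distribution dominates a multiple of the uniform one. -/
lemma le_algorithm_apply_uniform (hC : 1 ≤ C) (hε : 0 < ε) (hL : 0 < L) (hR : 0 < R)
    (hr : 0 < r) (hLr : L * r ≤ 1 / 2) (hn : 0 < n) (X : Fin n → ℝ) {S : Set ℝ}
    (hS : MeasurableSet S) (hSI : S ⊆ outputInterval C R r) :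
    ENNReal.ofReal (Real.exp (-(ε / 4) * (L * r * n)) *
      ((volume : Measure ℝ).real S / (2 * R + 8 * C * r))) ≤ algorithm C ε L R r X S := by
  obtain ⟨a, ha, hb⟩ := PrivateMedian.extensionWeight_bounds hC hε hL hR hr hLr hn X
  have hI := integral_indicator_one_outputInterval (C := C) (R := R) (r := r) (by linarith) hR hr
  refine le_trans (le_of_eq ?_) (le_extension_apply flattenedLaplaceDensity_nonneg
    (integrable_indicator_one_outputInterval (C := C) (R := R) (r := r))
    (fun ω => indicator_nonneg (fun _ _ => zero_le_one) ω) (by rw [hI]; positivity)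
    (integrable_extensionWeight hC hε hL hR hr hLr hn X) (by positivity) (fun ω => (hb ω).1)
    (fun ω => (hb ω).2) hS)
  rw [hI, mul_div_cancel_left₀ _ ha.ne', setIntegral_indicator measurableSet_outputInterval,
    inter_eq_left.2 hSI]
  simp

end

end PrivateMedian

/-! ### Normalizer and tails of the flattened Laplace mechanism. -/

namespace PrivateMedian

lemma integrable_exp_neg_mul_abs {μ : ℝ} (hμ : 0 < μ) (t : ℝ) :
    Integrable fun ω : ℝ => Real.exp (-(μ * |t - ω|)) := by
  have h0 : Integrable fun x : ℝ => Real.exp (-(μ * |x|)) := by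
    rw [← integrableOn_univ, ← Iic_union_Ioi (a := (0 : ℝ))]
    refine IntegrableOn.union ?_ ?_
    · refine (integrableOn_exp_mul_Iic hμ 0).congr_fun (fun x hx => ?_) measurableSet_Iic
      simp only
      rw [abs_of_nonpos hx]; ring_nf
    · refine (integrableOn_exp_mul_Ioi (neg_lt_zero.2 hμ) 0).congr_fun (fun x hx => ?_)
        measurableSet_Ioi
      simp only
      rw [abs_of_pos hx]; ring_nf
  exact h0.comp_sub_left t

lemma integral_exp_neg_mul_abs {μ : ℝ} (hμ : 0 < μ) (t : ℝ) :
    ∫ ω : ℝ, Real.exp (-(μ * |t - ω|)) = 2 / μ := by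
  rw [integral_sub_left_eq_self (fun x => Real.exp (-(μ * |x|))) volume t,
    integral_comp_abs (f := fun x => Real.exp (-(μ * x)))]
  have := integral_exp_mul_Ioi (neg_lt_zero.2 hμ) 0
  simp only [← neg_mul]
  rw [this]
  simp only [mul_zero, Real.exp_zero]
  field_simp

section

variable {C ε L R r : ℝ} {n : ℕ}

lemma laplaceProfile_eq (t ω : ℝ) (hε : 0 ≤ ε) :
    laplaceProfile C ε L r n t ω =
      Real.exp (-min (ε * L * n / (12 * C) * |t - ω|) (ε * L * r * n / 4)) := by
  unfold laplaceProfile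
  rw [neg_mul, mul_min_of_nonneg _ _ (by positivity : 0 ≤ ε / 4)]
  congr 2
  ring_nf

lemma laplaceProfile_le_add (hε : 0 ≤ ε) (t ω : ℝ) :
    laplaceProfile C ε L r n t ω ≤
      Real.exp (-(ε * L * n / (12 * C) * |t - ω|)) + Real.exp (-(ε * L * r * n / 4)) := by
  rw [laplaceProfile_eq t ω hε]
  rcases min_choice (ε * L * n / (12 * C) * |t - ω|) (ε * L * r * n / 4) with h | h <;> rw [h]
  · exact le_add_of_nonneg_right (Real.exp_pos _).le
  · exact le_add_of_nonneg_left (Real.exp_pos _).le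

lemma exp_neg_one_mul_le {lam : ℝ} (hlam : lam = ε * L * n / (12 * C)) (hε : 0 ≤ ε) {t ω s : ℝ}
    (hlam0 : 0 ≤ lam) (h : |t - ω| ≤ s) :
    Real.exp (-(lam * s)) ≤ laplaceProfile C ε L r n t ω := by
  rw [laplaceProfile_eq t ω hε, ← hlam]
  refine Real.exp_le_exp.2 (neg_le_neg ((min_le_left _ _).trans ?_))
  exact mul_le_mul_of_nonneg_left h hlam0

/-- The profile is at most the Laplace exponential plus the flat level. Half of the exponent gives
the decay at distance `a`, the other half keeps the integral finite; the flat level is paid over the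
length of the output interval. -/
lemma setIntegral_truncatedProfile_tail_le (hC : 0 < C) (hε : 0 < ε) (hL : 0 < L) (hR : 0 < R)
    (hr : 0 < r) (hn : 0 < n) (t : ℝ) (a : ℝ) :
    ∫ ω in {ω | a ≤ |t - ω|}, truncatedProfile C ε L R r n t ω ≤
      Real.exp (-(ε * L * n / (12 * C) * a / 2)) * (4 / (ε * L * n / (12 * C))) +
        (2 * R + 8 * C * r) * Real.exp (-(ε * L * r * n / 4)) := by
  have hn' : (0 : ℝ) < n := by exact_mod_cast hn
  have hlam : 0 < ε * L * n / (12 * C) := by positivity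
  set lam := ε * L * n / (12 * C) with hlamdef
  set y := ε * L * r * n / 4 with hy
  have hS : MeasurableSet {ω : ℝ | a ≤ |t - ω|} :=
    measurableSet_le measurable_const (by fun_prop)
  have hint : Integrable fun ω => Real.exp (-(lam * a / 2)) * Real.exp (-(lam / 2 * |t - ω|)) +
      Real.exp (-y) * (outputInterval C R r).indicator 1 ω :=
    ((integrable_exp_neg_mul_abs (half_pos hlam) t).const_mul _).add
      (integrable_indicator_one_outputInterval.const_mul _)
  rw [← integral_indicator hS]
  calc ∫ ω, {ω : ℝ | a ≤ |t - ω|}.indicator (truncatedProfile C ε L R r n t) ω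
      ≤ ∫ ω, (Real.exp (-(lam * a / 2)) * Real.exp (-(lam / 2 * |t - ω|)) +
          Real.exp (-y) * (outputInterval C R r).indicator 1 ω) := by
        refine integral_mono ((integrable_truncatedProfile t).indicator hS) hint fun ω => ?_
        by_cases h1 : ω ∈ {ω : ℝ | a ≤ |t - ω|} <;> by_cases h2 : ω ∈ outputInterval C R r
        · simp only [indicator_of_mem h1, truncatedProfile, indicator_of_mem h2, Pi.one_apply,
            mul_one]
          refine (laplaceProfile_le_add hε.le t ω).trans (add_le_add_left ?_ _)
          rw [← Real.exp_add]
          refine Real.exp_le_exp.2 ?_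
          have : lam * a ≤ lam * |t - ω| := mul_le_mul_of_nonneg_left h1 hlam.le
          rw [← hlamdef]
          linarith
        · simp only [indicator_of_mem h1, truncatedProfile, indicator_of_notMem h2]
          positivity
        · simp only [indicator_of_notMem h1, indicator_of_mem h2, Pi.one_apply]
          positivity
        · simp only [indicator_of_notMem h1, indicator_of_notMem h2]
          positivity
    _ = _ := by
        rw [integral_add ((integrable_exp_neg_mul_abs (half_pos hlam) t).const_mul _)
          (integrable_indicator_one_outputInterval.const_mul _), integral_const_mul,
          integral_const_mul, integral_exp_neg_mul_abs (half_pos hlam),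
          integral_indicator_one_outputInterval hC hR hr]
        field_simp
        ring

lemma le_setIntegral_truncatedProfile {S : Set ℝ} (hS : MeasurableSet S)
    (hSI : S ⊆ outputInterval C R r) {t c : ℝ}
    (h : ∀ ω ∈ S, c ≤ laplaceProfile C ε L r n t ω) :
    (volume : Measure ℝ).real S * c ≤ ∫ ω in S, truncatedProfile C ε L R r n t ω := by
  have hfin : volume S ≠ ⊤ := (lt_of_le_of_lt (measure_mono hSI) measure_Icc_lt_top).ne
  rw [← smul_eq_mul, ← setIntegral_const]
  refine setIntegral_mono_on (integrableOn_const hfin)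
    (integrable_truncatedProfile t).integrableOn hS fun ω hω => ?_
  unfold truncatedProfile
  rw [indicator_of_mem (hSI hω)]
  exact h ω hω

/-- Within one noise scale 12C/(εLn) of the centre the profile is at least e^{-1}, and `hy` says
that this scale is at most 3Cr, inside the output interval. -/
lemma le_laplaceNormalizer (hC : 0 < C) (hε : 0 < ε) (hL : 0 < L) (hR : 0 < R)
    (hr : 0 < r) (hn : 0 < n) (hy : 1 ≤ ε * L * r * n / 4) :
    2 / (ε * L * n / (12 * C)) * Real.exp (-1) ≤ laplaceNormalizer C ε L R r n := by
  have hn' : (0 : ℝ) < n := by exact_mod_cast hn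
  have hlam : 0 < ε * L * n / (12 * C) := by positivity
  have hy' : 1 ≤ ε * L * n / (12 * C) * (3 * C * r) := by
    refine hy.trans_eq ?_
    field_simp; norm_num
  set lam := ε * L * n / (12 * C) with hlamdef
  have h1 : 1 / lam ≤ 3 * C * r := by
    rw [div_le_iff₀ hlam]; linarith
  have hCr : 0 < C * r := by positivity
  have h2 : Icc (-(1 / lam)) (1 / lam) ⊆ outputInterval C R r := by
    refine Icc_subset_Icc ?_ ?_ <;> nlinarith
  have h3 := le_setIntegral_truncatedProfile (ε := ε) (L := L) (n := n) (t := 0)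
    (c := Real.exp (-1)) measurableSet_Icc h2 fun ω hω => by
      refine le_trans (le_of_eq ?_) (exp_neg_one_mul_le hlamdef hε.le hlam.le (s := 1 / lam) ?_)
      · rw [mul_one_div_cancel hlam.ne']
      · rw [zero_sub, abs_neg, abs_le]; exact hω
  rw [Real.volume_real_Icc_of_le (by have : 0 < 1 / lam := by positivity
                                     linarith)] at h3
  have h4 : ∫ ω in Icc (-(1 / lam)) (1 / lam), truncatedProfile C ε L R r n 0 ω ≤
      laplaceNormalizer C ε L R r n :=
    setIntegral_le_integral (integrable_truncatedProfile 0)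
      (Filter.Eventually.of_forall (truncatedProfile_nonneg 0))
  refine le_trans (le_of_eq ?_) (h3.trans h4)
  ring

lemma laplaceNormalizer_le (hC : 0 < C) (hε : 0 < ε) (hL : 0 < L) (hR : 0 < R)
    (hr : 0 < r) (hn : 0 < n) :
    laplaceNormalizer C ε L R r n ≤ 4 / (ε * L * n / (12 * C)) +
        (2 * R + 8 * C * r) * Real.exp (-(ε * L * r * n / 4)) := by
  have h := setIntegral_truncatedProfile_tail_le hC hε hL hR hr hn 0 0
  have : {ω : ℝ | 0 ≤ |0 - ω|} = univ := by
    ext ω; simp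
  rw [this, setIntegral_univ] at h
  simpa [laplaceNormalizer] using h

/-- Tail bound for the flattened Laplace mechanism. -/
lemma setIntegral_tail_div_normalizer_le (hC : 0 < C) (hε : 0 < ε) (hL : 0 < L) (hR : 0 < R)
    (hr : 0 < r) (hn : 0 < n) (hy : 1 ≤ ε * L * r * n / 4) (t a : ℝ) :
    (∫ ω in {ω | a ≤ |t - ω|}, truncatedProfile C ε L R r n t ω) /
        laplaceNormalizer C ε L R r n ≤
      Real.exp 1 * (2 * Real.exp (-(ε * L * n / (12 * C) * a / 2)) +
        ε * L * n / (12 * C) * (R + 4 * C * r) * Real.exp (-(ε * L * r * n / 4))) := by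
  have hn' : (0 : ℝ) < n := by exact_mod_cast hn
  have hlam : 0 < ε * L * n / (12 * C) := by positivity
  have h1 := setIntegral_truncatedProfile_tail_le hC hε hL hR hr hn t a
  have h2 := le_laplaceNormalizer hC hε hL hR hr hn hy
  set lam := ε * L * n / (12 * C) with hlamdef
  rw [div_le_iff₀ (lt_of_lt_of_le (by positivity) h2)]
  refine h1.trans (le_trans (le_of_eq ?_) (mul_le_mul_of_nonneg_left h2 (by positivity)))
  have : Real.exp 1 * Real.exp (-1) = 1 := by rw [← Real.exp_add]; simp
  calc _ = (Real.exp 1 * Real.exp (-1)) * (Real.exp (-(lam * a / 2)) * (4 / lam) +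
      (2 * R + 8 * C * r) * Real.exp (-(ε * L * r * n / 4))) := by rw [this, one_mul]
    _ = _ := by field_simp; ring

end

end PrivateMedian

/-! ### The joint law of the median and the entries on its two sides. -/

namespace PrivateMedian

lemma lintegral_pi_prod_eq {ι : Type*} [Fintype ι] (D : Measure ℝ) [IsProbabilityMeasure D]
    {h : ι → ℝ → ENNReal} (hh : ∀ i, Measurable (h i)) :
    ∫⁻ X : ι → ℝ, ∏ i, h i (X i) ∂(Measure.pi fun _ => D) = ∏ i, ∫⁻ y, h i y ∂D := by
  have hind : ProbabilityTheory.iIndepFun (fun i (X : ι → ℝ) => h i (X i))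
      (Measure.pi fun _ : ι => D) :=
    ProbabilityTheory.iIndepFun_pi (X := h) fun i => (hh i).aemeasurable
  have := ProbabilityTheory.lintegral_prod_eq_prod_lintegral_of_indepFun Finset.univ _ hind
    fun i => (hh i).comp (measurable_pi_apply i)
  rw [this]
  refine Finset.prod_congr rfl fun i _ => ?_
  exact (measurePreserving_eval (fun _ : ι => D) i).lintegral_comp (hh i)

section

variable {N : ℕ} (D : Measure ℝ)

/-- Fubini's theorem for a product of functions of one fixed coordinate and one other. -/
lemma lintegral_pi_split [IsProbabilityMeasure D] (i : Fin (N + 1)) {W : Set ℝ} (hW : MeasurableSet W)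
    {h : Fin N → ℝ → ℝ → ENNReal} (hh : ∀ j, Measurable (Function.uncurry (h j))) :
    ∫⁻ X : Fin (N + 1) → ℝ, W.indicator 1 (X i) * ∏ j, h j (X i) (X (i.succAbove j))
        ∂(Measure.pi fun _ => D) =
      ∫⁻ t in W, ∏ j, ∫⁻ y, h j t y ∂D ∂D := by
  have hmp := measurePreserving_piFinSuccAbove (fun _ : Fin (N + 1) => D) i
  have hF : Measurable fun z : ℝ × (Fin N → ℝ) =>
      (W.indicator 1 z.1 : ENNReal) * ∏ j, h j z.1 (z.2 j) := by
    refine Measurable.mul ((measurable_one.indicator hW).comp measurable_fst) ?_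
    refine Finset.measurable_prod _ fun j _ => ?_
    exact (hh j).comp (measurable_fst.prodMk ((measurable_pi_apply j).comp measurable_snd))
  have h1 := hmp.lintegral_comp hF
  have h2 : ∀ X : Fin (N + 1) → ℝ,
      (W.indicator 1 ((MeasurableEquiv.piFinSuccAbove (fun _ => ℝ) i X).1) : ENNReal) *
        ∏ j, h j (MeasurableEquiv.piFinSuccAbove (fun _ => ℝ) i X).1
          ((MeasurableEquiv.piFinSuccAbove (fun _ => ℝ) i X).2 j) =
      W.indicator 1 (X i) * ∏ j, h j (X i) (X (i.succAbove j)) := fun X => rfl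
  simp_rw [h2] at h1
  rw [h1, lintegral_prod _ hF.aemeasurable, ← lintegral_indicator hW]
  refine lintegral_congr fun t => ?_
  by_cases ht : t ∈ W
  · simp only [indicator_of_mem ht, Pi.one_apply, one_mul]
    exact lintegral_pi_prod_eq D fun j => (hh j).comp measurable_prodMk_left
  · simp [indicator_of_notMem ht]

/-- The event that the entries of `X` smaller than `X i` are those with indices in `S`, and that
the others are larger. -/
def splitEvent (i : Fin (N + 1)) (S : Finset (Fin N)) : Set (Fin (N + 1) → ℝ) :=
  {X | (∀ j, j ∈ S → X (i.succAbove j) < X i) ∧ ∀ j, j ∉ S → X i < X (i.succAbove j)}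

lemma count_eq_add (X : Fin (N + 1) → ℝ) (i : Fin (N + 1)) (p : ℝ → Prop) [DecidablePred p] :
    count X p = (if p (X i) then 1 else 0) +
      (Finset.univ.filter fun j => p (X (i.succAbove j))).card := by
  classical
  unfold count
  rw [Finset.card_filter, Finset.card_filter, Fin.sum_univ_succAbove _ i]
  refine congrArg₂ _ (by split_ifs <;> rfl) (Finset.sum_congr rfl fun j _ => by split_ifs <;> rfl)

lemma leftMedian_eq_of_mem_splitEvent {i : Fin (N + 1)} {S : Finset (Fin N)}
    (hS : S.card = (N + 1) / 2 - 1) {X : Fin (N + 1) → ℝ} (hX : X ∈ splitEvent i S) :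
    leftMedian X = X i := by
  classical
  refine leftMedian_eq_of_count (Nat.succ_pos N) _ _ ?_ ?_
  · rw [count_eq_add X i, if_neg (lt_irrefl _), zero_add, ← hS]
    refine Finset.card_le_card fun j hj => ?_
    by_contra hc
    exact lt_asymm (Finset.mem_filter.1 hj).2 (hX.2 j hc)
  · rw [count_eq_add X i, if_pos le_rfl, ← hS, add_comm]
    refine Nat.add_le_add_left (Finset.card_le_card fun j hj => ?_) 1
    exact Finset.mem_filter.2 ⟨Finset.mem_univ _, (hX.1 j hj).le⟩

/-- The inequalities in the event are strict, so the median value is attained at `i` only; the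
index, and then the set of smaller entries, are determined by `X`. Hence the events are disjoint. -/
lemma eq_of_mem_splitEvent {i i' : Fin (N + 1)} {S S' : Finset (Fin N)}
    (hS : S.card = (N + 1) / 2 - 1) (hS' : S'.card = (N + 1) / 2 - 1) {X : Fin (N + 1) → ℝ}
    (hX : X ∈ splitEvent i S) (hX' : X ∈ splitEvent i' S') : i = i' ∧ S = S' := by
  have h : X i = X i' := by
    rw [← leftMedian_eq_of_mem_splitEvent hS hX, leftMedian_eq_of_mem_splitEvent hS' hX']
  have hi : i = i' := by
    by_contra hne
    obtain ⟨j, hj⟩ := Fin.exists_succAbove_eq (Ne.symm hne)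
    rw [← hj] at h
    by_cases hjS : j ∈ S
    · exact (hX.1 j hjS).ne h.symm
    · exact (hX.2 j hjS).ne h
  subst hi
  refine ⟨rfl, ?_⟩
  ext j
  constructor
  · intro hj
    by_contra hc
    exact lt_asymm (hX.1 j hj) (hX'.2 j hc)
  · intro hj
    by_contra hc
    exact lt_asymm (hX'.1 j hj) (hX.2 j hc)

lemma exists_mem_splitEvent {X : Fin (N + 1) → ℝ}
    (hX : ∀ (i : Fin (N + 1)) (j : Fin N), X i = leftMedian X → X (i.succAbove j) ≠ X i) :
    ∃ i, ∃ S : Finset (Fin N), S.card = (N + 1) / 2 - 1 ∧ X ∈ splitEvent i S := by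
  classical
  obtain ⟨i, hi⟩ := exists_eq_leftMedian (Nat.succ_pos N) X
  refine ⟨i, Finset.univ.filter fun j => X (i.succAbove j) < X i, ?_, fun j hj => ?_,
    fun j hj => ?_⟩
  · have h1 := count_lt_leftMedian (Nat.succ_pos N) X
    have h2 := (leftMedian_le_iff (Nat.succ_pos N) X _).1 le_rfl
    rw [← hi, count_eq_add X i] at h1 h2
    rw [if_neg (lt_irrefl _)] at h1
    rw [if_pos le_rfl] at h2
    have h3 : (Finset.univ.filter fun j => X (i.succAbove j) ≤ X i) =
        Finset.univ.filter fun j => X (i.succAbove j) < X i := by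
      refine Finset.filter_congr fun j _ => ?_
      exact ⟨fun h => lt_of_le_of_ne h (hX i j hi), le_of_lt⟩
    rw [h3] at h2
    omega
  · exact (Finset.mem_filter.1 hj).2
  · have : ¬ X (i.succAbove j) < X i := fun h => hj (Finset.mem_filter.2 ⟨Finset.mem_univ _, h⟩)
    exact lt_of_le_of_ne (not_lt.1 this) (hX i j hi).symm

lemma measurableSet_splitEvent (i : Fin (N + 1)) (S : Finset (Fin N)) :
    MeasurableSet (splitEvent i S) := by
  have : splitEvent i S =
      (⋂ j, ⋂ (_ : j ∈ S), {X : Fin (N + 1) → ℝ | X (i.succAbove j) < X i}) ∩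
        ⋂ j, ⋂ (_ : j ∉ S), {X : Fin (N + 1) → ℝ | X i < X (i.succAbove j)} := by
    ext X
    simp [splitEvent]
  rw [this]
  exact (MeasurableSet.iInter fun j => MeasurableSet.iInter fun _ =>
      measurableSet_lt (measurable_pi_apply (i.succAbove j)) (measurable_pi_apply i)).inter
    (MeasurableSet.iInter fun j => MeasurableSet.iInter fun _ =>
      measurableSet_lt (measurable_pi_apply i) (measurable_pi_apply (i.succAbove j)))

/-- The weight `a` on `(-∞, t)` for indices in `S`, and the weight `b` on `(t, ∞)` for others. -/
noncomputable def splitWeight (a b : ℝ → ℝ → ENNReal) (S : Finset (Fin N)) (j : Fin N)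
    (t y : ℝ) : ENNReal :=
  open Classical in if j ∈ S then (Iio t).indicator (a t) y else (Ioi t).indicator (b t) y

lemma measurable_splitWeight {a b : ℝ → ℝ → ENNReal} (ha : Measurable (Function.uncurry a))
    (hb : Measurable (Function.uncurry b)) (S : Finset (Fin N)) (j : Fin N) :
    Measurable (Function.uncurry (splitWeight a b S j)) := by
  by_cases hj : j ∈ S
  · have : Function.uncurry (splitWeight a b S j) =
        {z : ℝ × ℝ | z.2 < z.1}.indicator (Function.uncurry a) := by
      funext ⟨t, y⟩
      simp [splitWeight, hj, Function.uncurry, indicator]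
    rw [this]
    exact ha.indicator (measurableSet_lt measurable_snd measurable_fst)
  · have : Function.uncurry (splitWeight a b S j) =
        {z : ℝ × ℝ | z.1 < z.2}.indicator (Function.uncurry b) := by
      funext ⟨t, y⟩
      simp [splitWeight, hj, Function.uncurry, indicator]
    rw [this]
    exact hb.indicator (measurableSet_lt measurable_fst measurable_snd)

lemma prod_lintegral_splitWeight (a b : ℝ → ℝ → ENNReal) (S : Finset (Fin N)) (t : ℝ) :
    ∏ j, ∫⁻ y, splitWeight a b S j t y ∂D =
      (∫⁻ y in Iio t, a t y ∂D) ^ S.card * (∫⁻ y in Ioi t, b t y ∂D) ^ (N - S.card) := by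
  classical
  have h : ∀ j, ∫⁻ y, splitWeight a b S j t y ∂D =
      if j ∈ S then ∫⁻ y in Iio t, a t y ∂D else ∫⁻ y in Ioi t, b t y ∂D := by
    intro j
    by_cases hj : j ∈ S
    · simp only [splitWeight, hj, if_true]
      exact lintegral_indicator measurableSet_Iio _
    · simp only [splitWeight, hj, if_false]
      exact lintegral_indicator measurableSet_Ioi _
  simp_rw [h]
  rw [Finset.prod_ite, Finset.prod_const, Finset.prod_const, Finset.filter_not, Finset.filter_mem_eq_inter,
    Finset.univ_inter, ← Finset.compl_eq_univ_sdiff, Finset.card_compl, Fintype.card_fin]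

/-- Fix the value t of coordinate `i`: the others are independent, and each falls on its prescribed
side of t. -/
lemma measure_splitEvent [IsProbabilityMeasure D] (i : Fin (N + 1)) (S : Finset (Fin N)) {W : Set ℝ}
    (hW : MeasurableSet W) :
    (Measure.pi fun _ : Fin (N + 1) => D) (splitEvent i S ∩ {X | X i ∈ W}) =
      ∫⁻ t in W, D (Iio t) ^ S.card * D (Ioi t) ^ (N - S.card) ∂D := by
  classical
  have hm : MeasurableSet (splitEvent i S ∩ {X : Fin (N + 1) → ℝ | X i ∈ W}) :=
    (measurableSet_splitEvent i S).inter (measurable_pi_apply i hW)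
  have h1 := lintegral_pi_split D i hW
    (measurable_splitWeight (a := fun _ _ => 1) (b := fun _ _ => 1) measurable_const
      measurable_const S)
  simp_rw [prod_lintegral_splitWeight] at h1
  simp only [lintegral_const, Measure.restrict_apply MeasurableSet.univ, univ_inter, one_mul] at h1
  rw [← h1, ← lintegral_indicator_one hm]
  refine lintegral_congr fun X => ?_
  by_cases hX : X ∈ splitEvent i S ∩ {X : Fin (N + 1) → ℝ | X i ∈ W}
  · rw [indicator_of_mem hX, indicator_of_mem (show X i ∈ W from hX.2)]
    simp only [Pi.one_apply, one_mul]
    symm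
    refine Finset.prod_eq_one fun j _ => ?_
    by_cases hj : j ∈ S
    · simp only [splitWeight, hj, if_true]
      exact indicator_of_mem (show _ ∈ Iio (X i) from hX.1.1 j hj) _
    · simp only [splitWeight, hj, if_false]
      exact indicator_of_mem (show _ ∈ Ioi (X i) from hX.1.2 j hj) _
  · rw [indicator_of_notMem hX]
    by_cases hi : X i ∈ W
    · have hX' : X ∉ splitEvent i S := fun h => hX ⟨h, hi⟩
      symm
      rw [mul_eq_zero]
      right
      by_contra hne
      apply hX'
      rw [← ne_eq, Finset.prod_ne_zero_iff] at hne
      constructor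
      · intro j hj
        have := hne j (Finset.mem_univ j)
        simp only [splitWeight, hj, if_true] at this
        exact mem_of_indicator_ne_zero (s := Iio (X i)) this
      · intro j hj
        have := hne j (Finset.mem_univ j)
        simp only [splitWeight, hj, if_false] at this
        exact mem_of_indicator_ne_zero (s := Ioi (X i)) this
    · rw [indicator_of_notMem hi, zero_mul]

lemma sum_measure_splitEvent_le {W : Set ℝ} (hW : MeasurableSet W) :
    ∑ i : Fin (N + 1), ∑ S ∈ (Finset.univ : Finset (Fin N)).powersetCard ((N + 1) / 2 - 1),
      (Measure.pi fun _ : Fin (N + 1) => D) (splitEvent i S ∩ {X | X i ∈ W}) ≤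
    (Measure.pi fun _ : Fin (N + 1) => D) {X | leftMedian X ∈ W} := by
  rw [← Finset.sum_product', ← measure_biUnion_finset]
  · refine measure_mono ?_
    simp only [Finset.mem_product, Finset.mem_univ, Finset.mem_powersetCard, true_and,
      iUnion_subset_iff]
    rintro ⟨i, S⟩ hS X hX
    simp only at hS hX
    have := leftMedian_eq_of_mem_splitEvent hS.2 hX.1
    change leftMedian X ∈ W
    rw [this]
    exact hX.2
  · rintro ⟨i, S⟩ h ⟨i', S'⟩ h' hne
    refine Set.disjoint_left.2 fun X hX hX' => hne ?_
    simp only [Finset.coe_product, mem_prod, Finset.mem_coe, Finset.mem_powersetCard] at h h'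
    have := eq_of_mem_splitEvent h.2.2 h'.2.2 hX.1 hX'.1
    exact Prod.ext this.1 this.2
  · rintro ⟨i, S⟩ -
    exact (measurableSet_splitEvent i S).inter (measurable_pi_apply i hW)

/-- By Fubini, a second entry hits a given value in `W` with probability zero. Off this null set the
split events cover all inputs with median in `W`. -/
lemma measure_ties_eq_zero [IsProbabilityMeasure D] {W : Set ℝ} (hW : MeasurableSet W) (hD : ∀ t ∈ W, D {t} = 0) :
    (Measure.pi fun _ : Fin (N + 1) => D)
      {X | ∃ (i : Fin (N + 1)) (j : Fin N), X i ∈ W ∧ X (i.succAbove j) = X i} = 0 := by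
  classical
  have : {X : Fin (N + 1) → ℝ | ∃ (i : Fin (N + 1)) (j : Fin N), X i ∈ W ∧
      X (i.succAbove j) = X i} = ⋃ i, ⋃ j, {X | X i ∈ W ∧ X (i.succAbove j) = X i} := by
    ext X; simp
  rw [this]
  refine measure_iUnion_null fun i => measure_iUnion_null fun j => ?_
  have hm : MeasurableSet {X : Fin (N + 1) → ℝ | X i ∈ W ∧ X (i.succAbove j) = X i} :=
    (measurable_pi_apply i hW).inter
      (measurableSet_eq_fun (measurable_pi_apply _) (measurable_pi_apply _))
  let h : Fin N → ℝ → ℝ → ENNReal := fun j' t y => if j' = j then ({t} : Set ℝ).indicator 1 y else 1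
  have hh : ∀ j', Measurable (Function.uncurry (h j')) := by
    intro j'
    by_cases hj : j' = j
    · have : Function.uncurry (h j') = {z : ℝ × ℝ | z.2 = z.1}.indicator 1 := by
        funext ⟨t, y⟩
        simp [h, hj, Function.uncurry, indicator]
      rw [this]
      exact measurable_one.indicator (measurableSet_eq_fun measurable_snd measurable_fst)
    · have : Function.uncurry (h j') = 1 := by
        funext ⟨t, y⟩
        simp [h, hj, Function.uncurry]
      rw [this]
      exact measurable_one
  have h1 := lintegral_pi_split D i hW hh
  have h2 : ∫⁻ t in W, ∏ j', ∫⁻ y, h j' t y ∂D ∂D = 0 := by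
    rw [setLIntegral_congr_fun (g := fun _ => 0) hW, lintegral_zero]
    intro t ht
    refine Finset.prod_eq_zero (Finset.mem_univ j) ?_
    simp only [h, if_true]
    rw [lintegral_indicator_one (measurableSet_singleton t)]
    exact hD t ht
  rw [← lintegral_indicator_one hm, ← nonpos_iff_eq_zero, ← h2, ← h1]
  refine lintegral_mono fun X => ?_
  by_cases hX : X ∈ {X : Fin (N + 1) → ℝ | X i ∈ W ∧ X (i.succAbove j) = X i}
  · rw [indicator_of_mem hX, indicator_of_mem hX.1]
    simp only [Pi.one_apply, one_mul]
    refine le_of_eq ?_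
    symm
    refine Finset.prod_eq_one fun j' _ => ?_
    by_cases hj : j' = j
    · subst hj
      simp [h, hX.2]
    · simp [h, hj]
  · rw [indicator_of_notMem hX]
    exact zero_le

/-- Conditionally on the median, the entries on its two sides are independent. -/
lemma measure_inter_leftMedian_mem_le [IsProbabilityMeasure D] {W : Set ℝ} (hW : MeasurableSet W)
    (hD : ∀ t ∈ W, D {t} = 0) {a b : ℝ → ℝ → ENNReal} (ha : Measurable (Function.uncurry a))
    (hb : Measurable (Function.uncurry b)) {α β c : ENNReal}
    (hα : ∀ t ∈ W, ∫⁻ y in Iio t, a t y ∂D ≤ α * D (Iio t))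
    (hβ : ∀ t ∈ W, ∫⁻ y in Ioi t, b t y ∂D ≤ β * D (Ioi t))
    (B : Set (Fin (N + 1) → ℝ))
    (hB : ∀ (i : Fin (N + 1)) (S : Finset (Fin N)) (X : Fin (N + 1) → ℝ),
      S.card = (N + 1) / 2 - 1 → X ∈ splitEvent i S → X i ∈ W → X ∈ B →
        1 ≤ c * ∏ j, splitWeight a b S j (X i) (X (i.succAbove j))) :
    (Measure.pi fun _ : Fin (N + 1) => D) (B ∩ {X | leftMedian X ∈ W}) ≤
      c * (α ^ ((N + 1) / 2 - 1) * β ^ (N - ((N + 1) / 2 - 1))) *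
        (Measure.pi fun _ : Fin (N + 1) => D) {X | leftMedian X ∈ W} := by
  set q := (N + 1) / 2 - 1 with hq
  set μ := Measure.pi fun _ : Fin (N + 1) => D with hμ
  set T := {X : Fin (N + 1) → ℝ | ∃ (i : Fin (N + 1)) (j : Fin N), X i ∈ W ∧
    X (i.succAbove j) = X i}
  have hcover : B ∩ {X | leftMedian X ∈ W} ⊆ T ∪
      ⋃ i ∈ (Finset.univ : Finset (Fin (N + 1))),
        ⋃ S ∈ (Finset.univ : Finset (Fin N)).powersetCard q,
          (B ∩ (splitEvent i S ∩ {X | X i ∈ W})) := by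
    rintro X ⟨hXB, hXW⟩
    by_cases hT : X ∈ T
    · exact Or.inl hT
    · right
      obtain ⟨i, S, hS, hX⟩ := exists_mem_splitEvent (X := X) fun i j hi h =>
        hT ⟨i, j, hi ▸ hXW, h⟩
      have hmed := leftMedian_eq_of_mem_splitEvent hS hX
      simp only [Finset.mem_univ, iUnion_true, mem_iUnion]
      exact ⟨i, S, Finset.mem_powersetCard.2 ⟨Finset.subset_univ _, hS⟩, hXB, hX,
        show X i ∈ W from hmed ▸ hXW⟩
  have hterm : ∀ (i : Fin (N + 1)) (S : Finset (Fin N)), S.card = q →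
      μ (B ∩ (splitEvent i S ∩ {X | X i ∈ W})) ≤
        c * (α ^ q * β ^ (N - q)) * μ (splitEvent i S ∩ {X | X i ∈ W}) := by
    intro i S hS
    have hmeas : Measurable fun X : Fin (N + 1) → ℝ =>
        W.indicator 1 (X i) * ∏ j, splitWeight a b S j (X i) (X (i.succAbove j)) := by
      refine Measurable.mul ((measurable_one.indicator hW).comp (measurable_pi_apply i)) ?_
      refine Finset.measurable_prod _ fun j _ => ?_
      have hp : Measurable fun X : Fin (N + 1) → ℝ => (X i, X (i.succAbove j)) :=
        (measurable_pi_apply i).prodMk (measurable_pi_apply (i.succAbove j))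
      exact (measurable_splitWeight ha hb S j).comp hp
    -- Exponential Markov inequality: the tilted weight is at least 1 on `B`. Its integral
    -- factorizes over the coordinates, and the one-sided bounds reproduce the integrand of the
    -- split event, so the final estimate is relative to the probability of `W`.
    have hset : B ∩ (splitEvent i S ∩ {X | X i ∈ W}) ⊆ {X | 1 ≤ c * (W.indicator 1 (X i) *
        ∏ j, splitWeight a b S j (X i) (X (i.succAbove j)))} := by
      rintro X ⟨hXB, hXE, hXW⟩
      have := hB i S X hS hXE hXW hXB
      change 1 ≤ c * (W.indicator 1 (X i) * ∏ j, splitWeight a b S j (X i) (X (i.succAbove j)))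
      rw [indicator_of_mem (show X i ∈ W from hXW)]
      simpa using this
    calc μ (B ∩ (splitEvent i S ∩ {X | X i ∈ W}))
        ≤ ∫⁻ X, c * (W.indicator 1 (X i) *
            ∏ j, splitWeight a b S j (X i) (X (i.succAbove j))) ∂μ := by
          refine (measure_mono hset).trans ?_
          have := mul_meas_ge_le_lintegral (μ := μ) (hmeas.const_mul c) 1
          rwa [one_mul] at this
      _ = c * ∫⁻ t in W, ∏ j, ∫⁻ y, splitWeight a b S j t y ∂D ∂D := by
          rw [lintegral_const_mul _ hmeas, hμ,
            lintegral_pi_split D i hW (measurable_splitWeight ha hb S)]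
      _ ≤ c * ∫⁻ t in W, (α ^ q * β ^ (N - q)) *
            (D (Iio t) ^ S.card * D (Ioi t) ^ (N - S.card)) ∂D := by
          refine mul_le_mul_right (setLIntegral_mono' hW fun t ht => ?_) _
          rw [prod_lintegral_splitWeight, hS]
          calc _ ≤ (α * D (Iio t)) ^ q * (β * D (Ioi t)) ^ (N - q) :=
                mul_le_mul' (pow_le_pow_left' (hα t ht) _) (pow_le_pow_left' (hβ t ht) _)
            _ = _ := by rw [mul_pow, mul_pow]; ring
      _ = _ := by
          have h1 : Measurable fun t : ℝ => D (Iio t) :=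
            (Monotone.measurable fun s t hst => measure_mono (Iio_subset_Iio hst))
          have h2 : Measurable fun t : ℝ => D (Ioi t) :=
            (Antitone.measurable fun s t hst => measure_mono (Ioi_subset_Ioi hst))
          have h3 : Measurable fun t : ℝ => D (Iio t) ^ S.card * D (Ioi t) ^ (N - S.card) :=
            (h1.pow_const _).mul (h2.pow_const _)
          rw [lintegral_const_mul _ h3, ← measure_splitEvent D i S hW, ← mul_assoc c]
  calc μ (B ∩ {X | leftMedian X ∈ W})
      ≤ μ T + ∑ i : Fin (N + 1), ∑ S ∈ (Finset.univ : Finset (Fin N)).powersetCard q,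
          μ (B ∩ (splitEvent i S ∩ {X | X i ∈ W})) := by
        refine (measure_mono hcover).trans ((measure_union_le _ _).trans ?_)
        refine add_le_add_right ((measure_biUnion_finset_le _ _).trans ?_) _
        exact Finset.sum_le_sum fun i _ => measure_biUnion_finset_le _ _
    _ ≤ ∑ i : Fin (N + 1), ∑ S ∈ (Finset.univ : Finset (Fin N)).powersetCard q,
          c * (α ^ q * β ^ (N - q)) * μ (splitEvent i S ∩ {X | X i ∈ W}) := by
        rw [measure_ties_eq_zero D hW hD, zero_add]
        exact Finset.sum_le_sum fun i _ => Finset.sum_le_sum fun S hS =>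
          hterm i S (Finset.mem_powersetCard.1 hS).2
    _ = c * (α ^ q * β ^ (N - q)) * ∑ i : Fin (N + 1),
          ∑ S ∈ (Finset.univ : Finset (Fin N)).powersetCard q,
            μ (splitEvent i S ∩ {X | X i ∈ W}) := by
        simp_rw [Finset.mul_sum]
    _ ≤ _ := mul_le_mul_right (sum_measure_splitEvent_le D hW) _

/-- The probability that the median lies in `W`, in terms of the distribution function. -/
lemma le_measure_leftMedian_mem [IsProbabilityMeasure D] {W : Set ℝ} (hW : MeasurableSet W) :
    ((N + 1 : ℕ) : ENNReal) * (N.choose ((N + 1) / 2 - 1) : ENNReal) *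
        ∫⁻ t in W, D (Iio t) ^ ((N + 1) / 2 - 1) * D (Ioi t) ^ (N - ((N + 1) / 2 - 1)) ∂D ≤
      (Measure.pi fun _ : Fin (N + 1) => D) {X | leftMedian X ∈ W} := by
  refine le_trans (le_of_eq ?_) (sum_measure_splitEvent_le D hW)
  rw [Finset.sum_congr rfl fun i _ => Finset.sum_congr rfl fun S hS => by
    rw [measure_splitEvent D i S hW, (Finset.mem_powersetCard.1 hS).2]]
  rw [Finset.sum_const, Finset.sum_const, Finset.card_powersetCard, Finset.card_univ,
    Finset.card_univ, Fintype.card_fin, Fintype.card_fin]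
  simp only [nsmul_eq_mul]
  rw [mul_assoc]

end

end PrivateMedian

/-! ### Chernoff bounds conditional on the median. -/

namespace PrivateMedian

/-- Since e^s ≥ 1 + s + s²/2 and (1 - s + s²/2)(1 + s + s²/2) = 1 + s⁴/4 ≥ 1. -/
lemma exp_neg_le_quadratic {s : ℝ} (hs : 0 ≤ s) : Real.exp (-s) ≤ 1 - s + s ^ 2 / 2 := by
  have h := Real.quadratic_le_exp_of_nonneg hs
  have h1 : Real.exp (-s) * Real.exp s = 1 := by rw [← Real.exp_add]; simp
  have h2 := Real.exp_pos (-s)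
  have h3 : Real.exp (-s) * (1 + s + s ^ 2 / 2) ≤ 1 := by
    exact (mul_le_mul_of_nonneg_left h h2.le).trans_eq h1
  have h4 : 1 ≤ (1 - s + s ^ 2 / 2) * (1 + s + s ^ 2 / 2) := by nlinarith [sq_nonneg (s ^ 2)]
  have h5 : 0 < 1 + s + s ^ 2 / 2 := by positivity
  exact le_of_mul_le_mul_right (h3.trans h4) h5

/-- A set of points close to the median of `D`, near which `D` has density at least `L`. -/
structure IsMedianWindow (L r : ℝ) (D : Measure ℝ) (W : Set ℝ) : Prop where
  measurableSet : MeasurableSet W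
  singleton : ∀ t ∈ W, D {t} = 0
  measure_Iio_le : ∀ t ∈ W, D.real (Iio t) ≤ 9 / 16
  measure_Ioi_le : ∀ t ∈ W, D.real (Ioi t) ≤ 9 / 16
  le_measure_Ioc : ∀ t ∈ W, ∀ w, 0 ≤ w → w ≤ 7 * r / 8 → L * w ≤ D.real (Ioc t (t + w))
  le_measure_Ico : ∀ t ∈ W, ∀ w, 0 ≤ w → w ≤ 7 * r / 8 → L * w ≤ D.real (Ico (t - w) t)

section

variable {N : ℕ} {D : Measure ℝ} [IsProbabilityMeasure D] {L r : ℝ} {W : Set ℝ}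

/-- The exponential moment of the indicator of a subset `A` of `B`. -/
lemma lintegral_exp_neg_indicator_le {A B : Set ℝ} (hA : MeasurableSet A) (hAB : A ⊆ B)
    {s l : ℝ} (hs : 0 ≤ s) (hs1 : s ≤ 1) (hl : 0 ≤ l) (hlA : l ≤ D.real A)
    (hB : D.real B ≤ 9 / 16) :
    ∫⁻ y in B, (A.indicator (fun _ => ENNReal.ofReal (Real.exp (-s))) y +
        Aᶜ.indicator (fun _ => 1) y) ∂D ≤
      ENNReal.ofReal (Real.exp (-((s - s ^ 2 / 2) * (16 / 9) * l))) * D B := by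
  rw [lintegral_add_left (measurable_const.indicator hA), lintegral_indicator hA,
    lintegral_indicator hA.compl, setLIntegral_const, setLIntegral_const,
    Measure.restrict_apply hA, Measure.restrict_apply hA.compl, inter_eq_left.2 hAB, one_mul, inter_comm, ← sdiff_eq,
    ← ofReal_measureReal (s := A), ← ofReal_measureReal (s := B \ A), ← ofReal_measureReal (s := B),
    measureReal_sdiff hAB hA, ← ENNReal.ofReal_mul (Real.exp_pos _).le,
    ← ENNReal.ofReal_add (by positivity) (sub_nonneg.2 (measureReal_mono hAB)),
    ← ENNReal.ofReal_mul (Real.exp_pos _).le]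
  refine ENNReal.ofReal_le_ofReal ?_
  have h1 := exp_neg_le_quadratic hs
  have h2 := Real.add_one_le_exp (-((s - s ^ 2 / 2) * (16 / 9) * l))
  have hκ : 0 ≤ s - s ^ 2 / 2 := by nlinarith
  set κ := s - s ^ 2 / 2 with hκdef
  have hP : 0 ≤ D.real B := measureReal_nonneg
  have hp : 0 ≤ D.real A := measureReal_nonneg
  have h3 : D.real B * (1 - κ * (16 / 9) * l) ≤
      D.real B * Real.exp (-(κ * (16 / 9) * l)) := mul_le_mul_of_nonneg_left (by linarith) hP
  have h4 : Real.exp (-s) * D.real A ≤ (1 - κ) * D.real A :=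
    mul_le_mul_of_nonneg_right (by rw [hκdef]; linarith) hp
  have h5 : κ * l ≤ κ * D.real A := mul_le_mul_of_nonneg_left hlA hκ
  have h6 : D.real B * (κ * l) ≤ 9 / 16 * (κ * l) :=
    mul_le_mul_of_nonneg_right hB (mul_nonneg hκ hl)
  nlinarith

lemma one_le_exp_mul_pow {s a : ℝ} {K : ℕ} (hs : 0 ≤ s) (hK : (K : ℝ) ≤ a) :
    1 ≤ ENNReal.ofReal (Real.exp (s * a)) * ENNReal.ofReal (Real.exp (-s)) ^ K := by
  rw [← ENNReal.ofReal_pow (Real.exp_pos _).le, ← ENNReal.ofReal_mul (Real.exp_pos _).le,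
    ← Real.exp_nat_mul, ← Real.exp_add]
  refine ENNReal.one_le_ofReal.2 (Real.one_le_exp ?_)
  have := mul_le_mul_of_nonneg_left hK hs
  linarith

lemma ofReal_exp_mul_pow (x y : ℝ) (M : ℕ) :
    ENNReal.ofReal (Real.exp x) * ENNReal.ofReal (Real.exp (-y)) ^ M =
      ENNReal.ofReal (Real.exp (x - y * M)) := by
  rw [← ENNReal.ofReal_pow (Real.exp_pos _).le, ← ENNReal.ofReal_mul (Real.exp_pos _).le,
    ← Real.exp_nat_mul, ← Real.exp_add]
  ring_nf

/-- Given that the median lies in the window, it is unlikely that few entries are just above it. -/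
lemma IsMedianWindow.measure_count_right_lt_le (hW : IsMedianWindow L r D W) (hL : 0 < L)
    {s w a : ℝ} (hs : 0 ≤ s) (hs1 : s ≤ 1) (hw : 0 ≤ w) (hwr : w ≤ 7 * r / 8) :
    (Measure.pi fun _ : Fin (N + 1) => D)
      ({X | (count X (· ≤ leftMedian X + w) : ℝ) < (((N + 1) / 2 - 1 + 1 : ℕ) : ℝ) + a} ∩
        {X | leftMedian X ∈ W}) ≤
      ENNReal.ofReal (Real.exp (s * a - (s - s ^ 2 / 2) * (16 / 9) * (L * w) *
        (N - ((N + 1) / 2 - 1) : ℕ))) *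
        (Measure.pi fun _ : Fin (N + 1) => D) {X | leftMedian X ∈ W} := by
  classical
  let b : ℝ → ℝ → ENNReal := fun t y =>
    (Ioc t (t + w)).indicator (fun _ => ENNReal.ofReal (Real.exp (-s))) y +
      (Ioc t (t + w))ᶜ.indicator (fun _ => 1) y
  have hbm : Measurable (Function.uncurry b) := by
    have hS : MeasurableSet {z : ℝ × ℝ | z.1 < z.2 ∧ z.2 ≤ z.1 + w} :=
      (measurableSet_lt measurable_fst measurable_snd).inter
        (measurableSet_le measurable_snd (measurable_fst.add_const w))
    exact (measurable_const.indicator hS (f := fun _ => ENNReal.ofReal (Real.exp (-s)))).add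
      (measurable_const.indicator hS.compl (f := fun _ => (1 : ENNReal)))
  have h := measure_inter_leftMedian_mem_le (N := N) D hW.measurableSet hW.singleton
    (a := fun _ _ => 1) (b := b) measurable_const hbm (α := 1)
    (β := ENNReal.ofReal (Real.exp (-((s - s ^ 2 / 2) * (16 / 9) * (L * w)))))
    (c := ENNReal.ofReal (Real.exp (s * a)))
    (fun t ht => by simp)
    (fun t ht => lintegral_exp_neg_indicator_le measurableSet_Ioc Ioc_subset_Ioi_self hs hs1
      (by positivity) (hW.le_measure_Ioc t ht w hw hwr) (hW.measure_Ioi_le t ht))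
    {X | (count X (· ≤ leftMedian X + w) : ℝ) < (((N + 1) / 2 - 1 + 1 : ℕ) : ℝ) + a}
    (fun i S X hS hX _ hXB => by
      have hm := leftMedian_eq_of_mem_splitEvent hS hX
      have hXB' : (count X (· ≤ leftMedian X + w) : ℝ) < (((N + 1) / 2 - 1 + 1 : ℕ) : ℝ) + a := hXB
      rw [hm] at hXB'
      -- These are the entries in (t, t + w], each carrying weight e^{-s}. With `S` and the median
      -- they exhaust the guaranteed count, so on the bad event there are at most `a` of them and
      -- the factor e^{sa} compensates.
      set T := Finset.univ.filter fun j => j ∉ S ∧ X (i.succAbove j) ≤ X i + w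
      have hprod : ∏ j, splitWeight (fun _ _ => 1) b S j (X i) (X (i.succAbove j)) =
          ENNReal.ofReal (Real.exp (-s)) ^ T.card := by
        rw [← Finset.prod_const, Finset.prod_filter]
        refine Finset.prod_congr rfl fun j _ => ?_
        by_cases hj : j ∈ S
        · simp [splitWeight, hj, hX.1 j hj]
        · by_cases hjw : X (i.succAbove j) ≤ X i + w <;>
            simp [splitWeight, hj, hX.2 j hj, hjw, b]
      rw [hprod]
      refine one_le_exp_mul_pow hs ?_
      have hcount : (N + 1) / 2 - 1 + 1 + T.card ≤ count X (· ≤ X i + w) := by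
        rw [count_eq_add X i, if_pos (by linarith), ← hS, add_comm S.card 1, add_assoc,
          ← Finset.card_union_of_disjoint]
        · refine Nat.add_le_add_left (Finset.card_le_card fun j hj => ?_) 1
          rw [Finset.mem_filter]
          refine ⟨Finset.mem_univ _, ?_⟩
          rcases Finset.mem_union.1 hj with hj | hj
          · linarith [hX.1 j hj]
          · exact (Finset.mem_filter.1 hj).2.2
        · rw [Finset.disjoint_left]
          intro j hj hj'
          exact (Finset.mem_filter.1 hj').2.1 hj
      have hcount' : (((N + 1) / 2 - 1 + 1 : ℕ) : ℝ) + T.card ≤ count X (· ≤ X i + w) := by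
        exact_mod_cast hcount
      linarith)
  rwa [one_pow, one_mul, ofReal_exp_mul_pow] at h

/-- Given that the median lies in the window, it is unlikely that few entries are just below it. -/
lemma IsMedianWindow.measure_count_left_lt_le (hW : IsMedianWindow L r D W) (hL : 0 < L)
    {s w a : ℝ} (hs : 0 ≤ s) (hs1 : s ≤ 1) (hw : 0 ≤ w) (hwr : w ≤ 7 * r / 8) :
    (Measure.pi fun _ : Fin (N + 1) => D)
      ({X | (count X (leftMedian X - w ≤ ·) : ℝ) < ((N + 1 - ((N + 1) / 2 - 1) : ℕ) : ℝ) + a} ∩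
        {X | leftMedian X ∈ W}) ≤
      ENNReal.ofReal (Real.exp (s * a - (s - s ^ 2 / 2) * (16 / 9) * (L * w) *
        ((N + 1) / 2 - 1 : ℕ))) *
        (Measure.pi fun _ : Fin (N + 1) => D) {X | leftMedian X ∈ W} := by
  classical
  let b : ℝ → ℝ → ENNReal := fun t y =>
    (Ico (t - w) t).indicator (fun _ => ENNReal.ofReal (Real.exp (-s))) y +
      (Ico (t - w) t)ᶜ.indicator (fun _ => 1) y
  have hbm : Measurable (Function.uncurry b) := by
    have hS : MeasurableSet {z : ℝ × ℝ | z.1 - w ≤ z.2 ∧ z.2 < z.1} :=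
      (measurableSet_le (measurable_fst.sub_const w) measurable_snd).inter
        (measurableSet_lt measurable_snd measurable_fst)
    exact (measurable_const.indicator hS (f := fun _ => ENNReal.ofReal (Real.exp (-s)))).add
      (measurable_const.indicator hS.compl (f := fun _ => (1 : ENNReal)))
  have h := measure_inter_leftMedian_mem_le (N := N) D hW.measurableSet hW.singleton
    (a := b) (b := fun _ _ => 1) hbm measurable_const (β := 1)
    (α := ENNReal.ofReal (Real.exp (-((s - s ^ 2 / 2) * (16 / 9) * (L * w)))))
    (c := ENNReal.ofReal (Real.exp (s * a)))
    (fun t ht => lintegral_exp_neg_indicator_le measurableSet_Ico Ico_subset_Iio_self hs hs1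
      (by positivity) (hW.le_measure_Ico t ht w hw hwr) (hW.measure_Iio_le t ht))
    (fun t ht => by simp)
    {X | (count X (leftMedian X - w ≤ ·) : ℝ) < ((N + 1 - ((N + 1) / 2 - 1) : ℕ) : ℝ) + a}
    (fun i S X hS hX _ hXB => by
      have hm := leftMedian_eq_of_mem_splitEvent hS hX
      have hXB' : (count X (leftMedian X - w ≤ ·) : ℝ) <
        ((N + 1 - ((N + 1) / 2 - 1) : ℕ) : ℝ) + a := hXB
      rw [hm] at hXB'
      set T := Finset.univ.filter fun j => j ∈ S ∧ X i - w ≤ X (i.succAbove j)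
      have hprod : ∏ j, splitWeight b (fun _ _ => 1) S j (X i) (X (i.succAbove j)) =
          ENNReal.ofReal (Real.exp (-s)) ^ T.card := by
        rw [← Finset.prod_const, Finset.prod_filter]
        refine Finset.prod_congr rfl fun j _ => ?_
        by_cases hj : j ∈ S
        · by_cases hjw : X i - w ≤ X (i.succAbove j)
          · have hjw' := hjw
            rw [tsub_le_iff_right] at hjw'
            simp [splitWeight, hj, hX.1 j hj, hjw', b]
          · have hjw' := hjw
            rw [tsub_le_iff_right] at hjw'
            simp [splitWeight, hj, hX.1 j hj, hjw', b]
        · simp [splitWeight, hj, hX.2 j hj]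
      rw [hprod]
      refine one_le_exp_mul_pow hs ?_
      have hcount : N + 1 - ((N + 1) / 2 - 1) + T.card ≤ count X (X i - w ≤ ·) := by
        have hSc : Sᶜ.card = N - ((N + 1) / 2 - 1) := by
          rw [Finset.card_compl, Fintype.card_fin, hS]
        have hSN : N + 1 - ((N + 1) / 2 - 1) = 1 + Sᶜ.card := by omega
        rw [count_eq_add X i, if_pos (by linarith), hSN, add_assoc,
          ← Finset.card_union_of_disjoint]
        · refine Nat.add_le_add_left (Finset.card_le_card fun j hj => ?_) 1
          rw [Finset.mem_filter]
          refine ⟨Finset.mem_univ _, ?_⟩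
          rcases Finset.mem_union.1 hj with hj | hj
          · linarith [hX.2 j (Finset.mem_compl.1 hj)]
          · exact (Finset.mem_filter.1 hj).2.2
        · rw [Finset.disjoint_left]
          intro j hj hj'
          exact (Finset.mem_compl.1 hj) (Finset.mem_filter.1 hj').2.1
      have hcount' : ((N + 1 - ((N + 1) / 2 - 1) : ℕ) : ℝ) + T.card ≤
          count X (X i - w ≤ ·) := by
        exact_mod_cast hcount
      linarith)
  rwa [one_pow, mul_one, ofReal_exp_mul_pow] at h

end

end PrivateMedian

namespace PrivateMedian

section

variable {N : ℕ} {D : Measure ℝ} [IsProbabilityMeasure D] {C L r : ℝ} {W : Set ℝ}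

lemma sum_exp_neg_seven_mul_le (k K : ℕ) :
    ∑ κ ∈ Finset.Ioc k K, Real.exp (-(7 * κ)) ≤ 1 / 16 * Real.exp (-(k : ℝ)) := by
  have hx0 : 0 < Real.exp (-7) := Real.exp_pos _
  have hx : Real.exp (-7) ≤ 1 / 32 := by
    have h := Real.quadratic_le_exp_of_nonneg (x := 7) (by norm_num)
    rw [Real.exp_neg, inv_eq_one_div]
    exact one_div_le_one_div_of_le (by norm_num) (by linarith)
  have h1 : ∀ κ : ℕ, Real.exp (-(7 * κ)) = Real.exp (-7) ^ κ := by
    intro κ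
    rw [← Real.exp_nat_mul]
    ring_nf
  have h2 : Finset.Ioc k K = Finset.Ico (k + 1) (K + 1) := by
    ext x; simp only [Finset.mem_Ioc, Finset.mem_Ico]; omega
  simp_rw [h1]
  rw [h2]
  refine (geom_sum_Ico_le_of_lt_one hx0.le (by linarith)).trans ?_
  rw [div_le_iff₀ (by linarith), pow_succ]
  have h3 : Real.exp (-7) ^ k ≤ Real.exp (-(k : ℝ)) := by
    rw [← Real.exp_nat_mul]
    refine Real.exp_le_exp.2 ?_
    have : (0 : ℝ) ≤ k := Nat.cast_nonneg k
    linarith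
  have h4 : 0 < Real.exp (-(k : ℝ)) := Real.exp_pos _
  have h5 : Real.exp (-7) ^ k * Real.exp (-7) ≤ Real.exp (-(k : ℝ)) * (1 / 32) :=
    mul_le_mul h3 hx hx0.le h4.le
  nlinarith

/-- Given that the median lies in the window, it is unlikely that the input is not well spread. -/
lemma IsMedianWindow.measure_not_wellSpread_le (hW : IsMedianWindow L r D W) (hC : 64 ≤ C)
    (hL : 0 < L) (hr : 0 < r) (hN : 150 ≤ N + 1) (k : ℕ) :
    (Measure.pi fun _ : Fin (N + 1) => D)
      ({X | ¬ WellSpread C L r k X} ∩ {X | leftMedian X ∈ W}) ≤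
      ENNReal.ofReal (1 / 8 * Real.exp (-(k : ℝ)) +
        2 * Real.exp (-(L * ((N + 1 : ℕ) : ℝ) * r / 30))) *
        (Measure.pi fun _ : Fin (N + 1) => D) {X | leftMedian X ∈ W} := by
  set μ := Measure.pi fun _ : Fin (N + 1) => D
  set M := {X : Fin (N + 1) → ℝ | leftMedian X ∈ W}
  have hC0 : 0 < C := by linarith
  set n : ℝ := ((N + 1 : ℕ) : ℝ) with hn
  have hn0 : 150 ≤ n := by rw [hn]; exact_mod_cast hN
  -- Each side of the median has at least (n - 3)/2 entries, which is at least 0.49 n exactly when n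
  -- ≥ 150.
  have hq1 : (49 / 100 : ℝ) * n ≤ (((N + 1) / 2 - 1 : ℕ) : ℝ) := by
    have h1 : N + 1 ≤ 2 * ((N + 1) / 2 - 1) + 3 := by omega
    have h2 : n ≤ 2 * (((N + 1) / 2 - 1 : ℕ) : ℝ) + 3 := by rw [hn]; exact_mod_cast h1
    linarith
  have hq2 : (49 / 100 : ℝ) * n ≤ ((N - ((N + 1) / 2 - 1) : ℕ) : ℝ) := by
    refine hq1.trans ?_
    have : (N + 1) / 2 - 1 ≤ N - ((N + 1) / 2 - 1) := by omega
    exact_mod_cast this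
  let A : ℝ → ℝ → Set (Fin (N + 1) → ℝ) := fun w a =>
    {X | (count X (· ≤ leftMedian X + w) : ℝ) < (((N + 1) / 2 - 1 + 1 : ℕ) : ℝ) + a}
  let B : ℝ → ℝ → Set (Fin (N + 1) → ℝ) := fun w a =>
    {X | (count X (leftMedian X - w ≤ ·) : ℝ) < ((N + 1 - ((N + 1) / 2 - 1) : ℕ) : ℝ) + a}
  set K := ⌊L * n * r / (2 * C)⌋₊
  have hcover : {X | ¬ WellSpread C L r k X} ∩ M ⊆
      (⋃ κ ∈ Finset.Ioc k K, ((A (κ * C / (L * n)) κ ∩ M) ∪ (B (κ * C / (L * n)) κ ∩ M))) ∪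
        ((A (7 * r / 8) (L * n * r / 2) ∩ M) ∪ (B (7 * r / 8) (L * n * r / 2) ∩ M)) := by
    rintro X ⟨hX, hXM⟩
    by_contra hc
    simp only [mem_union, mem_iUnion, mem_inter_iff, Finset.mem_Ioc, not_or, not_exists,
      not_and] at hc
    apply hX
    have hnn : 0 ≤ L * n * r / (2 * C) := by positivity
    refine ⟨fun κ h1 h2 => ?_, fun κ h1 h2 => ?_, ?_, ?_⟩
    · have := (hc.1 κ ⟨h1, Nat.le_floor h2⟩).1
      by_contra hlt
      refine this ?_ hXM
      rw [not_le] at hlt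
      change (count X (· ≤ leftMedian X + κ * C / (L * n)) : ℝ) <
        (((N + 1) / 2 - 1 + 1 : ℕ) : ℝ) + κ
      exact_mod_cast hlt
    · have := (hc.1 κ ⟨h1, Nat.le_floor h2⟩).2
      by_contra hlt
      refine this ?_ hXM
      rw [not_le] at hlt
      change (count X (leftMedian X - κ * C / (L * n) ≤ ·) : ℝ) <
        ((N + 1 - ((N + 1) / 2 - 1) : ℕ) : ℝ) + κ
      exact_mod_cast hlt
    · by_contra hlt
      exact hc.2.1 (not_le.1 hlt) hXM
    · by_contra hlt
      exact hc.2.2 (not_le.1 hlt) hXM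
  have hκ : ∀ κ ∈ Finset.Ioc k K,
      μ ((A (κ * C / (L * n)) κ ∩ M) ∪ (B (κ * C / (L * n)) κ ∩ M)) ≤
        ENNReal.ofReal (2 * Real.exp (-(7 * κ))) * μ M := by
    intro κ hκ
    have hκK : (κ : ℝ) ≤ L * n * r / (2 * C) :=
      (Nat.le_floor_iff (by positivity)).1 (Finset.mem_Ioc.1 hκ).2
    have hκ0 : (0 : ℝ) ≤ κ := Nat.cast_nonneg κ
    have hw : (κ : ℝ) * C / (L * n) ≤ 7 * r / 8 := by
      rw [le_div_iff₀ (by positivity)] at hκK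
      rw [div_le_iff₀ (by positivity)]
      have : 0 ≤ L * n * r := by positivity
      linarith only [this, hκK]
    -- The expected number of entries at scale κ is of order κC, so `C ≥ 64` leaves ample room over
    -- the required κ. The rate 7 makes the sum over κ > k a small multiple of e^{-k}.
    have hexp : ∀ m : ℝ, 49 / 100 * n ≤ m →
        1 * (κ : ℝ) - (1 - 1 ^ 2 / 2) * (16 / 9) * (L * (κ * C / (L * n))) * m ≤ -(7 * κ) := by
      intro m hm
      have h1 : L * (κ * C / (L * n)) * m = κ * C * (m / n) := by field_simp
      have h2 : 49 / 100 ≤ m / n := by rwa [le_div_iff₀ (by linarith)]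
      have h3 : 64 * (49 / 100) ≤ C * (m / n) := mul_le_mul hC h2 (by norm_num) hC0.le
      have h4 := mul_le_mul_of_nonneg_left h3 hκ0
      linarith
    have e1 := (hW.measure_count_right_lt_le (N := N) hL (s := 1) (a := κ) zero_le_one le_rfl
      (by positivity) hw)
    have e2 := (hW.measure_count_left_lt_le (N := N) hL (s := 1) (a := κ) zero_le_one le_rfl
      (by positivity) hw)
    refine (measure_union_le _ _).trans ?_
    rw [two_mul, ENNReal.ofReal_add (Real.exp_pos _).le (Real.exp_pos _).le, add_mul]
    refine add_le_add (e1.trans ?_) (e2.trans ?_)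
    · exact mul_le_mul_left (ENNReal.ofReal_le_ofReal (Real.exp_le_exp.2 (hexp _ hq2))) _
    · exact mul_le_mul_left (ENNReal.ofReal_le_ofReal (Real.exp_le_exp.2 (hexp _ hq1))) _
  have hfar : μ ((A (7 * r / 8) (L * n * r / 2) ∩ M) ∪ (B (7 * r / 8) (L * n * r / 2) ∩ M)) ≤
      ENNReal.ofReal (2 * Real.exp (-(L * n * r / 30))) * μ M := by
    -- Here the required count Lnr/2 is close to the guaranteed expectation, and tilting with s = 1
    -- would not suffice. With s = 1/2 the coefficient is 1/4 - (3/8)(16/9)(7/8)(49/100) < -1/30.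
    have hexp : ∀ m : ℝ, 49 / 100 * n ≤ m →
        1 / 2 * (L * n * r / 2) - (1 / 2 - (1 / 2) ^ 2 / 2) * (16 / 9) * (L * (7 * r / 8)) * m ≤
          -(L * n * r / 30) := by
      intro m hm
      have h1 : 0 < L * r := by positivity
      have h2 := mul_le_mul_of_nonneg_left hm h1.le
      have h3 : 0 < L * r * n := by positivity
      linarith only [h2, h3]
    have e1 := (hW.measure_count_right_lt_le (N := N) hL (s := 1 / 2) (a := L * n * r / 2)
      (w := 7 * r / 8) (by norm_num) (by norm_num) (by positivity) le_rfl)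
    have e2 := (hW.measure_count_left_lt_le (N := N) hL (s := 1 / 2) (a := L * n * r / 2)
      (w := 7 * r / 8) (by norm_num) (by norm_num) (by positivity) le_rfl)
    refine (measure_union_le _ _).trans ?_
    rw [two_mul, ENNReal.ofReal_add (Real.exp_pos _).le (Real.exp_pos _).le, add_mul]
    refine add_le_add (e1.trans ?_) (e2.trans ?_)
    · exact mul_le_mul_left (ENNReal.ofReal_le_ofReal (Real.exp_le_exp.2 (hexp _ hq2))) _
    · exact mul_le_mul_left (ENNReal.ofReal_le_ofReal (Real.exp_le_exp.2 (hexp _ hq1))) _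
  calc μ ({X | ¬ WellSpread C L r k X} ∩ M)
      ≤ ∑ κ ∈ Finset.Ioc k K, ENNReal.ofReal (2 * Real.exp (-(7 * κ))) * μ M +
          ENNReal.ofReal (2 * Real.exp (-(L * n * r / 30))) * μ M := by
        refine (measure_mono hcover).trans ((measure_union_le _ _).trans (add_le_add ?_ hfar))
        exact (measure_biUnion_finset_le _ _).trans (Finset.sum_le_sum hκ)
    _ = ENNReal.ofReal (∑ κ ∈ Finset.Ioc k K, 2 * Real.exp (-(7 * κ)) +
          2 * Real.exp (-(L * n * r / 30))) * μ M := by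
        rw [← Finset.sum_mul, ← add_mul, ENNReal.ofReal_add (by positivity) (by positivity),
          ENNReal.ofReal_sum_of_nonneg fun _ _ => by positivity]
    _ ≤ _ := by
        refine mul_le_mul_left (ENNReal.ofReal_le_ofReal (add_le_add_left ?_ _)) _
        rw [← Finset.mul_sum]
        have := sum_exp_neg_seven_mul_le k K
        linarith

end

end PrivateMedian

/-! ### Admissible distributions near their median. -/

namespace PrivateMedian

section Admissible

variable {D : Measure ℝ} {L R r m : ℝ}

lemma IsAdmissible.measure_singleton (h : IsAdmissible L R r D m) {t : ℝ}
    (ht : t ∈ Icc (m - r) (m + r)) : D {t} = 0 := by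
  obtain ⟨f, -, hf, -⟩ := h.density
  have h1 : D.restrict (Icc (m - r) (m + r)) {t} = 0 := by
    rw [hf]
    refine withDensity_absolutelyContinuous _ _ ?_
    exact Measure.restrict_le_self.absolutelyContinuous (MeasureTheory.measure_singleton t)
  rwa [Measure.restrict_apply (measurableSet_singleton t),
    inter_eq_left.2 (singleton_subset_iff.2 ht)] at h1

lemma IsAdmissible.le_measureReal [IsProbabilityMeasure D] (h : IsAdmissible L R r D m)
    (hL : 0 < L) {A : Set ℝ}
    (hA : MeasurableSet A) (hAI : A ⊆ Icc (m - r) (m + r)) :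
    L * (volume : Measure ℝ).real A ≤ D.real A := by
  obtain ⟨f, -, hf, hfL⟩ := h.density
  have h1 : D A = ∫⁻ u in A, f u := by
    have : D.restrict (Icc (m - r) (m + r)) A = D A := by
      rw [Measure.restrict_apply hA, inter_eq_left.2 hAI]
    rw [← this, hf, withDensity_apply _ hA, Measure.restrict_restrict hA, inter_eq_left.2 hAI]
  have h2 : ENNReal.ofReal L * volume A ≤ D A := by
    rw [h1, ← setLIntegral_const]
    exact setLIntegral_mono' hA fun u hu => hfL u (hAI hu)
  have h3 := ENNReal.toReal_mono (measure_ne_top D A) h2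
  rwa [ENNReal.toReal_mul, ENNReal.toReal_ofReal hL.le] at h3

lemma IsAdmissible.measureReal_Iic_median [IsProbabilityMeasure D] (h : IsAdmissible L R r D m) (hr : 0 < r) :
    D.real (Iic m) = 1 / 2 := by
  have h0 := h.measure_singleton (t := m) ⟨by linarith, by linarith⟩
  have hhalf : ((1 : ENNReal) / 2).toReal = 1 / 2 := by simp
  have h1 : 1 / 2 ≤ D.real (Iic m) := by
    rw [← hhalf]
    exact ENNReal.toReal_mono (measure_ne_top _ _) h.isMedian.1
  have h2 : 1 / 2 ≤ D.real (Ici m) := by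
    rw [← hhalf]
    exact ENNReal.toReal_mono (measure_ne_top _ _) h.isMedian.2
  have h3 : D.real (Ici m) = D.real (Ioi m) := by
    have : D (Ici m) = D (Ioi m) := by
      refine le_antisymm ?_ (measure_mono Ioi_subset_Ici_self)
      rw [← Ioi_union_left]
      refine (measure_union_le _ _).trans ?_
      rw [h0, add_zero]
    simp [measureReal_def, this]
  have h4 : D.real (Ioi m) = 1 - D.real (Iic m) := by
    rw [← compl_Iic, probReal_compl_eq_one_sub measurableSet_Iic]
  linarith

/-- The jump of the distribution function at a point is the mass of that point, which vanishes where
there is a density. -/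
lemma IsAdmissible.continuousOn_measureReal_Iic [IsProbabilityMeasure D] (h : IsAdmissible L R r D m) :
    ContinuousOn (fun t => D.real (Iic t)) (Icc (m - r) (m + r)) := by
  intro t ht
  refine ContinuousAt.continuousWithinAt ?_
  have h1 : (fun t => D.real (Iic t)) = ProbabilityTheory.cdf D := by
    funext t
    rw [ProbabilityTheory.cdf_eq_real]
  rw [h1]
  have h2 : (ProbabilityTheory.cdf D).measure {t} = 0 := by
    rw [ProbabilityTheory.measure_cdf]
    exact h.measure_singleton ht
  rw [StieltjesFunction.measure_singleton, ENNReal.ofReal_eq_zero, sub_nonpos] at h2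
  have hmono : Monotone (ProbabilityTheory.cdf D) := ProbabilityTheory.monotone_cdf D
  rw [hmono.continuousAt_iff_leftLim_eq_rightLim,
    ((ProbabilityTheory.cdf D).right_continuous t).rightLim_eq]
  exact le_antisymm (hmono.leftLim_le le_rfl) h2

/-- Points whose distribution function is close to `1 / 2` form a window around the median. -/
lemma IsAdmissible.exists_isMedianWindow [IsProbabilityMeasure D] (h : IsAdmissible L R r D m) (hL : 0 < L) (hr : 0 < r)
    (hLr : L * r ≤ 1 / 2) {v : ℝ} (hv : 0 ≤ v) (hvr : v ≤ L * r / 8) :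
    ∃ a b : ℝ, IsMedianWindow L r D (Icc a b) ∧ m - v / L ≤ a ∧ b ≤ m + v / L ∧
      D.real (Icc a b) = 2 * v ∧ D.real (Iio a) = 1 / 2 - v ∧ D.real (Ioi b) = 1 / 2 - v := by
  have hvL : v / L ≤ r / 8 := by
    rw [div_le_iff₀ hL]; linarith
  have hvL0 : 0 ≤ v / L := by positivity
  have hF := h.measureReal_Iic_median hr
  have hcont := h.continuousOn_measureReal_Iic
  have hLv : L * (v / L) = v := by field_simp
  have h1 : D.real (Iic (m - v / L)) ≤ 1 / 2 - v := by
    have e1 := h.le_measureReal hL (A := Ioc (m - v / L) m) measurableSet_Ioc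
      (fun x hx => ⟨by linarith [hx.1], by linarith [hx.2]⟩)
    rw [Real.volume_real_Ioc_of_le (by linarith), sub_sub_cancel, hLv] at e1
    have e2 : D.real (Iic m) = D.real (Iic (m - v / L)) + D.real (Ioc (m - v / L) m) := by
      rw [← measureReal_union _ measurableSet_Ioc, Iic_union_Ioc_eq_Iic (by linarith)]
      exact Iic_disjoint_Ioc le_rfl
    linarith
  have h2 : 1 / 2 + v ≤ D.real (Iic (m + v / L)) := by
    have e1 := h.le_measureReal hL (A := Ioc m (m + v / L)) measurableSet_Ioc
      (fun x hx => ⟨by linarith [hx.1], by linarith [hx.2]⟩)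
    rw [Real.volume_real_Ioc_of_le (by linarith), add_sub_cancel_left, hLv] at e1
    have e2 : D.real (Iic (m + v / L)) = D.real (Iic m) + D.real (Ioc m (m + v / L)) := by
      rw [← measureReal_union _ measurableSet_Ioc, Iic_union_Ioc_eq_Iic (by linarith)]
      exact Iic_disjoint_Ioc le_rfl
    linarith
  -- The endpoints are quantiles of levels 1/2 ± v, not m ± v/L: the masses are then exact although
  -- the density is only bounded below.
  obtain ⟨a, ha, haF⟩ := intermediate_value_Icc (by linarith : m - v / L ≤ m)
    (hcont.mono (Icc_subset_Icc (by linarith) (by linarith)))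
    (show 1 / 2 - v ∈ Icc (D.real (Iic (m - v / L))) (D.real (Iic m)) from ⟨h1, by linarith⟩)
  obtain ⟨b, hb, hbF⟩ := intermediate_value_Icc (by linarith : m ≤ m + v / L)
    (hcont.mono (Icc_subset_Icc (by linarith) (by linarith)))
    (show 1 / 2 + v ∈ Icc (D.real (Iic m)) (D.real (Iic (m + v / L))) from ⟨by linarith, h2⟩)
  simp only at haF hbF
  -- Distance r/8 from the median leaves room 7r/8 on both sides inside the interval of bounded
  -- density. Also v ≤ Lr/8 ≤ 1/16 gives the masses 9/16.
  have hwin : ∀ t ∈ Icc a b, m - r / 8 ≤ t ∧ t ≤ m + r / 8 := fun t ht =>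
    ⟨by linarith [ht.1, ha.1], by linarith [ht.2, hb.2]⟩
  have hIioa : D.real (Iio a) = 1 / 2 - v := by
    rw [← haF]
    have : D (Iic a) = D (Iio a) := by
      refine le_antisymm ?_ (measure_mono Iio_subset_Iic_self)
      rw [← Iio_union_right]
      refine (measure_union_le _ _).trans ?_
      rw [h.measure_singleton (t := a) ⟨by linarith [ha.1], by linarith [ha.2]⟩, add_zero]
    simp [measureReal_def, this]
  have hIoib : D.real (Ioi b) = 1 / 2 - v := by
    rw [← compl_Iic, probReal_compl_eq_one_sub measurableSet_Iic, hbF]; ring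
  have hab : a ≤ b := ha.2.trans hb.1
  refine ⟨a, b, ⟨measurableSet_Icc, fun t ht => ?_, fun t ht => ?_, fun t ht => ?_,
    fun t ht w hw hwr => ?_, fun t ht w hw hwr => ?_⟩, ha.1, hb.2, ?_, hIioa, hIoib⟩
  · exact h.measure_singleton ⟨by linarith [(hwin t ht).1], by linarith [(hwin t ht).2]⟩
  · have : D.real (Iio t) ≤ D.real (Iic b) := measureReal_mono fun x hx => (le_of_lt hx).trans ht.2
    linarith
  · have : D.real (Ioi t) ≤ D.real (Ioi a) := measureReal_mono (Ioi_subset_Ioi ht.1)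
    rw [← compl_Iic (a := a), probReal_compl_eq_one_sub measurableSet_Iic, haF] at this
    linarith
  · have := h.le_measureReal hL (A := Ioc t (t + w)) measurableSet_Ioc
      (fun x hx => ⟨by linarith [hx.1, (hwin t ht).1], by linarith [hx.2, (hwin t ht).2]⟩)
    rwa [Real.volume_real_Ioc_of_le (by linarith), add_sub_cancel_left] at this
  · have := h.le_measureReal hL (A := Ico (t - w) t) measurableSet_Ico
      (fun x hx => ⟨by linarith [hx.1, (hwin t ht).1], by linarith [hx.2, (hwin t ht).2]⟩)
    rwa [Real.volume_real_Ico_of_le (by linarith), sub_sub_cancel] at this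
  · have : D.real (Iic b) = D.real (Iio a) + D.real (Icc a b) := by
      rw [← measureReal_union _ measurableSet_Icc, Iio_union_Icc_eq_Iic hab]
      rw [Set.disjoint_left]
      intro x hx hx'
      exact absurd hx'.1 (not_le.2 hx)
    linarith

end Admissible

/-! ### Concentration of the empirical median. -/

section Concentration

variable {n : ℕ} {D : Measure ℝ} [IsProbabilityMeasure D]

/-- A tail bound for the number of entries in a set of probability `1 / 2 - v`. -/
lemma measure_le_count_le {A : Set ℝ} (hA : MeasurableSet A) {v : ℝ} (hv : 0 ≤ v)
    (hv1 : v ≤ 1 / 4) (hDA : D.real A = 1 / 2 - v) :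
    (Measure.pi fun _ : Fin n => D) {X | n ≤ 2 * count X (· ∈ A) + 1} ≤
      ENNReal.ofReal (2 * Real.exp (-(n * v ^ 2))) := by
  classical
  -- Entries in `A` weigh e^s, the others e^{-s}. The moment is cosh s - 2v sinh s ≤ 1 - 2v² + 4v⁴ ≤
  -- e^{-v²}. The extra factor e^s ≤ 2 pays for the `+ 1` in the event.
  set s := 2 * v with hs
  let h : ℝ → ENNReal := fun y =>
    A.indicator (fun _ => ENNReal.ofReal (Real.exp s)) y +
      Aᶜ.indicator (fun _ => ENNReal.ofReal (Real.exp (-s))) y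
  have hm : Measurable h := (measurable_const.indicator hA).add (measurable_const.indicator hA.compl)
  have hint : ∫⁻ y, h y ∂D ≤ ENNReal.ofReal (Real.exp (-v ^ 2)) := by
    rw [lintegral_add_left (measurable_const.indicator hA), lintegral_indicator hA,
      lintegral_indicator hA.compl, setLIntegral_const, setLIntegral_const,
      ← ofReal_measureReal (s := A), ← ofReal_measureReal (s := Aᶜ),
      ← ENNReal.ofReal_mul (Real.exp_pos _).le, ← ENNReal.ofReal_mul (Real.exp_pos _).le,
      ← ENNReal.ofReal_add (by positivity) (by positivity), probReal_compl_eq_one_sub hA, hDA]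
    refine ENNReal.ofReal_le_ofReal ?_
    have h1 : Real.exp s * (1 / 2 - v) + Real.exp (-s) * (1 - (1 / 2 - v)) =
        Real.cosh s - 2 * v * Real.sinh s := by
      rw [Real.cosh_eq, Real.sinh_eq]; ring
    have h2 : s ≤ Real.sinh s := Real.self_le_sinh_iff.2 (by positivity)
    have h3 := Real.cosh_le_exp_half_sq s
    have h4 : Real.exp (s ^ 2 / 2) ≤ 1 + s ^ 2 / 2 + (s ^ 2 / 2) ^ 2 := by
      have := Real.abs_exp_sub_one_sub_id_le (x := s ^ 2 / 2) (by
        rw [abs_of_nonneg (by positivity)]; rw [hs]; nlinarith)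
      have := (abs_le.1 this).2
      linarith
    have h5 := Real.add_one_le_exp (-v ^ 2)
    rw [h1]
    have h6 : 2 * v * s ≤ 2 * v * Real.sinh s := mul_le_mul_of_nonneg_left h2 (by positivity)
    have h7 : v ^ 2 * v ^ 2 ≤ v ^ 2 * (1 / 16) :=
      mul_le_mul_of_nonneg_left (by nlinarith) (sq_nonneg v)
    rw [hs] at *
    nlinarith
  have hsub : {X : Fin n → ℝ | n ≤ 2 * count X (· ∈ A) + 1} ⊆
      {X | 1 ≤ ENNReal.ofReal (Real.exp s) * ∏ i, h (X i)} := by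
    intro X hX
    have hX' : n ≤ 2 * count X (· ∈ A) + 1 := hX
    have hsum := count_add_count_not X (· ∈ A)
    have hprod : ∏ i, h (X i) = ENNReal.ofReal (Real.exp s) ^ count X (· ∈ A) *
        ENNReal.ofReal (Real.exp (-s)) ^ count X (fun x => ¬ x ∈ A) := by
      have : ∀ i, h (X i) = if X i ∈ A then ENNReal.ofReal (Real.exp s) else
          ENNReal.ofReal (Real.exp (-s)) := by
        intro i
        by_cases hi : X i ∈ A <;> simp [h, hi]
      simp_rw [this]
      rw [Finset.prod_ite, Finset.prod_const, Finset.prod_const]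
      unfold count
      congr!
    change 1 ≤ ENNReal.ofReal (Real.exp s) * ∏ i, h (X i)
    rw [hprod, ← ENNReal.ofReal_pow (Real.exp_pos _).le, ← ENNReal.ofReal_pow (Real.exp_pos _).le,
      ← ENNReal.ofReal_mul (by positivity), ← ENNReal.ofReal_mul (by positivity),
      ← Real.exp_nat_mul, ← Real.exp_nat_mul, ← Real.exp_add, ← Real.exp_add]
    refine ENNReal.one_le_ofReal.2 (Real.one_le_exp ?_)
    have e1 : (count X (fun x => ¬ x ∈ A) : ℝ) ≤ count X (· ∈ A) + 1 := by
      have : count X (fun x => ¬ x ∈ A) ≤ count X (· ∈ A) + 1 := by omega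
      exact_mod_cast this
    have hs0 : 0 ≤ s := by positivity
    have := mul_le_mul_of_nonneg_right e1 hs0
    linarith
  refine (measure_mono hsub).trans ?_
  have hmp : Measurable fun X : Fin n → ℝ => ∏ i, h (X i) :=
    Finset.measurable_prod _ fun i _ => hm.comp (measurable_pi_apply i)
  have h1 := mul_meas_ge_le_lintegral (μ := Measure.pi fun _ : Fin n => D)
    (hmp.const_mul (ENNReal.ofReal (Real.exp s))) 1
  rw [one_mul, lintegral_const_mul _ hmp, lintegral_pi_prod_eq D fun _ => hm,
    Finset.prod_const, Finset.card_univ, Fintype.card_fin] at h1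
  refine h1.trans ?_
  have hs2 : Real.exp s ≤ 2 := by
    refine (Real.exp_le_exp.2 (by rw [hs]; linarith : s ≤ 1 / 2)).trans ?_
    have h := Real.exp_one_lt_d9
    have h' : Real.exp (1 / 2) ^ 2 = Real.exp 1 := by
      rw [← Real.exp_nat_mul]; norm_num
    nlinarith [Real.exp_pos (1 / 2)]
  calc _ ≤ ENNReal.ofReal (Real.exp s) * ENNReal.ofReal (Real.exp (-v ^ 2)) ^ n :=
        mul_le_mul_right (pow_le_pow_left' hint n) _
    _ = ENNReal.ofReal (Real.exp s * Real.exp (-(n * v ^ 2))) := by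
        rw [← ENNReal.ofReal_pow (Real.exp_pos _).le, ← ENNReal.ofReal_mul (Real.exp_pos _).le,
          ← Real.exp_nat_mul]
        ring_nf
    _ ≤ _ := ENNReal.ofReal_le_ofReal (mul_le_mul_of_nonneg_right hs2 (Real.exp_pos _).le)

/-- Concentration of the empirical median. -/
lemma measure_leftMedian_notMem_Icc_le (hn : 0 < n) {a b v : ℝ} (hv : 0 ≤ v) (hv1 : v ≤ 1 / 4)
    (ha : D.real (Iio a) = 1 / 2 - v) (hb : D.real (Ioi b) = 1 / 2 - v) :
    (Measure.pi fun _ : Fin n => D) {X | leftMedian X ∉ Icc a b} ≤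
      ENNReal.ofReal (4 * Real.exp (-(n * v ^ 2))) := by
  have hsub : {X : Fin n → ℝ | leftMedian X ∉ Icc a b} ⊆
      {X | n ≤ 2 * count X (· ∈ Iio a) + 1} ∪ {X | n ≤ 2 * count X (· ∈ Ioi b) + 1} := by
    intro X hX
    have hX' : leftMedian X ∉ Icc a b := hX
    rw [mem_Icc, not_and_or, not_le, not_le, leftMedian_lt_iff hn, lt_leftMedian_iff hn] at hX'
    rcases hX' with h | h
    · left
      change n ≤ 2 * count X (· < a) + 1
      omega
    · right
      change n ≤ 2 * count X (b < ·) + 1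
      omega
  refine (measure_mono hsub).trans ((measure_union_le _ _).trans ?_)
  refine (add_le_add (measure_le_count_le measurableSet_Iio hv hv1 ha)
    (measure_le_count_le measurableSet_Ioi hv hv1 hb)).trans_eq ?_
  rw [← ENNReal.ofReal_add (by positivity) (by positivity)]
  ring_nf

end Concentration

/-! ### Anticoncentration of the empirical median. -/

section Anticoncentration

/-- Induction through the ratio of consecutive central binomials; the step is 4k(k + 1) ≤ (2k + 1)².
-/
lemma four_pow_le_sqrt_mul_centralBinom {k : ℕ} (hk : 1 ≤ k) :
    (16 : ℝ) ^ k ≤ 4 * k * (Nat.centralBinom k : ℝ) ^ 2 := by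
  induction k, hk using Nat.le_induction with
  | base => norm_num [Nat.centralBinom]
  | succ k hk ih =>
    have h := Nat.succ_mul_centralBinom_succ k
    have h' : ((k : ℝ) + 1) * (Nat.centralBinom (k + 1) : ℝ) =
        2 * (2 * k + 1) * Nat.centralBinom k := by exact_mod_cast h
    have hk0 : (0 : ℝ) < (k : ℝ) + 1 := by positivity
    push_cast
    have h2 : ((k : ℝ) + 1) * (4 * (k + 1) * (Nat.centralBinom (k + 1) : ℝ) ^ 2) =
        4 * (2 * (2 * k + 1) * Nat.centralBinom k) ^ 2 := by rw [← h']; ring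
    refine le_of_mul_le_mul_left ?_ hk0
    rw [h2, pow_succ]
    have h3 := mul_le_mul_of_nonneg_left ih hk0.le
    have h4 : 0 ≤ (Nat.centralBinom k : ℝ) ^ 2 := by positivity
    nlinarith

/-- The right side is the combinatorial factor in the law of the median. Since N ≥ 2q + 1, it
reduces to half the central binomial coefficient of 2q + 2. -/
lemma sqrt_le_mul_choose {N : ℕ} (hN : 1 ≤ N) :
    Real.sqrt (N + 1 : ℕ) * 4 ^ ((N + 1) / 2 - 1) ≤
      ((N + 1 : ℕ) : ℝ) * (N.choose ((N + 1) / 2 - 1) : ℝ) := by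
  set q := (N + 1) / 2 - 1 with hq
  have h1 := four_pow_le_sqrt_mul_centralBinom (k := q + 1) (by omega)
  have h2 : 2 * (2 * q + 1).choose q = Nat.centralBinom (q + 1) := by
    have h3 : (2 * q + 1).choose q = (2 * q + 1).choose (q + 1) :=
      Nat.choose_symm_half q |>.symm
    rw [Nat.centralBinom_eq_two_mul_choose, show 2 * (q + 1) = 2 * q + 1 + 1 by ring,
      Nat.choose_succ_succ, ← h3]
    ring
  have h3 : (2 * q + 1).choose q ≤ N.choose q := Nat.choose_le_choose q (by omega)
  have h3' : ((2 * q + 1).choose q : ℝ) ≤ N.choose q := by exact_mod_cast h3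
  rw [← h2] at h1
  push_cast at h1
  have hqn : (q : ℝ) + 1 ≤ (N + 1 : ℕ) := by
    have : q + 1 ≤ N + 1 := by omega
    exact_mod_cast this
  set n : ℝ := ((N + 1 : ℕ) : ℝ)
  have hn0 : 0 ≤ n := Nat.cast_nonneg _
  have hc0 : (0 : ℝ) ≤ (2 * q + 1).choose q := Nat.cast_nonneg _
  have h4 : (4 : ℝ) ^ q ≤ Real.sqrt n * (2 * q + 1).choose q := by
    refine le_of_sq_le_sq ?_ (by positivity)
    rw [mul_pow, Real.sq_sqrt hn0, ← pow_mul, mul_comm q 2, pow_mul]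
    norm_num
    rw [pow_succ] at h1
    have := mul_le_mul_of_nonneg_right hqn (sq_nonneg ((2 * q + 1).choose q : ℝ))
    nlinarith
  calc Real.sqrt n * 4 ^ q ≤ Real.sqrt n * (Real.sqrt n * (2 * q + 1).choose q) :=
        mul_le_mul_of_nonneg_left h4 (Real.sqrt_nonneg _)
    _ = n * (2 * q + 1).choose q := by rw [← mul_assoc, Real.mul_self_sqrt hn0]
    _ ≤ _ := mul_le_mul_of_nonneg_left h3' hn0

/-- A lower bound for the probability that the empirical median is close to the median. -/
lemma IsMedianWindow.le_measure_leftMedian_mem {N : ℕ} {D : Measure ℝ} [IsProbabilityMeasure D]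
    {L r a b v : ℝ} (hW : IsMedianWindow L r D (Icc a b)) (hN : 1 ≤ N) (hv : 0 ≤ v)
    (hv1 : v ≤ 1 / 4) (hvn : 8 * ((N + 1 : ℕ) : ℝ) * v ^ 2 ≤ 1) (hab : D.real (Icc a b) = 2 * v)
    (ha : D.real (Iio a) = 1 / 2 - v) (hb : D.real (Ioi b) = 1 / 2 - v) :
    ENNReal.ofReal (Real.sqrt (N + 1 : ℕ) * v / 16) ≤
      (Measure.pi fun _ : Fin (N + 1) => D) {X | leftMedian X ∈ Icc a b} := by
  refine le_trans ?_ (PrivateMedian.le_measure_leftMedian_mem D measurableSet_Icc)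
  have hch := sqrt_le_mul_choose hN
  set q := (N + 1) / 2 - 1 with hq
  have hpoint : ∀ t ∈ Icc a b,
      ENNReal.ofReal (1 / 32 * (1 / 4) ^ q) ≤ D (Iio t) ^ q * D (Ioi t) ^ (N - q) := by
    intro t ht
    have h1 : 1 / 2 - v ≤ D.real (Iio t) := by
      rw [← ha]; exact measureReal_mono (Iio_subset_Iio ht.1)
    have h2 : 1 / 2 - v ≤ D.real (Ioi t) := by
      rw [← hb]; exact measureReal_mono (Ioi_subset_Ioi ht.2)
    have h3 : D.real (Iio t) + D.real (Ioi t) = 1 := by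
      have e1 : D (Iic t) = D (Iio t) := by
        refine le_antisymm ?_ (measure_mono Iio_subset_Iic_self)
        rw [← Iio_union_right]
        refine (measure_union_le _ _).trans ?_
        rw [hW.singleton t ht, add_zero]
      rw [← compl_Iic, probReal_compl_eq_one_sub measurableSet_Iic]
      simp [measureReal_def, e1]
    rw [← ofReal_measureReal (s := Iio t), ← ofReal_measureReal (s := Ioi t),
      ← ENNReal.ofReal_pow measureReal_nonneg, ← ENNReal.ofReal_pow measureReal_nonneg,
      ← ENNReal.ofReal_mul (pow_nonneg measureReal_nonneg _)]
    refine ENNReal.ofReal_le_ofReal ?_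
    set x := D.real (Iio t)
    set y := D.real (Ioi t)
    -- The median is slightly left of centre, by one or two surplus factors depending on parity,
    -- each at least 1/4. The balanced part is (F(1 - F))^q ≥ 4^{-q}(1 - 4v²)^q, and `hvn` with
    -- Bernoulli's inequality bounds the last power by 1/2 from below.
    have hsplit : N - q = q + (N - 2 * q) := by omega
    have hN2 : N - 2 * q ≤ 2 := by omega
    have hy : (1 / 4 : ℝ) ≤ y := by linarith
    have hxy : 1 / 4 * (1 - 4 * v ^ 2) ≤ x * y := by nlinarith
    have hpow : (1 / 16 : ℝ) ≤ y ^ (N - 2 * q) := by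
      have e1 : (1 / 4 : ℝ) ^ 2 ≤ (1 / 4 : ℝ) ^ (N - 2 * q) :=
        pow_le_pow_of_le_one (by norm_num) (by norm_num) hN2
      have e2 : (1 / 4 : ℝ) ^ (N - 2 * q) ≤ y ^ (N - 2 * q) :=
        pow_le_pow_left₀ (by norm_num) hy _
      norm_num at e1 e2 ⊢
      linarith
    have hbern : (1 : ℝ) / 2 ≤ (1 - 4 * v ^ 2) ^ q := by
      have e1 := one_add_mul_le_pow (a := -(4 * v ^ 2)) (by nlinarith) q
      have e2 : (q : ℝ) ≤ ((N + 1 : ℕ) : ℝ) := by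
        have : q ≤ N + 1 := by omega
        exact_mod_cast this
      have e3 := mul_le_mul_of_nonneg_right e2 (sq_nonneg v)
      rw [← sub_eq_add_neg] at e1
      linarith
    have hpow2 : (1 / 4) ^ q * (1 / 2) ≤ (x * y) ^ q := by
      calc (1 / 4 : ℝ) ^ q * (1 / 2) ≤ (1 / 4) ^ q * (1 - 4 * v ^ 2) ^ q :=
            mul_le_mul_of_nonneg_left hbern (by positivity)
        _ = (1 / 4 * (1 - 4 * v ^ 2)) ^ q := (mul_pow _ _ _).symm
        _ ≤ _ := pow_le_pow_left₀ (by nlinarith) hxy _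
    calc (1 / 32 : ℝ) * (1 / 4) ^ q = (1 / 4) ^ q * (1 / 2) * (1 / 16) := by ring
      _ ≤ (x * y) ^ q * y ^ (N - 2 * q) :=
          mul_le_mul hpow2 hpow (by norm_num) (le_trans (by positivity) hpow2)
      _ = x ^ q * y ^ (N - q) := by rw [hsplit, pow_add, mul_pow]; ring
  have hint : ENNReal.ofReal (1 / 32 * (1 / 4) ^ q * (2 * v)) ≤
      ∫⁻ t in Icc a b, D (Iio t) ^ q * D (Ioi t) ^ (N - q) ∂D := by
    rw [← hab, ENNReal.ofReal_mul (by positivity), ofReal_measureReal, ← setLIntegral_const]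
    exact setLIntegral_mono' measurableSet_Icc hpoint
  refine le_trans ?_ (mul_le_mul_right hint _)
  rw [← ENNReal.ofReal_natCast, ← ENNReal.ofReal_natCast, ← ENNReal.ofReal_mul (by positivity),
    ← ENNReal.ofReal_mul (by positivity)]
  refine ENNReal.ofReal_le_ofReal ?_
  have h4 : (4 : ℝ) ^ q * (1 / 4) ^ q = 1 := by rw [← mul_pow]; norm_num
  calc Real.sqrt (N + 1 : ℕ) * v / 16
      = (Real.sqrt (N + 1 : ℕ) * 4 ^ q) * (1 / 32 * (1 / 4) ^ q * (2 * v)) := by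
        linear_combination (-(Real.sqrt (N + 1 : ℕ) * v / 16)) * h4
    _ ≤ _ := mul_le_mul_of_nonneg_right hch (by positivity)

end Anticoncentration

end PrivateMedian

/-! ### Accuracy for failure probabilities bounded away from one. -/

namespace PrivateMedian

section

variable {n : ℕ} {D : Measure ℝ} [IsProbabilityMeasure D]

/-- `B` need not be measurable, so the integral is split along a superlevel set of `f`, which lies
in `B`. -/
lemma lintegral_le_add_measure {Ω : Type*} [MeasurableSpace Ω] (μ : Measure Ω)
    [IsProbabilityMeasure μ] {f : Ω → ENNReal} (hf : Measurable f) (hf1 : ∀ X, f X ≤ 1)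
    {δ : ENNReal} {B : Set Ω} (hB : ∀ X, X ∉ B → f X ≤ δ) :
    ∫⁻ X, f X ∂μ ≤ δ + μ B := by
  have hm : MeasurableSet {X | δ < f X} := measurableSet_lt measurable_const hf
  calc ∫⁻ X, f X ∂μ ≤ ∫⁻ X, (δ + {X | δ < f X}.indicator 1 X) ∂μ := by
        refine lintegral_mono fun X => ?_
        by_cases hX : X ∈ {X | δ < f X}
        · rw [indicator_of_mem hX]
          exact (hf1 X).trans le_add_self
        · rw [indicator_of_notMem hX, add_zero]
          exact not_lt.1 hX
    _ = δ + μ {X | δ < f X} := by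
        rw [lintegral_add_left measurable_const, lintegral_const, measure_univ, mul_one,
          lintegral_indicator_one hm]
    _ ≤ δ + μ B := by
        refine add_le_add_right (measure_mono fun X hX => ?_) _
        by_contra hc
        exact absurd (hB X hc) (not_le.2 hX)

/-- The contribution of the flat part of the density is negligible. -/
lemma mul_exp_neg_le {C ε L R r α : ℝ} (hC : 1 ≤ C) (hε : 0 < ε) (hL : 0 < L) (hR : 0 < R)
    (hr : 0 < r) (hα : 0 < α) (hαr : α < r) (hn : 0 < n)
    (h : 16 * Real.log (R / α + 1) ≤ n * (ε * L * r)) :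
    ε * L * n / (12 * C) * (R + 4 * C * r) * Real.exp (-(ε * L * r * n / 4)) ≤
      3 * Real.exp (-(ε * L * r * n / 16)) := by
  have hn' : (0 : ℝ) < n := by exact_mod_cast hn
  set y := ε * L * r * n / 4 with hy
  have hy0 : 0 < y := by positivity
  have h1 : R / α + 1 ≤ Real.exp (y / 4) := by
    rw [← Real.log_le_iff_le_exp (by positivity)]
    rw [hy]; linarith
  have h2 : ε * L * n / (12 * C) * (R + 4 * C * r) ≤ 4 / 3 * y * (R / α + 1) := by
    have e1 : ε * L * n / (12 * C) * (R + 4 * C * r) = y / 3 * (R / r / C) + 4 / 3 * y := by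
      rw [hy]; field_simp; ring
    have e2 : R / r / C ≤ R / α := by
      rw [div_div]
      refine div_le_div_of_nonneg_left hR.le hα ?_
      nlinarith
    have e3 : 0 < R / α := by positivity
    rw [e1]
    have := mul_le_mul_of_nonneg_left e2 (by positivity : 0 ≤ y / 3)
    nlinarith
  have h3 : y ≤ 2 * Real.exp (y / 2) := by
    have := Real.add_one_le_exp (y / 2)
    linarith
  have h4 : ε * L * r * n / 16 = y / 4 := by rw [hy]; ring
  rw [h4]
  calc _ ≤ 4 / 3 * y * (R / α + 1) * Real.exp (-y) :=
        mul_le_mul_of_nonneg_right h2 (Real.exp_pos _).le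
    _ ≤ 4 / 3 * (2 * Real.exp (y / 2)) * Real.exp (y / 4) * Real.exp (-y) := by
        gcongr
    _ = 8 / 3 * (Real.exp (y / 2) * Real.exp (y / 4) * Real.exp (-y)) := by ring
    _ = 8 / 3 * Real.exp (-(y / 4)) := by
        rw [← Real.exp_add, ← Real.exp_add]; ring_nf
    _ ≤ _ := by
        have := Real.exp_pos (-(y / 4))
        linarith

/-- The failure probability in terms of the tails of the median and of the Laplace noise. -/
lemma failureProbability_le {C ε L R r m α : ℝ} (hC : 64 ≤ C) (hε : 0 < ε) (hε1 : ε < 1)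
    (hL : 0 < L) (hR : 0 < R) (hr : 0 < r) (hLr : L * r ≤ 1 / 2) (hD : IsAdmissible L R r D m)
    (hα : 0 < α) (hαr : α < r) (hn : 150 ≤ n) (hy : 1 ≤ ε * L * r * n / 4)
    (h : 16 * Real.log (R / α + 1) ≤ n * (ε * L * r)) (k : ℕ) :
    failureProbability (n := n) (algorithm C ε L R r) D m α ≤
      ENNReal.ofReal (Real.exp (k + 2) * (2 * Real.exp (-(ε * L * n * α / (48 * C))) +
          3 * Real.exp (-(ε * L * r * n / 16))) +
        4 * Real.exp (-(n * (L * α) ^ 2 / 64)) +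
        (1 / 8 * Real.exp (-(k : ℝ)) + 2 * Real.exp (-(L * n * r / 30)))) := by
  obtain ⟨N, rfl⟩ : ∃ N, n = N + 1 := ⟨n - 1, by omega⟩
  have hC1 : 1 ≤ C := by linarith
  have hn0 : 0 < N + 1 := Nat.succ_pos N
  have hLα : L * α ≤ 1 / 2 := (mul_le_mul_of_nonneg_left hαr.le hL.le).trans hLr
  -- This v puts the window within α/8 of the median, so a failure forces the noise to exceed α/2.
  obtain ⟨a, b, hW, ha, hb, -, hDa, hDb⟩ := hD.exists_isMedianWindow hL hr hLr
    (v := L * α / 8) (by positivity)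
    (by linarith only [mul_le_mul_of_nonneg_left hαr.le hL.le])
  have hvL : L * α / 8 / L = α / 8 := by field_simp
  rw [hvL] at ha hb
  have hA := isRandomizedAlgorithm_algorithm (n := N + 1) hC1 hε hL hR hr hLr hn0
  have hS : MeasurableSet {ω : ℝ | α ≤ |ω - m|} :=
    measurableSet_le measurable_const (by fun_prop)
  unfold failureProbability
  set μ := Measure.pi fun _ : Fin (N + 1) => D
  have hprob := hA.2
  refine (lintegral_le_add_measure μ ((Measure.measurable_coe hS).comp hA.1)
    (fun X => prob_le_one)
    (δ := ENNReal.ofReal (Real.exp (k + 2) * (2 * Real.exp (-(ε * L * ((N + 1 : ℕ) : ℝ) * α /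
      (48 * C))) + 3 * Real.exp (-(ε * L * r * ((N + 1 : ℕ) : ℝ) / 16)))))
    (B := {X | leftMedian X ∉ Icc a b} ∪
      ({X | ¬ WellSpread C L r k X} ∩ {X | leftMedian X ∈ Icc a b})) ?_).trans ?_
  · intro X hX
    simp only [mem_union, mem_ofPred_eq, mem_inter_iff, not_or, not_and, not_not] at hX
    have hmed := hX.1
    have hws : WellSpread C L r k X := by
      by_contra hc
      exact hX.2 hc hmed
    have hm := hD.mem_Icc
    have hrange : leftMedian X ∈ Icc (-R - r / 2) (R + r / 2) :=
      ⟨by linarith [hm.1, hmed.1], by linarith [hm.2, hmed.2]⟩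
    have hsub : {ω : ℝ | α ≤ |ω - m|} ⊆ {ω | α / 2 ≤ |leftMedian X - ω|} := by
      intro ω hω
      have hω' : α ≤ |ω - m| := hω
      change α / 2 ≤ |leftMedian X - ω|
      have h1 : |ω - m| ≤ |ω - leftMedian X| + |leftMedian X - m| := abs_sub_le _ _ _
      have h2 : |leftMedian X - m| ≤ α / 8 := by
        rw [abs_le]; exact ⟨by linarith [hmed.1], by linarith [hmed.2]⟩
      rw [abs_sub_comm] at h1
      rw [abs_sub_comm]
      rw [abs_sub_comm m ω] at h1
      linarith
    have hS' : MeasurableSet {ω : ℝ | α / 2 ≤ |leftMedian X - ω|} :=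
      measurableSet_le measurable_const (by fun_prop)
    refine (measure_mono hsub).trans ((hws.algorithm_apply_le hC1 hε hL hR hr hLr hn0 hrange
      hS').trans (ENNReal.ofReal_le_ofReal ?_))
    have e1 := setIntegral_tail_div_normalizer_le (C := C) (n := N + 1) (by linarith) hε hL hR hr
      hn0 hy (leftMedian X) (α / 2)
    have e2 := mul_exp_neg_le hC1 hε hL hR hr hα hαr hn0 h
    have e3 : Real.exp (ε / 2 * (2 * k + 1)) * Real.exp 1 ≤ Real.exp (k + 2) := by
      rw [← Real.exp_add]
      refine Real.exp_le_exp.2 ?_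
      have : (0 : ℝ) ≤ k := Nat.cast_nonneg k
      linarith only [mul_le_mul_of_nonneg_right hε1.le this, hε1]
    have e4 : ε * L * ((N + 1 : ℕ) : ℝ) / (12 * C) * (α / 2) / 2 =
        ε * L * ((N + 1 : ℕ) : ℝ) * α / (48 * C) := by
      field_simp; norm_num
    rw [e4] at e1
    calc _ ≤ Real.exp (ε / 2 * (2 * k + 1)) * (Real.exp 1 *
          (2 * Real.exp (-(ε * L * ((N + 1 : ℕ) : ℝ) * α / (48 * C))) +
            3 * Real.exp (-(ε * L * r * ((N + 1 : ℕ) : ℝ) / 16)))) := by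
          refine mul_le_mul_of_nonneg_left (e1.trans ?_) (Real.exp_pos _).le
          exact mul_le_mul_of_nonneg_left (add_le_add_right e2 _) (Real.exp_pos _).le
      _ ≤ _ := by
          rw [← mul_assoc]
          exact mul_le_mul_of_nonneg_right e3 (by positivity)
  · have e1 := measure_leftMedian_notMem_Icc_le (n := N + 1) hn0 (by positivity)
      (by linarith : L * α / 8 ≤ 1 / 4) hDa hDb
    have e2 := (hW.measure_not_wellSpread_le hC hL hr hn k).trans
      (mul_le_of_le_one_right' prob_le_one)
    have e3 : ((N + 1 : ℕ) : ℝ) * (L * α / 8) ^ 2 = ((N + 1 : ℕ) : ℝ) * (L * α) ^ 2 / 64 := by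
      ring
    rw [e3] at e1
    rw [add_assoc (Real.exp _ * _), ENNReal.ofReal_add (by positivity) (by positivity),
      ENNReal.ofReal_add (by positivity) (by positivity)]
    exact add_le_add_right ((measure_union_le _ _).trans (add_le_add e1 e2)) _

/-- Accuracy with explicit constants. -/
lemma failureProbability_le_of_le {C ε L R r m α β K : ℝ} (hC : 64 ≤ C) (hε : 0 < ε)
    (hε1 : ε < 1) (hL : 0 < L) (hR : 0 < R) (hr : 0 < r) (hLr : L * r ≤ 1 / 2)
    (hD : IsAdmissible L R r D m) (hα : 0 < α) (hαr : α < r) (hβ : 0 < β) (hβ1 : β < 1)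
    (h1 : K * Real.log (1 / β) ≤ n * (L * α) ^ 2)
    (h2 : K * (C * Real.log (1 / β)) ≤ n * (ε * L * α))
    (h3 : K * Real.log (R / α + 1) ≤ n * (ε * L * r))
    (hK : 6 ≤ (K / 64 - 2) * Real.log (1 / β)) :
    failureProbability (n := n) (algorithm C ε L R r) D m α ≤ ENNReal.ofReal β := by
  set Λ := Real.log (1 / β) with hΛ
  have hΛ0 : 0 < Λ := Real.log_pos (by rw [lt_div_iff₀ hβ]; linarith)
  have hβΛ : β = Real.exp (-Λ) := by
    rw [hΛ, one_div, Real.log_inv, neg_neg, Real.exp_log hβ]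
  have hK128 : 128 < K := by
    by_contra hc
    have : (K / 64 - 2) * Λ ≤ 0 := mul_nonpos_of_nonpos_of_nonneg (by linarith) hΛ0.le
    linarith
  have hKΛ : 384 ≤ K * Λ := by nlinarith
  have hLα : L * α ≤ 1 / 2 := (mul_le_mul_of_nonneg_left hαr.le hL.le).trans hLr
  have hLα0 : 0 < L * α := by positivity
  have hn0 : (0 : ℝ) ≤ n := Nat.cast_nonneg n
  have hsq : (L * α) ^ 2 ≤ L * α / 2 := by nlinarith
  have hnreal : 150 ≤ (n : ℝ) := by
    have : (n : ℝ) * (L * α) ^ 2 ≤ n * (1 / 4) := mul_le_mul_of_nonneg_left (by nlinarith) hn0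
    linarith
  have hn : 150 ≤ n := by exact_mod_cast hnreal
  have hKCΛ : 64 * (K * Λ) ≤ K * (C * Λ) := by
    have : 64 * (K * Λ) ≤ C * (K * Λ) := mul_le_mul_of_nonneg_right hC (by linarith)
    linarith
  have hyr : (n : ℝ) * (ε * L * α) ≤ ε * L * r * n := by
    have : 0 ≤ ε * L * n := by positivity
    nlinarith
  have hlog : 0 ≤ Real.log (R / α + 1) := by
    refine Real.log_nonneg ?_
    have : 0 < R / α := by positivity
    linarith
  -- k = ⌈log(1/β)⌉ is just large enough for e^{-k} ≤ β, while the comparison cost e^{k+2} stays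
  -- below 27/β.
  have h := failureProbability_le (n := n) hC hε hε1 hL hR hr hLr hD hα hαr hn (by linarith)
    (by nlinarith) ⌈Λ⌉₊
  refine h.trans (ENNReal.ofReal_le_ofReal ?_)
  have hk1 : Λ ≤ (⌈Λ⌉₊ : ℝ) := Nat.le_ceil Λ
  have hk2 : (⌈Λ⌉₊ : ℝ) < Λ + 1 := Nat.ceil_lt_add_one hΛ0.le
  set k : ℝ := (⌈Λ⌉₊ : ℝ)
  set E := Real.exp (-(K * Λ / 64)) with hE
  have hE0 : 0 < E := Real.exp_pos _
  have b1 : Real.exp (-(ε * L * n * α / (48 * C))) ≤ E := by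
    refine Real.exp_le_exp.2 (neg_le_neg ?_)
    rw [le_div_iff₀ (by positivity)]
    have : 0 ≤ K * (C * Λ) := by linarith
    linarith
  have b2 : Real.exp (-(ε * L * r * n / 16)) ≤ E :=
    Real.exp_le_exp.2 (neg_le_neg (by linarith))
  have b3 : Real.exp (-(n * (L * α) ^ 2 / 64)) ≤ E :=
    Real.exp_le_exp.2 (neg_le_neg (by linarith))
  have b4 : Real.exp (-(L * n * r / 30)) ≤ E := by
    refine Real.exp_le_exp.2 (neg_le_neg ?_)
    have e1 : (n : ℝ) * (L * α) ^ 2 ≤ n * (L * α / 2) := mul_le_mul_of_nonneg_left hsq hn0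
    have e2 : (n : ℝ) * (L * α) ≤ n * (L * r) :=
      mul_le_mul_of_nonneg_left (mul_le_mul_of_nonneg_left hαr.le hL.le) hn0
    linarith
  have b5 : Real.exp (-k) ≤ β := by
    rw [hβΛ]; exact Real.exp_le_exp.2 (by linarith)
  have hexp1 : Real.exp 1 < 3 := Real.exp_one_lt_d9.trans (by norm_num)
  have b6 : Real.exp (k + 2) ≤ 27 * Real.exp Λ := by
    have e1 : Real.exp (k + 2) ≤ Real.exp (3 + Λ) := Real.exp_le_exp.2 (by linarith)
    have e2 : Real.exp 3 = Real.exp 1 ^ 3 := by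
      rw [← Real.exp_nat_mul]; norm_num
    have e3 : Real.exp 1 ^ 3 ≤ 3 ^ 3 := pow_le_pow_left₀ (Real.exp_pos _).le hexp1.le 3
    rw [Real.exp_add 3, e2] at e1
    refine e1.trans (mul_le_mul_of_nonneg_right (by linarith) (Real.exp_pos _).le)
  -- `hK` says KΛ/64 ≥ 2Λ + 6: one Λ cancels the comparison cost, one yields β, and e^{-6} absorbs
  -- the constants. In total 27·5 + 4 + 2 = 141 copies of β/200, plus β/8, remain below β.
  have b7 : Real.exp Λ * E ≤ β / 200 := by
    have e1 : (2 : ℝ) ≤ Real.exp 1 := by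
      have := Real.add_one_le_exp (1 : ℝ); linarith
    have e2 : Real.exp (-6) ≤ 1 / 200 := by
      have e3 : Real.exp 6 = Real.exp 1 ^ 6 := by
        rw [← Real.exp_nat_mul]; norm_num
      have e4 : (2.7 : ℝ) ^ 6 ≤ Real.exp 1 ^ 6 :=
        pow_le_pow_left₀ (by norm_num) (by linarith [Real.exp_one_gt_d9]) 6
      rw [Real.exp_neg, inv_eq_one_div]
      refine one_div_le_one_div_of_le (by norm_num) ?_
      rw [e3]
      refine le_trans ?_ e4
      norm_num
    calc Real.exp Λ * E = Real.exp (Λ - K * Λ / 64) := by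
          rw [hE, ← Real.exp_add]; ring_nf
      _ ≤ Real.exp (-Λ + -6) := Real.exp_le_exp.2 (by linarith)
      _ = β * Real.exp (-6) := by rw [Real.exp_add, ← hβΛ]
      _ ≤ β * (1 / 200) := mul_le_mul_of_nonneg_left e2 hβ.le
      _ = β / 200 := by ring
  have b8 : E ≤ Real.exp Λ * E := by
    have : 1 ≤ Real.exp Λ := Real.one_le_exp hΛ0.le
    nlinarith
  have b9 : Real.exp (k + 2) * (2 * Real.exp (-(ε * L * n * α / (48 * C))) +
      3 * Real.exp (-(ε * L * r * n / 16))) ≤ 27 * Real.exp Λ * (5 * E) :=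
    mul_le_mul b6 (by linarith) (by positivity) (by positivity)
  linarith

end

end PrivateMedian

/-! ### Lower bounds for the success probability at every sample size. -/

namespace PrivateMedian

section

variable {n : ℕ} {D : Measure ℝ} [IsProbabilityMeasure D] {C ε L R r m α : ℝ}

lemma failureProbability_le_one_sub {A : (Fin n → ℝ) → Measure ℝ} (hA : IsRandomizedAlgorithm A)
    {p : ℝ} (hp0 : 0 ≤ p)
    (hp : ENNReal.ofReal p ≤ ∫⁻ X, A X {ω | |ω - m| < α} ∂(Measure.pi fun _ : Fin n => D)) :
    failureProbability A D m α ≤ ENNReal.ofReal (1 - p) := by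
  have hS : MeasurableSet {ω : ℝ | |ω - m| < α} := measurableSet_lt (by fun_prop) measurable_const
  have hc : {ω : ℝ | α ≤ |ω - m|} = {ω : ℝ | |ω - m| < α}ᶜ := by
    ext ω; simp
  have hprob := hA.2
  have hm : Measurable fun X => A X {ω : ℝ | |ω - m| < α} :=
    (Measure.measurable_coe hS).comp hA.1
  have hsum : failureProbability A D m α +
      ∫⁻ X, A X {ω | |ω - m| < α} ∂(Measure.pi fun _ : Fin n => D) = 1 := by
    unfold failureProbability
    rw [← lintegral_add_right _ hm]
    have : ∀ X, A X {ω : ℝ | α ≤ |ω - m|} + A X {ω : ℝ | |ω - m| < α} = 1 := by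
      intro X
      rw [hc, add_comm]
      exact prob_add_prob_compl hS
    simp_rw [this]
    simp
  rw [ENNReal.ofReal_sub _ hp0, ENNReal.ofReal_one, ← hsum]
  refine le_trans ?_ (tsub_le_tsub_left hp _)
  have hfin : ∫⁻ X, A X {ω | |ω - m| < α} ∂(Measure.pi fun _ : Fin n => D) ≠ ⊤ := by
    intro h
    rw [h] at hsum
    simp at hsum
  rw [ENNReal.add_sub_cancel_right hfin]

/-- If the noise is so large that the output is nearly uniform, the success probability is still
at least of the order of `α / r`. -/
lemma failureProbability_le_of_small {M : ℝ} (hC : 1 ≤ C) (hε : 0 < ε)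
    (hL : 0 < L) (hR : 0 < R) (hr : 0 < r) (hLr : L * r ≤ 1 / 2) (hD : IsAdmissible L R r D m)
    (hα : 0 < α) (hαr : α < r) (hn : 0 < n) (hM : n * (ε * L * r) ≤ M)
    (h : 16 * Real.log (R / α + 1) ≤ n * (ε * L * r)) :
    failureProbability (n := n) (algorithm C ε L R r) D m α ≤ ENNReal.ofReal
      (1 - Real.exp (-M) * (1 / (M * (Real.exp M + 4 * C))) * (n * (ε * L * α))) := by
  have hn' : (0 : ℝ) < n := by exact_mod_cast hn
  have hM0 : 0 < M := lt_of_lt_of_le (by positivity) hM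
  have hS : MeasurableSet {ω : ℝ | |ω - m| < α} := measurableSet_lt (by fun_prop) measurable_const
  have hm := hD.mem_Icc
  have hSI : {ω : ℝ | |ω - m| < α} ⊆ outputInterval C R r := by
    intro ω hω
    have hω' : |ω - m| < α := hω
    rw [abs_lt] at hω'
    have : r ≤ C * r := by nlinarith
    constructor
    · linarith [hω'.1, hm.1]
    · linarith [hω'.2, hm.2]
  have hvol : (volume : Measure ℝ).real {ω : ℝ | |ω - m| < α} = 2 * α := by
    have : {ω : ℝ | |ω - m| < α} = Ioo (m - α) (m + α) := by
      ext ω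
      change |ω - m| < α ↔ _
      rw [abs_lt, mem_Ioo]
      constructor <;> rintro ⟨h1, h2⟩ <;> constructor <;> linarith
    rw [this, Real.volume_real_Ioo_of_le (by linarith)]
    ring
  -- In this regime the logarithmic condition itself bounds R/α, so the output interval has length
  -- of order r and uniform output succeeds with probability of order α/r.
  have hRr : R ≤ r * Real.exp M := by
    have e1 : R / α + 1 ≤ Real.exp M := by
      rw [← Real.log_le_iff_le_exp (by positivity)]
      linarith
    have e2 : R / α ≤ Real.exp M := by linarith
    rw [div_le_iff₀ hα] at e2
    have := mul_le_mul_of_nonneg_left hαr.le (Real.exp_pos M).le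
    linarith
  refine failureProbability_le_one_sub
    (isRandomizedAlgorithm_algorithm hC hε hL hR hr hLr hn) (by positivity) ?_
  have hpoint : ∀ X : Fin n → ℝ, ENNReal.ofReal
      (Real.exp (-M) * (1 / (M * (Real.exp M + 4 * C))) * (n * (ε * L * α))) ≤
      algorithm C ε L R r X {ω | |ω - m| < α} := by
    intro X
    refine le_trans (ENNReal.ofReal_le_ofReal ?_)
      (le_algorithm_apply_uniform hC hε hL hR hr hLr hn X hS hSI)
    rw [hvol, mul_assoc]
    have e1 : Real.exp (-M) ≤ Real.exp (-(ε / 4) * (L * r * n)) := by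
      refine Real.exp_le_exp.2 ?_
      have : 0 < n * (ε * L * r) := by positivity
      linarith
    refine mul_le_mul e1 ?_ (by positivity) (Real.exp_pos _).le
    rw [div_mul_eq_mul_div, one_mul, div_le_div_iff₀ (by positivity) (by positivity)]
    have e2 : 2 * R + 8 * C * r ≤ r * (2 * (Real.exp M + 4 * C)) := by linarith
    calc (n : ℝ) * (ε * L * α) * (2 * R + 8 * C * r)
        ≤ n * (ε * L * α) * (r * (2 * (Real.exp M + 4 * C))) :=
          mul_le_mul_of_nonneg_left e2 (by positivity)
      _ = n * (ε * L * r) * (2 * α * (Real.exp M + 4 * C)) := by ring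
      _ ≤ M * (2 * α * (Real.exp M + 4 * C)) := mul_le_mul_of_nonneg_right hM (by positivity)
      _ = _ := by ring
  calc _ = ∫⁻ _ : Fin n → ℝ, ENNReal.ofReal
        (Real.exp (-M) * (1 / (M * (Real.exp M + 4 * C))) * (n * (ε * L * α)))
        ∂(Measure.pi fun _ : Fin n => D) := by simp
    _ ≤ _ := lintegral_mono hpoint

/-- The flattened Laplace mechanism puts mass of order `α / s` near points at distance of order
`s` from the median, where `s` is the scale of the noise. -/
lemma le_setIntegral_div_normalizer (hC : 1 ≤ C) (hε : 0 < ε) (hL : 0 < L) (hR : 0 < R)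
    (hr : 0 < r) (hα : 0 < α) (hαr : α < r) (hn : 0 < n) (hy : 1 ≤ ε * L * r * n / 4)
    (h : 16 * Real.log (R / α + 1) ≤ n * (ε * L * r)) (hm : m ∈ Icc (-R) R) {t s : ℝ}
    (hs : s = 12 * C / (ε * L * n)) (hsr : s ≤ r / 8) (ht : |t - m| ≤ max s (α / 8)) :
    1 / 1080 * min 1 (α / s) ≤
      (∫ ω in {ω | |ω - m| < α}, truncatedProfile C ε L R r n t ω) /
        laplaceNormalizer C ε L R r n := by
  have hn' : (0 : ℝ) < n := by exact_mod_cast hn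
  have hC0 : 0 < C := by linarith
  have hs0 : 0 < s := by rw [hs]; positivity
  have hlam : 1 / s = ε * L * n / (12 * C) := by rw [hs]; field_simp
  have hlam0 : 0 < 1 / s := by positivity
  have hJ0 := laplaceNormalizer_pos (L := L) (n := n) hC0 hε hR hr
  have hJ : laplaceNormalizer C ε L R r n ≤ 10 * s := by
    have e1 := laplaceNormalizer_le hC0 hε hL hR hr hn
    have e2 := mul_exp_neg_le hC hε hL hR hr hα hαr hn h
    rw [← hlam] at e1 e2
    have e3 : Real.exp (-(ε * L * r * n / 16)) ≤ 1 := Real.exp_le_one_iff.2 (by linarith)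
    have e4 : 4 / (1 / s) = 4 * s := by field_simp
    rw [e4] at e1
    have e5 : (2 * R + 8 * C * r) * Real.exp (-(ε * L * r * n / 4)) =
        2 * s * (1 / s * (R + 4 * C * r) * Real.exp (-(ε * L * r * n / 4))) := by
      field_simp; ring
    have e6 := mul_le_mul_of_nonneg_left (e2.trans (by linarith : _ ≤ (3 : ℝ)))
      (by positivity : 0 ≤ 2 * s)
    linarith
  have hS : MeasurableSet {ω : ℝ | |ω - m| < α} := measurableSet_lt (by fun_prop) measurable_const
  have hexp1 : Real.exp 1 < 3 := Real.exp_one_lt_d9.trans (by norm_num)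
  have hexpm : 1 / 3 ≤ Real.exp (-1) := by
    rw [Real.exp_neg, inv_eq_one_div]
    exact one_div_le_one_div_of_le (Real.exp_pos _) hexp1.le
  have hmono : ∀ {S : Set ℝ}, S ⊆ {ω : ℝ | |ω - m| < α} →
      ∫ ω in S, truncatedProfile C ε L R r n t ω ≤
        ∫ ω in {ω | |ω - m| < α}, truncatedProfile C ε L R r n t ω := fun hSS =>
    setIntegral_mono_set (integrable_truncatedProfile t).integrableOn
      (Filter.Eventually.of_forall (truncatedProfile_nonneg t)) hSS.eventuallyLE
  have hCr : r ≤ C * r := by nlinarith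
  have hI : ∀ ω, |ω - m| ≤ r → ω ∈ outputInterval C R r := by
    intro ω hω
    rw [abs_le] at hω
    constructor
    · linarith [hω.1, hm.1]
    · linarith [hω.2, hm.2]
  rw [le_div_iff₀ hJ0]
  -- The mass is collected on a ball of radius s about `t` if the noise is small, and of radius α/8
  -- about `m` otherwise; on either the profile is at least e^{-2}.
  rcases le_total s (α / 8) with hsα | hsα
  · rw [max_eq_right hsα] at ht
    have hball : ∀ ω ∈ Icc (t - s) (t + s), |t - ω| ≤ s ∧ |ω - m| ≤ α / 4 := by
      intro ω hω
      have h1 : |t - ω| ≤ s := by rw [abs_le]; constructor <;> linarith [hω.1, hω.2]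
      refine ⟨h1, ?_⟩
      have h2 := abs_sub_le ω t m
      rw [abs_sub_comm ω t] at h2
      linarith
    have e1 := le_setIntegral_truncatedProfile (C := C) (ε := ε) (L := L) (R := R) (r := r)
      (n := n) (t := t) (c := Real.exp (-1)) (S := Icc (t - s) (t + s)) measurableSet_Icc
      (fun ω hω => hI ω (by linarith [(hball ω hω).2])) (fun ω hω => by
        refine le_trans (le_of_eq ?_) (exp_neg_one_mul_le hlam hε.le hlam0.le (hball ω hω).1)
        rw [one_div_mul_cancel hs0.ne'])
    have e2 := hmono (S := Icc (t - s) (t + s)) fun ω hω =>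
      show |ω - m| < α by linarith [(hball ω hω).2]
    rw [Real.volume_real_Icc_of_le (by linarith)] at e1
    have e3 := mul_le_mul_of_nonneg_left hexpm hs0.le
    have e4 : 1 / 1080 * min 1 (α / s) * laplaceNormalizer C ε L R r n ≤
        1 / 1080 * 1 * (10 * s) := by
      have hle := min_le_left 1 (α / s)
      have : 0 ≤ min 1 (α / s) := by positivity
      gcongr
    linarith
  · rw [max_eq_left hsα] at ht
    have hball : ∀ ω ∈ Icc (m - α / 8) (m + α / 8), |t - ω| ≤ 2 * s ∧ |ω - m| ≤ α / 8 := by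
      intro ω hω
      have h1 : |ω - m| ≤ α / 8 := by rw [abs_le]; constructor <;> linarith [hω.1, hω.2]
      refine ⟨?_, h1⟩
      have h2 := abs_sub_le t m ω
      rw [abs_sub_comm m ω] at h2
      linarith
    have e1 := le_setIntegral_truncatedProfile (C := C) (ε := ε) (L := L) (R := R) (r := r)
      (n := n) (t := t) (c := Real.exp (-2)) (S := Icc (m - α / 8) (m + α / 8)) measurableSet_Icc
      (fun ω hω => hI ω (by linarith [(hball ω hω).2])) (fun ω hω => by
        refine le_trans (le_of_eq ?_) (exp_neg_one_mul_le hlam hε.le hlam0.le (hball ω hω).1)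
        congr 1
        field_simp)
    have e2 := hmono (S := Icc (m - α / 8) (m + α / 8)) fun ω hω =>
      show |ω - m| < α by linarith [(hball ω hω).2]
    rw [Real.volume_real_Icc_of_le (by linarith)] at e1
    have e5 : 1 / 9 ≤ Real.exp (-2) := by
      have : Real.exp (-2) = Real.exp (-1) * Real.exp (-1) := by
        rw [← Real.exp_add]; norm_num
      rw [this]; nlinarith
    have e3 := mul_le_mul_of_nonneg_left e5 hα.le
    have e4 : 1 / 1080 * min 1 (α / s) * laplaceNormalizer C ε L R r n ≤
        1 / 1080 * (α / s) * (10 * s) := by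
      have := min_le_right 1 (α / s)
      gcongr
    have e6 : 1 / 1080 * (α / s) * (10 * s) = α / 108 := by field_simp; norm_num
    linarith

/-- With x = n(Lα)² and y = nεLα, each choice of the two minima makes the product of order 1, √x or
y/C, and √x ≥ min(1, x). -/
lemma le_min_mul_sqrt_mul {n s g v : ℝ} (hC : 1 ≤ C) (hε : 0 < ε) (hL : 0 < L) (hα : 0 < α)
    (hn : 0 < n) (hs : s = 12 * C / (ε * L * n)) (hg : g = 1 / Real.sqrt (8 * n))
    (hv : v = min (L * max s (α / 8)) g) :
    min 1 (min (n * (L * α) ^ 2) (n * (ε * L * α))) / (288 * C) ≤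
      min 1 (α / s) * (Real.sqrt n * v) := by
  have hC0 : 0 < C := by linarith
  have hs0 : 0 < s := by rw [hs]; positivity
  have hsn : 0 < Real.sqrt n := Real.sqrt_pos.2 hn
  have hsx : Real.sqrt n * (L * α) = Real.sqrt (n * (L * α) ^ 2) := by
    rw [Real.sqrt_mul hn.le, Real.sqrt_sq (by positivity)]
  have hys : α / s = n * (ε * L * α) / (12 * C) := by
    rw [hs]; field_simp
  have hx0 : 0 ≤ n * (L * α) ^ 2 := by positivity
  have hy0 : 0 ≤ n * (ε * L * α) := by positivity
  set x := n * (L * α) ^ 2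
  set y := n * (ε * L * α)
  have hxs : min 1 x ≤ Real.sqrt x := by
    rcases le_total 1 x with h1 | h1
    · rw [min_eq_left h1]; exact Real.one_le_sqrt.2 h1
    · rw [min_eq_right h1]
      exact Real.le_sqrt_of_sq_le (by nlinarith)
  have hgs : 1 / 3 ≤ Real.sqrt n * g := by
    have h8 : 0 < Real.sqrt 8 := Real.sqrt_pos.2 (by norm_num)
    rw [hg, Real.sqrt_mul (by norm_num), mul_one_div, le_div_iff₀ (by positivity)]
    have : Real.sqrt 8 ≤ 3 := Real.sqrt_le_iff.2 ⟨by norm_num, by norm_num⟩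
    nlinarith
  set z := min 1 (min x y)
  have hz1 : z ≤ 1 := min_le_left _ _
  have hzx : z ≤ Real.sqrt x := le_trans (min_le_min_left _ (min_le_left _ _)) hxs
  have hzy : z ≤ y := (min_le_right _ _).trans (min_le_right _ _)
  have hz0 : 0 ≤ z := le_min zero_le_one (le_min hx0 hy0)
  have hCz : z / C ≤ z := div_le_self hz0 hC
  have hCz0 : 0 ≤ z / C := by positivity
  have e0 : z / (288 * C) = z / C / 288 := by rw [div_div, mul_comm C]
  rw [hv, mul_min_of_nonneg _ _ hsn.le, e0]
  rcases le_total s (α / 8) with hsα | hsα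
  · have h1 : min 1 (α / s) = 1 := by
      refine min_eq_left ?_
      rw [le_div_iff₀ hs0]; linarith
    rw [h1, one_mul, max_eq_right hsα]
    refine le_min ?_ (by linarith)
    have : Real.sqrt n * (L * (α / 8)) = Real.sqrt x / 8 := by rw [← hsx]; ring
    rw [this]
    linarith
  · have hαs : 0 < α / s := by positivity
    have h1 : α / s / 8 ≤ min 1 (α / s) := by
      refine le_min ?_ (by linarith)
      rw [div_div, div_le_iff₀ (by positivity)]; linarith
    rw [max_eq_left hsα]
    have hsnL : 0 ≤ min (Real.sqrt n * (L * s)) (Real.sqrt n * g) :=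
      le_min (by positivity) (by linarith)
    refine le_trans ?_ (mul_le_mul_of_nonneg_right h1 hsnL)
    rw [mul_min_of_nonneg _ _ (by positivity)]
    refine le_min ?_ ?_
    · have : α / s / 8 * (Real.sqrt n * (L * s)) = Real.sqrt x / 8 := by
        rw [← hsx]; field_simp
      rw [this]
      linarith
    · have e1 := mul_le_mul_of_nonneg_left hgs (by positivity : 0 ≤ α / s / 8)
      refine le_trans ?_ e1
      rw [hys]
      have e2 : z / C ≤ y / C := div_le_div_of_nonneg_right hzy hC0.le
      have e3 : y / (12 * C) / 8 * (1 / 3) = y / C / 288 := by field_simp; ring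
      rw [e3]
      linarith

/-- A lower bound for the success probability when the noise is small compared with `r`. -/
lemma failureProbability_le_of_large (hC : 64 ≤ C) (hε : 0 < ε) (hε1 : ε < 1)
    (hL : 0 < L) (hR : 0 < R) (hr : 0 < r) (hLr : L * r ≤ 1 / 2) (hD : IsAdmissible L R r D m)
    (hα : 0 < α) (hαr : α < r) (hM : 96 * C ≤ n * (ε * L * r))
    (h : 16 * Real.log (R / α + 1) ≤ n * (ε * L * r)) :
    failureProbability (n := n) (algorithm C ε L R r) D m α ≤ ENNReal.ofReal
      (1 - 1 / (10 ^ 8 * C) * min 1 (min (n * (L * α) ^ 2) (n * (ε * L * α)))) := by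
  have hC1 : 1 ≤ C := by linarith
  have hC0 : 0 < C := by linarith
  have hn0 : (0 : ℝ) ≤ n := Nat.cast_nonneg n
  have hεLr : ε * L * r ≤ 1 / 2 := by
    have : 0 < L * r := by positivity
    nlinarith
  have hLrn : n * (ε * L * r) ≤ L * n * r := by
    have : 0 ≤ L * n * r := by positivity
    nlinarith
  have hnreal : 12288 ≤ (n : ℝ) := by
    have : (n : ℝ) * (ε * L * r) ≤ n * (1 / 2) := mul_le_mul_of_nonneg_left hεLr hn0
    linarith
  have hnpos : (0 : ℝ) < n := by linarith
  have hn : 12288 ≤ n := by exact_mod_cast hnreal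
  set s := 12 * C / (ε * L * n) with hs
  have hs0 : 0 < s := by rw [hs]; positivity
  have hsr : s ≤ r / 8 := by
    rw [hs, div_le_iff₀ (by positivity)]
    linarith
  -- The median may deviate by the noise scale without reducing the order of the success
  -- probability. The mass v is then capped at (8n)^{-1/2}, the range where the hitting probability
  -- is linear in v.
  set u := max s (α / 8) with hu
  have hur : u ≤ r / 8 := max_le hsr (by linarith)
  have hu0 : 0 < u := lt_max_of_lt_left hs0
  set g := 1 / Real.sqrt (8 * n) with hg
  have hsqrt8 : 0 < Real.sqrt (8 * n) := Real.sqrt_pos.2 (by positivity)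
  have hg0 : 0 < g := by rw [hg]; positivity
  have hgsq : 8 * n * g ^ 2 = 1 := by
    rw [hg, div_pow, Real.sq_sqrt (by positivity)]; field_simp
  set v := min (L * u) g with hv
  have hv0 : 0 < v := lt_min (by positivity) hg0
  have hvg : v ≤ g := min_le_right _ _
  have hvu : v ≤ L * u := min_le_left _ _
  have hvr : v ≤ L * r / 8 := by
    have := mul_le_mul_of_nonneg_left hur hL.le
    linarith
  obtain ⟨a, b, hW, ha, hb, hab, hDa, hDb⟩ := hD.exists_isMedianWindow hL hr hLr hv0.le hvr
  have hvLu : v / L ≤ u := by rw [div_le_iff₀ hL]; linarith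
  have hvn : 8 * (n : ℝ) * v ^ 2 ≤ 1 := by
    rw [← hgsq]
    exact mul_le_mul_of_nonneg_left (pow_le_pow_left₀ hv0.le hvg 2) (by positivity)
  set p := 1 / (10 ^ 8 * C) * min 1 (min (n * (L * α) ^ 2) (n * (ε * L * α))) with hp
  have hp0 : 0 ≤ p := by rw [hp]; positivity
  have hA := isRandomizedAlgorithm_algorithm (n := n) hC1 hε hL hR hr hLr (by omega)
  refine failureProbability_le_one_sub hA hp0 ?_
  set μ := Measure.pi fun _ : Fin n => D with hμ
  set M := {X : Fin n → ℝ | leftMedian X ∈ Icc a b} with hMdef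
  set B := {X : Fin n → ℝ | ¬ WellSpread C L r 0 X} with hB
  have hMlow : ENNReal.ofReal (Real.sqrt n * v / 16) ≤ μ M := by
    obtain ⟨N, rfl⟩ : ∃ N, n = N + 1 := ⟨n - 1, by omega⟩
    exact hW.le_measure_leftMedian_mem (by omega) hv0.le (by linarith) hvn hab hDa hDb
  -- Defect k = 0 suffices: its conditional failure probability is at most 1/8 + 2/16. The bound
  -- must be relative to `M`, whose probability may be small.
  have hBM : μ (B ∩ M) ≤ ENNReal.ofReal (1 / 4) * μ M := by
    obtain ⟨N, rfl⟩ : ∃ N, n = N + 1 := ⟨n - 1, by omega⟩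
    refine (hW.measure_not_wellSpread_le hC hL hr (by omega) 0).trans
      (mul_le_mul_left (ENNReal.ofReal_le_ofReal ?_) _)
    have e1 : Real.exp (-(L * ((N + 1 : ℕ) : ℝ) * r / 30)) ≤ 1 / 16 := by
      have e2 : Real.exp (-(L * ((N + 1 : ℕ) : ℝ) * r / 30)) ≤ Real.exp (-15) :=
        Real.exp_le_exp.2 (by linarith)
      have e3 := Real.add_one_le_exp (15 : ℝ)
      refine e2.trans ?_
      rw [Real.exp_neg, inv_eq_one_div]
      exact one_div_le_one_div_of_le (by norm_num) (by linarith)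
    simp only [Nat.cast_zero, neg_zero, Real.exp_zero]
    linarith
  have hgood : ENNReal.ofReal (Real.sqrt n * v / 32) ≤ μ (M \ B) := by
    have e1 : μ M ≤ μ (B ∩ M) + μ (M \ B) := by
      refine (measure_mono ?_).trans (measure_union_le _ _)
      intro X hX
      by_cases hXB : X ∈ B
      · exact Or.inl ⟨hXB, hX⟩
      · exact Or.inr ⟨hX, hXB⟩
    have hMfin : μ M ≠ ⊤ := measure_ne_top _ _
    have e2 := ENNReal.toReal_mono (by finiteness) (e1.trans (add_le_add_left hBM _))
    rw [ENNReal.toReal_add (by finiteness) (by finiteness), ENNReal.toReal_mul,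
      ENNReal.toReal_ofReal (by norm_num)] at e2
    have e3 := (ENNReal.ofReal_le_iff_le_toReal hMfin).1 hMlow
    rw [ENNReal.ofReal_le_iff_le_toReal (by finiteness)]
    have : 0 ≤ (μ M).toReal := ENNReal.toReal_nonneg
    linarith
  have hsucc : ∀ X ∈ M \ B, ENNReal.ofReal (1 / 3240 * min 1 (α / s)) ≤
      algorithm C ε L R r X {ω | |ω - m| < α} := by
    rintro X ⟨hXM, hXB⟩
    have hws : WellSpread C L r 0 X := not_not.1 hXB
    have hXM' : leftMedian X ∈ Icc a b := hXM
    have hm := hD.mem_Icc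
    have ht : |leftMedian X - m| ≤ u := by
      rw [abs_le]; exact ⟨by linarith [hXM'.1], by linarith [hXM'.2]⟩
    have hrange : leftMedian X ∈ Icc (-R - r / 2) (R + r / 2) :=
      ⟨by linarith [hm.1, hXM'.1], by linarith [hm.2, hXM'.2]⟩
    have hS : MeasurableSet {ω : ℝ | |ω - m| < α} :=
      measurableSet_lt (by fun_prop) measurable_const
    refine le_trans (ENNReal.ofReal_le_ofReal ?_)
      (hws.le_algorithm_apply hC1 hε hL hR hr hLr (by omega) hrange hS)
    have e1 := le_setIntegral_div_normalizer hC1 hε hL hR hr hα hαr (by omega)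
      (by linarith) h hm hs hsr ht
    have e2 : 1 / 3 ≤ Real.exp (-(ε / 2 * (2 * ((0 : ℕ) : ℝ) + 1))) := by
      have e3 : Real.exp (-1) ≤ Real.exp (-(ε / 2 * (2 * ((0 : ℕ) : ℝ) + 1))) :=
        Real.exp_le_exp.2 (by push_cast; linarith)
      refine le_trans ?_ e3
      rw [Real.exp_neg, inv_eq_one_div]
      exact one_div_le_one_div_of_le (Real.exp_pos _) (Real.exp_one_lt_d9.trans (by norm_num)).le
    have e4 : 0 ≤ 1 / 1080 * min 1 (α / s) := by positivity
    calc 1 / 3240 * min 1 (α / s) = 1 / 3 * (1 / 1080 * min 1 (α / s)) := by ring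
      _ ≤ _ := mul_le_mul e2 e1 e4 (Real.exp_pos _).le
  have hreal : p ≤ 1 / 3240 * min 1 (α / s) * (Real.sqrt n * v / 32) := by
    have key := le_min_mul_sqrt_mul hC1 hε hL hα hnpos hs hg hv
    set z := min 1 (min (n * (L * α) ^ 2) (n * (ε * L * α)))
    set Q := min 1 (α / s) * (Real.sqrt n * v) with hQ
    have hz0 : 0 ≤ z / (288 * C) := by positivity
    have h1 : p = z / (288 * C) * (288 / 10 ^ 8) := by rw [hp]; field_simp
    have h2 : 1 / 3240 * min 1 (α / s) * (Real.sqrt n * v / 32) = Q / 103680 := by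
      rw [hQ]; ring
    rw [h1, h2]
    linarith only [key, hz0]
  calc ENNReal.ofReal p
      ≤ ENNReal.ofReal (1 / 3240 * min 1 (α / s)) * ENNReal.ofReal (Real.sqrt n * v / 32) := by
        rw [← ENNReal.ofReal_mul (by positivity)]
        exact ENNReal.ofReal_le_ofReal hreal
    _ ≤ ENNReal.ofReal (1 / 3240 * min 1 (α / s)) * μ {X | ENNReal.ofReal
          (1 / 3240 * min 1 (α / s)) ≤ algorithm C ε L R r X {ω | |ω - m| < α}} :=
        mul_le_mul_right (hgood.trans (measure_mono hsucc)) _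
    _ ≤ _ := mul_meas_ge_le_lintegral ((Measure.measurable_coe
        (measurableSet_lt (by fun_prop) measurable_const)).comp hA.1) _

end

end PrivateMedian

/-! ### Choice of constants and the theorem. -/

namespace PrivateMedian

/-- The three lower bounds on the sample size that follow from a lower bound by a sum. -/
lemma le_of_mul_sum_le {K Λ l c ε L r α n : ℝ} (hK : 0 ≤ K) (hΛ : 0 ≤ Λ) (hl : 0 ≤ l) (hc : 0 ≤ c)
    (hε : 0 < ε) (hL : 0 < L) (hr : 0 < r) (hα : 0 < α)
    (h : K * (Λ / (L ^ 2 * α ^ 2) + c * (Λ / (ε * L * α)) + l / (ε * L * r)) ≤ n) :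
    K * Λ ≤ n * (L * α) ^ 2 ∧ K * (c * Λ) ≤ n * (ε * L * α) ∧ K * l ≤ n * (ε * L * r) := by
  have h1 : 0 ≤ Λ / (L ^ 2 * α ^ 2) := by positivity
  have h2 : 0 ≤ c * (Λ / (ε * L * α)) := by positivity
  have h3 : 0 ≤ l / (ε * L * r) := by positivity
  refine ⟨?_, ?_, ?_⟩
  · have : K * (Λ / (L ^ 2 * α ^ 2)) ≤ n :=
      (mul_le_mul_of_nonneg_left (by linarith) hK).trans h
    rwa [← mul_div_assoc, div_le_iff₀ (by positivity), ← mul_pow] at this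
  · have : K * (c * (Λ / (ε * L * α))) ≤ n :=
      (mul_le_mul_of_nonneg_left (by linarith) hK).trans h
    rwa [← mul_div_assoc, ← mul_div_assoc, div_le_iff₀ (by positivity)] at this
  · have : K * (l / (ε * L * r)) ≤ n :=
      (mul_le_mul_of_nonneg_left (by linarith) hK).trans h
    rwa [← mul_div_assoc, div_le_iff₀ (by positivity)] at this

lemma log_div_add_one_nonneg {R α : ℝ} (hR : 0 < R) (hα : 0 < α) : 0 ≤ Real.log (R / α + 1) := by
  refine Real.log_nonneg ?_
  have : 0 < R / α := by positivity
  linarith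

/-- For failure probabilities that are bounded away from `1`, the constant does not depend
on `C`. -/
theorem exists_accuracy_of_le {b : ℝ} (hb : 0 < b) (hb1 : b < 1) :
    ∃ K : ℝ, 128 ≤ K ∧ ∀ C ε L R r : ℝ, 64 ≤ C → 0 < ε → ε < 1 → 0 < L → 0 < R → 0 < r →
      L * r ≤ 1 / 2 → ∀ (D : Measure ℝ) [IsProbabilityMeasure D] (m : ℝ),
      IsAdmissible L R r D m → ∀ α β : ℝ, 0 < α → α < r → 0 < β → β ≤ b → ∀ n : ℕ,
      K * Real.log (1 / β) ≤ n * (L * α) ^ 2 →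
      K * (C * Real.log (1 / β)) ≤ n * (ε * L * α) →
      K * Real.log (R / α + 1) ≤ n * (ε * L * r) →
      failureProbability (n := n) (algorithm C ε L R r) D m α ≤ ENNReal.ofReal β := by
  have hlog : 0 < Real.log (1 / b) := Real.log_pos (by rw [lt_div_iff₀ hb]; linarith)
  -- Chosen so that (K/64 - 2) log(1/β) ≥ 6 for all β ≤ b.
  refine ⟨64 * (2 + 6 / Real.log (1 / b)), ?_, ?_⟩
  · have : 0 < 6 / Real.log (1 / b) := by positivity
    linarith
  intro C ε L R r hC hε hε1 hL hR hr hLr D _ m hD α β hα hαr hβ hβb n h1 h2 h3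
  refine failureProbability_le_of_le hC hε hε1 hL hR hr hLr hD hα hαr hβ (by linarith) h1 h2 h3 ?_
  have e1 : Real.log (1 / b) ≤ Real.log (1 / β) :=
    Real.log_le_log (by positivity) (one_div_le_one_div_of_le hβ hβb)
  have e2 : (64 * (2 + 6 / Real.log (1 / b)) / 64 - 2) * Real.log (1 / β) =
      6 / Real.log (1 / b) * Real.log (1 / β) := by ring
  rw [e2, div_mul_eq_mul_div, le_div_iff₀ hlog]
  linarith

/-- For every sample size, the success probability is at least of the order of the parameters that
control the deviations of the median and of the noise. -/
theorem exists_le_one_sub {C : ℝ} (hC : 64 ≤ C) :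
    ∃ c : ℝ, 0 < c ∧ ∀ ε L R r : ℝ, 0 < ε → ε < 1 → 0 < L → 0 < R → 0 < r →
      L * r ≤ 1 / 2 → ∀ (D : Measure ℝ) [IsProbabilityMeasure D] (m : ℝ),
      IsAdmissible L R r D m → ∀ α : ℝ, 0 < α → α < r → ∀ n : ℕ, 0 < n →
      16 * Real.log (R / α + 1) ≤ n * (ε * L * r) →
      failureProbability (n := n) (algorithm C ε L R r) D m α ≤ ENNReal.ofReal
        (1 - c * min 1 (min (n * (L * α) ^ 2) (n * (ε * L * α)))) := by
  have hC0 : 0 < C := by linarith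
  -- At nεLr = 96C the noise scale 12C/(εLn) equals r/8.
  set M := 96 * C with hM
  set c₁ := Real.exp (-M) * (1 / (M * (Real.exp M + 4 * C))) with hc₁
  set c₂ := 1 / (10 ^ 8 * C) with hc₂
  have hc₁0 : 0 < c₁ := by positivity
  have hc₂0 : 0 < c₂ := by positivity
  refine ⟨min c₁ c₂, lt_min hc₁0 hc₂0, ?_⟩
  intro ε L R r hε hε1 hL hR hr hLr D _ m hD α hα hαr n hn h
  have hz0 : 0 ≤ min 1 (min ((n : ℝ) * (L * α) ^ 2) (n * (ε * L * α))) :=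
    le_min zero_le_one (le_min (by positivity) (by positivity))
  rcases le_total ((n : ℝ) * (ε * L * r)) M with hnM | hnM
  · refine (failureProbability_le_of_small (by linarith) hε hL hR hr hLr hD hα hαr hn hnM h).trans
      (ENNReal.ofReal_le_ofReal (sub_le_sub_left ?_ _))
    exact mul_le_mul (min_le_left _ _) ((min_le_right _ _).trans (min_le_right _ _)) hz0 hc₁0.le
  · refine (failureProbability_le_of_large hC hε hε1 hL hR hr hLr hD hα hαr hnM h).trans
      (ENNReal.ofReal_le_ofReal (sub_le_sub_left ?_ _))
    exact mul_le_mul_of_nonneg_right (min_le_right _ _) hz0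

/-- Accuracy for a fixed `C` and every failure probability in `(0, 1)`. -/
theorem exists_accuracy {C : ℝ} (hC : 64 ≤ C) :
    ∃ K : ℝ, 0 < K ∧ ∀ ε L R r : ℝ, 0 < ε → ε < 1 → 0 < L → 0 < R → 0 < r →
      L * r ≤ 1 / 2 → ∀ (D : Measure ℝ) [IsProbabilityMeasure D] (m : ℝ),
      IsAdmissible L R r D m → ∀ α β : ℝ, 0 < α → α < r → 0 < β → β < 1 → ∀ n : ℕ,
      K * Real.log (1 / β) ≤ n * (L * α) ^ 2 →
      K * Real.log (1 / β) ≤ n * (ε * L * α) →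
      K * Real.log (R / α + 1) ≤ n * (ε * L * r) →
      failureProbability (n := n) (algorithm C ε L R r) D m α ≤ ENNReal.ofReal β := by
  have hC0 : 0 < C := by linarith
  obtain ⟨K₁, hK₁, hacc⟩ := exists_accuracy_of_le (b := 1 / 2) (by norm_num) (by norm_num)
  obtain ⟨c, hc, hsmall⟩ := exists_le_one_sub hC
  set Q := K₁ * C with hQ
  have hQ1 : K₁ ≤ Q := by rw [hQ]; nlinarith
  have hQ0 : 0 < Q := by linarith
  refine ⟨max Q (Q / c), lt_max_of_lt_left hQ0, ?_⟩
  intro ε L R r hε hε1 hL hR hr hLr D _ m hD α β hα hαr hβ hβ1 n h1 h2 h3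
  have hl := log_div_add_one_nonneg hR hα
  have hΛ : 0 < Real.log (1 / β) := Real.log_pos (by rw [lt_div_iff₀ hβ]; linarith)
  have h3' : K₁ * Real.log (R / α + 1) ≤ n * (ε * L * r) :=
    (mul_le_mul_of_nonneg_right (hQ1.trans (le_max_left _ _)) hl).trans h3
  have hmaxQ : Q ≤ max Q (Q / c) := le_max_left _ _
  rcases le_or_gt β (1 / 2) with hβ2 | hβ2
  · refine hacc C ε L R r hC hε hε1 hL hR hr hLr D m hD α β hα hαr hβ hβ2 n ?_ ?_ h3'
    · exact (mul_le_mul_of_nonneg_right (hQ1.trans hmaxQ) hΛ.le).trans h1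
    · rw [← mul_assoc]
      exact (mul_le_mul_of_nonneg_right hmaxQ hΛ.le).trans h2
  -- If n already suffices for failure probability 1/2, this is below β. Otherwise min(x, y) ≤ Q,
  -- and the success probability is at least c min(x, y)/Q ≥ log(1/β) ≥ 1 - β, by the term Q/c in
  -- the constant.
  by_cases hlarge : K₁ * Real.log (1 / (1 / 2)) ≤ n * (L * α) ^ 2 ∧
      K₁ * (C * Real.log (1 / (1 / 2))) ≤ n * (ε * L * α)
  · exact (hacc C ε L R r hC hε hε1 hL hR hr hLr D m hD α (1 / 2) hα hαr (by norm_num) le_rfl n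
      hlarge.1 hlarge.2 h3').trans (ENNReal.ofReal_le_ofReal hβ2.le)
  have hlog2 : Real.log (1 / (1 / 2)) ≤ 1 := by
    rw [one_div_one_div]
    have := Real.log_two_lt_d9
    linarith
  have hn : 0 < n := by
    rcases Nat.eq_zero_or_pos n with rfl | hn
    · have : 0 < max Q (Q / c) * Real.log (1 / β) := mul_pos (by linarith) hΛ
      simp only [Nat.cast_zero, zero_mul] at h1
      linarith
    · exact hn
  refine (hsmall ε L R r hε hε1 hL hR hr hLr D m hD α hα hαr n hn ?_).trans
    (ENNReal.ofReal_le_ofReal ?_)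
  · exact (mul_le_mul_of_nonneg_right (by linarith) hl).trans h3'
  set x := (n : ℝ) * (L * α) ^ 2
  set y := (n : ℝ) * (ε * L * α)
  set Λ := Real.log (1 / β) with hΛdef
  have hxy0 : 0 ≤ min x y := le_min (by positivity) (by positivity)
  have hxyQ : min x y ≤ Q := by
    rw [not_and_or, not_le, not_le] at hlarge
    rcases hlarge with h | h
    · refine (min_le_left _ _).trans (h.le.trans ?_)
      have := mul_le_mul_of_nonneg_left hlog2 (by linarith : 0 ≤ K₁)
      linarith
    · refine (min_le_right _ _).trans (h.le.trans ?_)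
      rw [← mul_assoc, ← hQ]
      have := mul_le_mul_of_nonneg_left hlog2 hQ0.le
      linarith
  have hxyΛ : Q / c * Λ ≤ min x y :=
    le_min ((mul_le_mul_of_nonneg_right (le_max_right _ _) hΛ.le).trans h1)
      ((mul_le_mul_of_nonneg_right (le_max_right _ _) hΛ.le).trans h2)
  have hmin : min x y / Q ≤ min 1 (min x y) := by
    refine le_min ?_ (div_le_self hxy0 (by linarith))
    rwa [div_le_one hQ0]
  have hfin : Λ ≤ c * min 1 (min x y) := by
    calc Λ = c * (Q / c * Λ / Q) := by field_simp
      _ ≤ c * (min x y / Q) :=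
          mul_le_mul_of_nonneg_left (div_le_div_of_nonneg_right hxyΛ hQ0.le) hc.le
      _ ≤ _ := mul_le_mul_of_nonneg_left hmin hc.le
  have hβΛ : β = Real.exp (-Λ) := by
    rw [hΛdef, one_div, Real.log_inv, neg_neg, Real.exp_log hβ]
  have := Real.add_one_le_exp (-Λ)
  rw [← hβΛ] at this
  linarith

end PrivateMedian

theorem mainTheorem2 :
    ∃ C₀ : ℝ, 0 < C₀ ∧
      -- the algorithm is well defined and differentially private
      (∀ C : ℝ, C₀ ≤ C → ∀ ε L R r : ℝ, 0 < ε → ε < 1 → 0 < L → 0 < R → 0 < r → L * r ≤ 1 / 2 →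
        ∀ n : ℕ, 0 < n →
          PrivateMedian.IsRandomizedAlgorithm
            (PrivateMedian.algorithm C ε L R r : (Fin n → ℝ) → MeasureTheory.Measure ℝ) ∧
          PrivateMedian.IsDifferentiallyPrivate ε
            (PrivateMedian.algorithm C ε L R r : (Fin n → ℝ) → MeasureTheory.Measure ℝ)) ∧
      -- accuracy for a constant `C`, for every `β ∈ (0, 1)`
      (∀ C : ℝ, C₀ ≤ C → ∃ K : ℝ, 0 < K ∧
        ∀ ε L R r : ℝ, 0 < ε → ε < 1 → 0 < L → 0 < R → 0 < r → L * r ≤ 1 / 2 →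
        ∀ (D : MeasureTheory.Measure ℝ) [MeasureTheory.IsProbabilityMeasure D] (m : ℝ),
          PrivateMedian.IsAdmissible L R r D m →
        ∀ α β : ℝ, 0 < α → α < r → 0 < β → β < 1 →
        ∀ n : ℕ,
          K * (Real.log (1 / β) / (L ^ 2 * α ^ 2) + Real.log (1 / β) / (ε * L * α)
            + Real.log (R / α + 1) / (ε * L * r)) ≤ (n : ℝ) →
          PrivateMedian.failureProbability (n := n)
            (PrivateMedian.algorithm C ε L R r) D m α ≤ ENNReal.ofReal β) ∧
      -- accuracy with a constant `K` that does not depend on `C`, which may thus vary with `n`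
      (∀ b : ℝ, 0 < b → b < 1 → ∃ K : ℝ, 0 < K ∧
        ∀ C : ℕ → ℝ, (∀ n, C₀ ≤ C n) →
        ∀ ε L R r : ℝ, 0 < ε → ε < 1 → 0 < L → 0 < R → 0 < r → L * r ≤ 1 / 2 →
        ∀ (D : MeasureTheory.Measure ℝ) [MeasureTheory.IsProbabilityMeasure D] (m : ℝ),
          PrivateMedian.IsAdmissible L R r D m →
        ∀ α β : ℝ, 0 < α → α < r → 0 < β → β ≤ b →
        ∀ n : ℕ,
          K * (Real.log (1 / β) / (L ^ 2 * α ^ 2) + C n * (Real.log (1 / β) / (ε * L * α))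
            + Real.log (R / α + 1) / (ε * L * r)) ≤ (n : ℝ) →
          PrivateMedian.failureProbability (n := n)
            (PrivateMedian.algorithm (C n) ε L R r) D m α ≤ ENNReal.ofReal β) := by
  refine ⟨64, by norm_num, ?_, ?_, ?_⟩
  · intro C hC ε L R r hε _ hL hR hr hLr n hn
    exact ⟨PrivateMedian.isRandomizedAlgorithm_algorithm (by linarith) hε hL hR hr hLr hn,
      PrivateMedian.isDifferentiallyPrivate_algorithm (by linarith) hε hL hR hr hLr hn⟩
  · intro C hC
    obtain ⟨K, hK, h⟩ := PrivateMedian.exists_accuracy hC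
    refine ⟨K, hK, ?_⟩
    intro ε L R r hε hε1 hL hR hr hLr D _ m hD α β hα hαr hβ hβ1 n hn
    have hΛ : 0 ≤ Real.log (1 / β) := Real.log_nonneg (by rw [le_div_iff₀ hβ]; linarith)
    obtain ⟨h1, h2, h3⟩ := PrivateMedian.le_of_mul_sum_le (n := (n : ℝ)) (c := 1) hK.le hΛ
      (PrivateMedian.log_div_add_one_nonneg hR hα) zero_le_one hε hL hr hα
      (by rw [one_mul]; exact hn)
    rw [one_mul] at h2
    exact h ε L R r hε hε1 hL hR hr hLr D m hD α β hα hαr hβ hβ1 n h1 h2 h3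
  · intro b hb hb1
    obtain ⟨K, hK, h⟩ := PrivateMedian.exists_accuracy_of_le hb hb1
    refine ⟨K, by linarith, ?_⟩
    intro C hC ε L R r hε hε1 hL hR hr hLr D _ m hD α β hα hαr hβ hβb n hn
    have hΛ : 0 ≤ Real.log (1 / β) := Real.log_nonneg (by rw [le_div_iff₀ hβ]; linarith)
    obtain ⟨h1, h2, h3⟩ := PrivateMedian.le_of_mul_sum_le (by linarith) hΛ
      (PrivateMedian.log_div_add_one_nonneg hR hα) (by linarith [hC n]) hε hL hr hα hn
    exact h (C n) ε L R r (hC n) hε hε1 hL hR hr hLr D m hD α β hα hαr hβ hβb n h1 h2 h3
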